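/- Let $N\ge 2$, let $x_0\in\mathbb R^n$, and let $\mathcal V=\{1,\dots,N\}$. On a probability space let $\mathcal A(k)=[w_{ij}(k)]$, $k\ge 0$, be random real $N\times N$ weighted adjacency matrices with zero diagonal (node $j$ is a neighbour of node $i$ at time $k$, $j\in\mathcal N_i(k)$, iff $w_{ij}(k)\neq 0$), $H_i(k)\in\mathbb R^{n_i\times n}$ random regression matrices, and $v_i(k)\in\mathbb R^{n_i}$, $\xi_{ji}(k)\in\mathbb R^n$ random noises ($i,j\in\mathcal V$, $k\ge0$). Let $\mathcal F(k)$ be the $\sigma$-algebra generated by $\mathcal A(s),H_i(s),v_i(s),\xi_{ji}(s)$ for $i,j\in\mathcal V$, $0\le s\le k$, and let $\mathcal F(-1)$ be trivial. Let $\mathcal D(k)=\mathrm{diag}\big(\sum_j w_{1j}(k),\dots,\sum_j w_{Nj}(k)\big)$, $\mathcal L(k)=\mathcal D(k)-\mathcal A(k)$ and $\mathcal H(k)=\mathrm{diag}(H_1(k),\dots,H_N(k))$ (block diagonal). Write $v(k)$, $\xi(k)$ for the stacked noise vectors. Starting from deterministic $x_i(0)\in\mathbb R^n$, and with $y_i(k)=H_i(k)x_0+v_i(k)$,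 $f_{ji}:\mathbb R^n\to\mathbb R$ measurable and $a(k),b(k),\lambda(k)$ real sequences, define $$x_i(k+1)=x_i(k)+a(k)H_i^T(k)\big(y_i(k)-H_i(k)x_i(k)\big)+b(k)\sum_{j\in\mathcal N_i(k)}w_{ij}(k)\big(\mu_{ji}(k)-x_i(k)\big)-\lambda(k)x_i(k),$$ $$\mu_{ji}(k)=x_j(k)+f_{ji}(x_j(k)-x_i(k))\,\xi_{ji}(k).$$ Suppose: - (conditionally balanced graphs) for every $k\ge 0$, almost surely the matrix $\mathbb E[\mathcal A(k)\mid\mathcal F(k-1)]$ has nonnegative entries and, for each $i$, its $i$-th row sum equals its $i$-th column sum; - (A1) there are constants $\sigma,c$ with $|f_{ji}(x)|\le\sigma\|x\|+c$ for all $x\in\mathbb R^n$ and all $i,j$; - (A2) $\{v(k),\mathcal F(k)\}$ and $\{\xi(k),\mathcal F(k)\}$ are martingale difference sequences, the noises $\{v(k),\xi(k),k\ge0\}$ are independent of $\{\mathcal A(k),\mathcal H(k),k\ge0\}$, and for some constant $\beta_v$, $\sup_{k\ge0}\mathbb E[\|v(k)\|^2+\|\xi(k)\|^2\mid\mathcal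 F(k-1)]\le\beta_v$ a.s.; - (i) the symmetrized graphs are uniformly conditionally jointly connected: there are an integer $h_1\ge1$ and $\theta_1>0$ such that almost surely, for all $k\ge0$, the second smallest eigenvalue of $\sum_{i=kh_1}^{(k+1)h_1-1}\mathbb E[\mathcal L_{\widehat{\mathcal G}(i)}\mid\mathcal F(kh_1-1)]$ is at least $\theta_1$, where $\mathcal L_{\widehat{\mathcal G}(i)}$ is the Laplacian matrix of the graph with adjacency matrix $\frac12(\mathcal A(i)+\mathcal A^T(i))$; - (ii) the regression matrices are uniformly conditionally spatio-temporally jointly observable: there are an integer $h_2\ge1$ and $\theta_2>0$ such that almost surely, for all $k\ge0$, the smallest eigenvalue of $\sum_{i=1}^N\sum_{j=kh_2}^{(k+1)h_2-1}\mathbb E[H_i^T(j)H_i(j)\mid\mathcal F(kh_2-1)]$ is at least $\theta_2$; - (iii) there are an integer $h\ge1$ and $\rho_0>0$ such that, with $p=2^{\max\{h,2\}}$ and the matrix $2$-norm, almost surely $\sup_{k\ge0}\big(\|\mathcal L(k)\|+(\mathbb E[\|\mathcal H^T(k)\mathcal H(k)\|^{p}\mid\mathcal F(k-1)])^{1/p}\big)\le\rho_0$.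 (I) If (C1) the sequences $a,b,\lambda$ are nonnegative and nonincreasing with $\sum_{k}\min\{a(k),b(k)\}=\infty$, $\sum_{k}(a^2(k)+b^2(k)+\lambda(k))<\infty$, $a(k)=\mathcal O(a(k+1))$, $b(k)=\mathcal O(b(k+1))$ and $\lambda(k)=o(\min\{a(k),b(k)\})$, then almost surely $\lim_{k\to\infty}x_i(k)=x_0$ for all $i\in\mathcal V$. (II) If (C2) the sequences $a,b,\lambda$ are nonnegative, nonincreasing and tend to zero, with $\sum_{k}\min\{a(k),b(k)\}=\infty$, $a(k)=\mathcal O(a(k+1))$, $b(k)=\mathcal O(b(k+1))$ and $a^2(k)+b^2(k)+\lambda(k)=o(\min\{a(k),b(k)\})$, then $\lim_{k\to\infty}\mathbb E[\|x_i(k)-x_0\|^2]=0$ for all $i\in\mathcal V$ (these expectations being finite). -/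

import Mathlib

open MeasureTheory ProbabilityTheory Filter Topology Asymptotics

noncomputable section

namespace DecReg

/-! ### Matrices -/

/-- The `r`-th smallest eigenvalue (`r = 0, 1, …`, counted with multiplicity) of a real symmetric
matrix. Mathlib's `eigenvalues₀` lists the eigenvalues in decreasing order. The value is `0` when
the matrix is not symmetric or has at most `r` eigenvalues. -/
def ascEigenvalue {m : ℕ} (r : ℕ) (M : Matrix (Fin m) (Fin m) ℝ) : ℝ :=
  if h : M.IsHermitian ∧ r < m then
    h.1.eigenvalues₀ ⟨m - 1 - r, by rw [Fintype.card_fin]; omega⟩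
  else 0

/-- The smallest eigenvalue of a real symmetric matrix. -/
def lambdaMin {m : ℕ} (M : Matrix (Fin m) (Fin m) ℝ) : ℝ := ascEigenvalue 0 M

/-- The second smallest eigenvalue of a real symmetric matrix. -/
def lambdaTwo {m : ℕ} (M : Matrix (Fin m) (Fin m) ℝ) : ℝ := ascEigenvalue 1 M

/-- The matrix 2-norm of a square matrix: the operator norm for the Euclidean norm. -/
def specNorm {ι : Type*} [Fintype ι] [DecidableEq ι] (M : Matrix ι ι ℝ) : ℝ :=
  ‖Matrix.toEuclideanCLM (n := ι) (𝕜 := ℝ) M‖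

/-- Conditional expectation of a random matrix, entry by entry. -/
def condExpMatrix {Ω ι κ : Type*} {mΩ : MeasurableSpace Ω} (μ : Measure Ω)
    (m : MeasurableSpace Ω) (M : Ω → Matrix ι κ ℝ) (ω : Ω) : Matrix ι κ ℝ :=
  Matrix.of fun i j => condExp m μ (fun ω' => M ω' i j) ω

/-! ### Weighted digraphs, given by their adjacency matrices

`w i j` is the weight of the edge from `j` to `i`. -/

/-- In-degree of `i`. -/
def inDegree {N : ℕ} (w : Matrix (Fin N) (Fin N) ℝ) (i : Fin N) : ℝ := ∑ j, w i j

/-- Out-degree of `i`. -/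
def outDegree {N : ℕ} (w : Matrix (Fin N) (Fin N) ℝ) (i : Fin N) : ℝ := ∑ j, w j i

/-- In-degree and out-degree agree at every node. -/
def IsBalanced {N : ℕ} (w : Matrix (Fin N) (Fin N) ℝ) : Prop :=
  ∀ i, inDegree w i = outDegree w i

/-- The Laplacian matrix: in-degree matrix minus adjacency matrix. -/
def laplacian {N : ℕ} (w : Matrix (Fin N) (Fin N) ℝ) : Matrix (Fin N) (Fin N) ℝ :=
  Matrix.diagonal (inDegree w) - w

/-- The neighbourhood of `i`: the nodes `j` for which `(j, i)` is an edge. -/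
def neighbors {N : ℕ} (w : Matrix (Fin N) (Fin N) ℝ) (i : Fin N) : Finset (Fin N) :=
  Finset.univ.filter fun j => w i j ≠ 0

/-- Adjacency matrix of the symmetrized graph. -/
def symmetrized {N : ℕ} (w : Matrix (Fin N) (Fin N) ℝ) : Matrix (Fin N) (Fin N) ℝ :=
  (1 / 2 : ℝ) • (w + w.transpose)

/-! ### The random data -/

/-- The random data of a network with `N` nodes and a parameter in `ℝⁿ`, on a measurable space `Ω`:
weighted adjacency matrices `A k` with zero diagonal, regression matrices `H k i` (node `i`, of size
`d i × n`), measurement noises `v k i` and communication noises `ξ k j i` (on the channel from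
`j` to `i`). -/
structure Network (Ω : Type*) [MeasurableSpace Ω] (N n : ℕ) (d : Fin N → ℕ) where
  A : ℕ → Ω → Matrix (Fin N) (Fin N) ℝ
  H : ℕ → (i : Fin N) → Ω → Matrix (Fin (d i)) (Fin n) ℝ
  v : ℕ → (i : Fin N) → Ω → EuclideanSpace ℝ (Fin (d i))
  ξ : ℕ → Fin N → Fin N → Ω → EuclideanSpace ℝ (Fin n)
  measurable_A : ∀ k i j, Measurable fun ω => A k ω i j
  measurable_H : ∀ k i r s, Measurable fun ω => H k i ω r s
  measurable_v : ∀ k i, Measurable (v k i)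
  measurable_ξ : ∀ k j i, Measurable (ξ k j i)
  A_diag : ∀ k ω i, A k ω i i = 0

variable {Ω : Type*} [mΩ : MeasurableSpace Ω] {N n : ℕ} {d : Fin N → ℕ}

namespace Network

/-- The σ-algebra generated by the graph and the regression matrices at time `k`. -/
def sigmaAH (net : Network Ω N n d) (k : ℕ) : MeasurableSpace Ω :=
  (⨆ i, ⨆ j, MeasurableSpace.comap (fun ω => net.A k ω i j) inferInstance) ⊔
  (⨆ i, ⨆ r, ⨆ s, MeasurableSpace.comap (fun ω => net.H k i ω r s) inferInstance)

/-- The σ-algebra generated by all noises at time `k`. -/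
def sigmaNoise (net : Network Ω N n d) (k : ℕ) : MeasurableSpace Ω :=
  (⨆ i, MeasurableSpace.comap (net.v k i) inferInstance) ⊔
  (⨆ j, ⨆ i, MeasurableSpace.comap (net.ξ k j i) inferInstance)

/-- `net.history k` is the σ-algebra generated by all data at the times `s < k`, that is
`𝓕(k - 1)`; in particular `net.history 0` is trivial. -/
def history (net : Network Ω N n d) (k : ℕ) : MeasurableSpace Ω :=
  ⨆ s, ⨆ _ : s < k, net.sigmaAH s ⊔ net.sigmaNoise s

/-- The Gram matrix `𝓗ᵀ(k) 𝓗(k)`, where `𝓗(k)` is block diagonal with blocks `H₁(k), …, H_N(k)`. -/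
def gram (net : Network Ω N n d) (k : ℕ) (ω : Ω) :
    Matrix ((_ : Fin N) × Fin n) ((_ : Fin N) × Fin n) ℝ :=
  (Matrix.blockDiagonal' fun i => net.H k i ω).transpose *
    Matrix.blockDiagonal' fun i => net.H k i ω

/-- `‖v(k)‖² + ‖ξ(k)‖²` for the stacked noise vectors. -/
def noiseSq (net : Network Ω N n d) (k : ℕ) (ω : Ω) : ℝ :=
  (∑ i, ‖net.v k i ω‖ ^ 2) + ∑ j, ∑ i, ‖net.ξ k j i ω‖ ^ 2

/-- The observation `yᵢ(k) = Hᵢ(k) x₀ + vᵢ(k)`. -/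
def obs (net : Network Ω N n d) (x0 : EuclideanSpace ℝ (Fin n)) (k : ℕ) (i : Fin N) (ω : Ω) :
    EuclideanSpace ℝ (Fin (d i)) :=
  Matrix.toEuclideanLin (net.H k i ω) x0 + net.v k i ω

/-- The message that `i` receives from `j` at time `k` when the current estimates are `x`. -/
def message (net : Network Ω N n d) (f : Fin N → Fin N → EuclideanSpace ℝ (Fin n) → ℝ)
    (x : Fin N → EuclideanSpace ℝ (Fin n)) (k : ℕ) (j i : Fin N) (ω : Ω) :
    EuclideanSpace ℝ (Fin n) :=
  x j + f j i (x j - x i) • net.ξ k j i ω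

/-- The estimates produced by the decentralized online regularized algorithm with gains `a`, `b`,
`lam` and initial estimates `xinit`. -/
def estimate (net : Network Ω N n d) (x0 : EuclideanSpace ℝ (Fin n))
    (f : Fin N → Fin N → EuclideanSpace ℝ (Fin n) → ℝ) (a b lam : ℕ → ℝ)
    (xinit : Fin N → EuclideanSpace ℝ (Fin n)) :
    ℕ → Ω → Fin N → EuclideanSpace ℝ (Fin n)
  | 0, _ => xinit
  | k + 1, ω => fun i =>
      let x := estimate net x0 f a b lam xinit k ω
      x i
        + a k • Matrix.toEuclideanLin (net.H k i ω).transpose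
            (net.obs x0 k i ω - Matrix.toEuclideanLin (net.H k i ω) (x i))
        + b k • ∑ j ∈ neighbors (net.A k ω) i,
            net.A k ω i j • (net.message f x k j i ω - x i)
        - lam k • x i

end Network

/-! ### Assumptions -/

/-- Linear growth of the noise intensity functions (which are Borel functions). -/
structure NoiseIntensityGrowth (f : Fin N → Fin N → EuclideanSpace ℝ (Fin n) → ℝ) : Prop where
  measurable : ∀ j i, Measurable (f j i)
  growth : ∃ σ b : ℝ, ∀ j i x, |f j i x| ≤ σ * ‖x‖ + b

/-- The noises are martingale differences with respect to `𝓕`, independent of the graphs and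
regression matrices, with uniformly bounded conditional second moments. -/
structure NoiseAssumption (μ : Measure Ω) (net : Network Ω N n d) : Prop where
  integrable_v : ∀ k i, Integrable (net.v k i) μ
  integrable_ξ : ∀ k j i, Integrable (net.ξ k j i) μ
  condExp_v : ∀ k i, condExp (net.history k) μ (net.v k i) =ᵐ[μ] 0
  condExp_ξ : ∀ k j i, condExp (net.history k) μ (net.ξ k j i) =ᵐ[μ] 0
  indep : Indep (⨆ k, net.sigmaNoise k) (⨆ k, net.sigmaAH k) μ
  integrable_sq : ∀ k, Integrable (net.noiseSq k) μ
  bounded : ∃ β : ℝ, ∀ᵐ ω ∂μ, ∀ k, condExp (net.history k) μ (net.noiseSq k) ω ≤ β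

/-- The graphs are conditionally balanced: the conditional adjacency matrices given the past are
a.s. nonnegative and balanced. -/
structure CondBalanced (μ : Measure Ω) (net : Network Ω N n d) : Prop where
  integrable : ∀ k i j, Integrable (fun ω => net.A k ω i j) μ
  nonneg : ∀ k, ∀ᵐ ω ∂μ, ∀ i j, 0 ≤ condExpMatrix μ (net.history k) (net.A k) ω i j
  balanced : ∀ k, ∀ᵐ ω ∂μ, IsBalanced (condExpMatrix μ (net.history k) (net.A k) ω)

/-- Uniform conditional joint connectivity of a sequence of random undirected graphs with adjacency
matrices `B k`, with respect to the σ-algebras `F k = 𝓕(k - 1)`. -/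
def UniformlyCondJointlyConnected (μ : Measure Ω) (F : ℕ → MeasurableSpace Ω)
    (B : ℕ → Ω → Matrix (Fin N) (Fin N) ℝ) : Prop :=
  (∀ k i j, Integrable (fun ω => B k ω i j) μ) ∧
  ∃ h : ℕ, 0 < h ∧ ∃ θ : ℝ, 0 < θ ∧ ∀ᵐ ω ∂μ, ∀ k,
    θ ≤ lambdaTwo (∑ i ∈ Finset.Ico (k * h) ((k + 1) * h),
      condExpMatrix μ (F (k * h)) (fun ω' => laplacian (B i ω')) ω)

/-- Uniform conditional spatio-temporal joint observability of the regression matrices. -/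
def UniformlyCondJointlyObservable (μ : Measure Ω) (net : Network Ω N n d) : Prop :=
  (∀ k i r s, Integrable (fun ω => ((net.H k i ω).transpose * net.H k i ω) r s) μ) ∧
  ∃ h : ℕ, 0 < h ∧ ∃ θ : ℝ, 0 < θ ∧ ∀ᵐ ω ∂μ, ∀ k,
    θ ≤ lambdaMin (∑ i : Fin N, ∑ j ∈ Finset.Ico (k * h) ((k + 1) * h),
      condExpMatrix μ (net.history (k * h))
        (fun ω' => (net.H j i ω').transpose * net.H j i ω') ω)

/-- The moment bound: with `p = 2 ^ max h 2`, a.s. for all `k`,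
`‖𝓛(k)‖ + (E[‖𝓗ᵀ(k)𝓗(k)‖ ^ p | 𝓕(k - 1)]) ^ (1 / p) ≤ ρ`. -/
structure MomentBound (μ : Measure Ω) (net : Network Ω N n d) (h : ℕ) (ρ : ℝ) : Prop where
  integrable : ∀ k, Integrable (fun ω => specNorm (net.gram k ω) ^ (2 ^ max h 2)) μ
  bound : ∀ᵐ ω ∂μ, ∀ k,
    specNorm (laplacian (net.A k ω)) +
      (condExp (net.history k) μ (fun ω' => specNorm (net.gram k ω') ^ (2 ^ max h 2)) ω) ^
        (1 / (2 ^ max h 2 : ℝ)) ≤ ρ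

/-- Gain condition for almost sure convergence. -/
structure GainC1 (a b lam : ℕ → ℝ) : Prop where
  nonneg : ∀ k, 0 ≤ a k ∧ 0 ≤ b k ∧ 0 ≤ lam k
  anti : Antitone a ∧ Antitone b ∧ Antitone lam
  diverge : Tendsto (fun T => ∑ k ∈ Finset.range T, min (a k) (b k)) atTop atTop
  summable : Summable fun k => a k ^ 2 + b k ^ 2 + lam k
  a_ratio : a =O[atTop] fun k => a (k + 1)
  b_ratio : b =O[atTop] fun k => b (k + 1)
  lam_small : lam =o[atTop] fun k => min (a k) (b k)

/-- Gain condition for mean square convergence. -/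
structure GainC2 (a b lam : ℕ → ℝ) : Prop where
  nonneg : ∀ k, 0 ≤ a k ∧ 0 ≤ b k ∧ 0 ≤ lam k
  anti : Antitone a ∧ Antitone b ∧ Antitone lam
  tendsto_zero : Tendsto a atTop (𝓝 0) ∧ Tendsto b atTop (𝓝 0) ∧ Tendsto lam atTop (𝓝 0)
  diverge : Tendsto (fun T => ∑ k ∈ Finset.range T, min (a k) (b k)) atTop atTop
  a_ratio : a =O[atTop] fun k => a (k + 1)
  b_ratio : b =O[atTop] fun k => b (k + 1)
  small : (fun k => a k ^ 2 + b k ^ 2 + lam k) =o[atTop] fun k => min (a k) (b k)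

end DecReg

end

open MeasureTheory ProbabilityTheory Filter Topology Asymptotics

set_option linter.unusedSectionVars false
set_option linter.unusedVariables false

noncomputable section

namespace DecReg

/-! ### Conditional expectations: products with past-measurable factors, and adjoining independent
information. -/

section Conditioning

variable {Ω : Type*} {mΩ : MeasurableSpace Ω} {μ : Measure Ω} {m : MeasurableSpace Ω}

/-! Write `e(k)` for the stacked error, `V(k) = E‖e(k)‖²` and `ε(k) = a(k)² + b(k)² + λ(k)`. The
error moves by a drift, which involves the graph and the regression matrices at time `k`, plus a
noise term. The noises are independent of all graphs and regression matrices, so the noise term at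
time `k` is orthogonal in `L²` even to square integrable quantities built from `𝓐(k)` and `𝓗(k)`
(`setIntegral_inner_noiseAt`). Expanding the square gives, also when integrated over any event of
`𝓕(k-1)`, `V(k+1) ≤ V(k) - 2 (b(k) P + a(k) O) + C ε(k) (1 + V(k))`. Here `P` is the expected
Dirichlet energy of `e(k)` on the graph and `O` the expected value of `∑ᵢ ‖Hᵢ(k) eᵢ(k)‖²`.
Conditional balance turns the consensus term into the Dirichlet energy, and the regularization
contributes a bias of order `λ(k)` only (`exists_step_constant`).

The energies at a single time may vanish, so a block of `h` steps is considered, with the state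
frozen at its first time `T`. The frozen state is known at the start of the block, hence the
conditional hypotheses apply to it: connectivity controls its deviation from the average,
observability controls the average, and the energies over the block add up to at least `c V(T)`
(`DataBounds.excitation`). The mean square displacement from `e(T)` inside the block is `O(∑ ε) (1 +
V(T))`, so freezing costs no more than the error terms already present. With `g` the smaller of the
two gains at the end of the block, `block_descent` gives `V(T+h) ≤ V(T) - c g V(T) + C (∑ ε) (1 +
V(T))`.

Under C2 the sum of `ε` over a block is `o(g)`, and a scalar recursion yields `V → 0`. Under C1 the
sum of all `ε` is finite: the one-step inequality makes `‖e(k)‖²` an almost supermartingale, which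
converges almost surely; the block inequality makes `V` arbitrarily small infinitely often; and
Fatou's lemma identifies the almost sure limit as `0`. -/

theorem integrable_condExp_mul {X Y : Ω → ℝ} (hX : Integrable X μ)
    (hY : StronglyMeasurable[m] Y) (hXY : Integrable (fun ω => X ω * Y ω) μ) :
    Integrable (fun ω => (μ[X|m]) ω * Y ω) μ :=
  (integrable_condExp (m := m) (f := fun ω => X ω * Y ω) (μ := μ)).congr
    (condExp_mul_of_stronglyMeasurable_right hY hXY hX)

theorem setIntegral_condExp_mul [IsFiniteMeasure μ] (hm : m ≤ mΩ) {X Y : Ω → ℝ}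
    (hX : Integrable X μ) (hY : StronglyMeasurable[m] Y)
    (hXY : Integrable (fun ω => X ω * Y ω) μ) {s : Set Ω} (hs : MeasurableSet[m] s) :
    ∫ ω in s, (μ[X|m]) ω * Y ω ∂μ = ∫ ω in s, X ω * Y ω ∂μ := by
  rw [← setIntegral_condExp hm hXY hs]
  refine setIntegral_congr_ae (hm s hs) ?_
  filter_upwards [condExp_mul_of_stronglyMeasurable_right hY hXY hX] with ω h _
  exact h.symm

/-- If `X ≥ 0` has conditional expectation at most `C` given `m`, then `∫ X Y ≤ C ∫ Y` for every
integrable `m`-measurable `Y ≥ 0`, and `X Y` is integrable. -/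
theorem lintegral_mul_le_of_condExp_le [IsFiniteMeasure μ] (hm : m ≤ mΩ) {X Y : Ω → ℝ} {C : ℝ}
    (hX : Integrable X μ) (hX0 : 0 ≤ᵐ[μ] X) (hXC : ∀ᵐ ω ∂μ, (μ[X|m]) ω ≤ C)
    (hY : StronglyMeasurable[m] Y) :
    ∫⁻ ω, ENNReal.ofReal (X ω) * ENNReal.ofReal (Y ω) ∂μ
      ≤ ENNReal.ofReal C * ∫⁻ ω, ENNReal.ofReal (Y ω) ∂μ := by
  have hYm : Measurable[m] fun ω => ENNReal.ofReal (Y ω) :=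
    ENNReal.measurable_ofReal.comp hY.measurable
  have hXm : AEMeasurable (fun ω => ENNReal.ofReal (X ω)) μ :=
    hX.aestronglyMeasurable.aemeasurable.ennreal_ofReal
  set ν := μ.withDensity fun ω => ENNReal.ofReal (X ω) with hν
  -- Since `Y` is `m`-measurable, only the restrictions to `m` of `X dμ` and of `μ` matter, and the
  -- conditional bound says exactly that the first is at most `C` times the second. Working with
  -- `lintegral` avoids any integrability of `X Y`, which is a consequence.
  have key : ν.trim hm ≤ ENNReal.ofReal C • μ.trim hm := by
    refine Measure.le_iff.2 fun s hs => ?_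
    rw [Measure.smul_apply, trim_measurableSet_eq hm hs, trim_measurableSet_eq hm hs,
      withDensity_apply _ (hm s hs),
      ← ofReal_integral_eq_lintegral_ofReal hX.integrableOn (ae_restrict_of_ae hX0),
      ← setIntegral_condExp hm hX hs, smul_eq_mul]
    calc ENNReal.ofReal (∫ ω in s, (μ[X|m]) ω ∂μ)
        ≤ ENNReal.ofReal (∫ _ in s, C ∂μ) := by
          refine ENNReal.ofReal_le_ofReal (integral_mono_ae integrable_condExp.integrableOn
            (integrable_const _) (ae_restrict_of_ae hXC))
      _ = ENNReal.ofReal C * μ s := by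
          rw [setIntegral_const, smul_eq_mul, mul_comm, measureReal_def]
          rw [ENNReal.ofReal_mul' ENNReal.toReal_nonneg, ENNReal.ofReal_toReal (measure_ne_top _ _)]
  calc ∫⁻ ω, ENNReal.ofReal (X ω) * ENNReal.ofReal (Y ω) ∂μ
      = ∫⁻ ω, ENNReal.ofReal (Y ω) ∂ν := by
        rw [hν, lintegral_withDensity_eq_lintegral_mul₀ hXm
          (hYm.mono hm le_rfl).aemeasurable]
        rfl
    _ = ∫⁻ ω, ENNReal.ofReal (Y ω) ∂(ν.trim hm) := (lintegral_trim hm hYm).symm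
    _ ≤ ∫⁻ ω, ENNReal.ofReal (Y ω) ∂(ENNReal.ofReal C • μ.trim hm) := lintegral_mono' key le_rfl
    _ = ENNReal.ofReal C * ∫⁻ ω, ENNReal.ofReal (Y ω) ∂μ := by
        rw [lintegral_smul_measure, lintegral_trim hm hYm, smul_eq_mul]

theorem integrable_mul_of_condExp_le [IsFiniteMeasure μ] (hm : m ≤ mΩ) {X Y : Ω → ℝ} {C : ℝ}
    (hX : Integrable X μ) (hX0 : 0 ≤ᵐ[μ] X) (hXC : ∀ᵐ ω ∂μ, (μ[X|m]) ω ≤ C)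
    (hY : StronglyMeasurable[m] Y) (hY0 : 0 ≤ Y) (hYi : Integrable Y μ) :
    Integrable (fun ω => X ω * Y ω) μ := by
  refine ⟨hX.aestronglyMeasurable.mul hYi.aestronglyMeasurable, ?_⟩
  rw [hasFiniteIntegral_iff_norm]
  have h1 : ∫⁻ ω, ENNReal.ofReal ‖X ω * Y ω‖ ∂μ
      = ∫⁻ ω, ENNReal.ofReal (X ω) * ENNReal.ofReal (Y ω) ∂μ := by
    refine lintegral_congr_ae ?_
    filter_upwards [hX0] with ω h
    rw [Real.norm_of_nonneg (mul_nonneg h (hY0 ω)), ENNReal.ofReal_mul h]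
  rw [h1]
  refine (lintegral_mul_le_of_condExp_le hm hX hX0 hXC hY).trans_lt ?_
  refine ENNReal.mul_lt_top ENNReal.ofReal_lt_top ?_
  have := hYi.2
  rw [hasFiniteIntegral_iff_norm] at this
  simpa [Real.norm_of_nonneg (hY0 _)] using this

theorem setIntegral_mul_le_of_condExp_le [IsFiniteMeasure μ] (hm : m ≤ mΩ) {X Y : Ω → ℝ} {C : ℝ}
    (hX : Integrable X μ) (hX0 : 0 ≤ᵐ[μ] X) (hXC : ∀ᵐ ω ∂μ, (μ[X|m]) ω ≤ C)
    (hY : StronglyMeasurable[m] Y) (hY0 : 0 ≤ Y) (hYi : Integrable Y μ)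
    {s : Set Ω} (hs : MeasurableSet[m] s) :
    ∫ ω in s, X ω * Y ω ∂μ ≤ C * ∫ ω in s, Y ω ∂μ := by
  have hi := integrable_mul_of_condExp_le hm hX hX0 hXC hY hY0 hYi
  rw [← setIntegral_condExp_mul hm hX hY hi hs, ← integral_const_mul]
  refine integral_mono_ae (integrable_condExp_mul hX hY hi).integrableOn
    (hYi.const_mul C).integrableOn (ae_restrict_of_ae ?_)
  filter_upwards [hXC] with ω h
  exact mul_le_mul_of_nonneg_right h (hY0 ω)

/-- Adding independent information does not change a conditional expectation. -/
theorem condExp_sup_of_indep [IsProbabilityMeasure μ] {E : Type*} [NormedAddCommGroup E]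
    [NormedSpace ℝ E] [CompleteSpace E] {m₁ m₁' m₂ : MeasurableSpace Ω}
    (h11 : m₁ ≤ m₁') (h1 : m₁' ≤ mΩ) (h2 : m₂ ≤ mΩ) (hind : Indep m₁' m₂ μ)
    {z : Ω → E} (hz : StronglyMeasurable[m₁'] z) (hzi : Integrable z μ) :
    μ[z|m₁ ⊔ m₂] =ᵐ[μ] μ[z|m₁] := by
  have hle : m₁ ⊔ m₂ ≤ mΩ := sup_le (h11.trans h1) h2
  have hm1 : m₁ ≤ mΩ := h11.trans h1
  -- Independence factorizes integrals over `A ∩ B`: the function `w · 1_A` is independent of `m₂`,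
  -- so its conditional expectation given `m₂` is constant.
  have rect : ∀ w : Ω → E, StronglyMeasurable[m₁'] w → Integrable w μ → ∀ A B : Set Ω,
      MeasurableSet[m₁] A → MeasurableSet[m₂] B →
      ∫ ω in A ∩ B, w ω ∂μ = μ.real B • ∫ ω in A, w ω ∂μ := by
    intro w hw hwi A B hA hB
    have h := condExp_indep_eq h1 h2 (hw.indicator (h11 _ hA)) hind
    have h' := setIntegral_condExp h2 (hwi.indicator (hm1 _ hA)) hB
    rw [setIntegral_congr_ae (h2 _ hB) (h.mono fun ω hω _ => hω), setIntegral_const,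
      setIntegral_indicator (hm1 _ hA), integral_indicator (hm1 _ hA)] at h'
    rw [Set.inter_comm, ← h']
  symm
  refine ae_eq_condExp_of_forall_setIntegral_eq hle hzi
    (fun s _ _ => integrable_condExp.integrableOn) (fun s hs _ => ?_)
    (stronglyMeasurable_condExp.mono le_sup_left).aestronglyMeasurable
  -- The sets `A ∩ B` form a π-system generating the join, so it suffices to match integrals there
  -- and extend by Dynkin's argument.
  have hgen : m₁ ⊔ m₂ = MeasurableSpace.generateFrom
      {t | ∃ A B, MeasurableSet[m₁] A ∧ MeasurableSet[m₂] B ∧ t = A ∩ B} := by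
    apply le_antisymm
    · refine sup_le (fun A hA => ?_) (fun B hB => ?_)
      · exact MeasurableSpace.measurableSet_generateFrom
          ⟨A, Set.univ, hA, MeasurableSet.univ, (Set.inter_univ A).symm⟩
      · exact MeasurableSpace.measurableSet_generateFrom
          ⟨Set.univ, B, MeasurableSet.univ, hB, (Set.univ_inter B).symm⟩
    · refine MeasurableSpace.generateFrom_le ?_
      rintro t ⟨A, B, hA, hB, rfl⟩
      exact MeasurableSet.inter ((le_sup_left : m₁ ≤ m₁ ⊔ m₂) _ hA)
        ((le_sup_right : m₂ ≤ m₁ ⊔ m₂) _ hB)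
  have hzc : Integrable (μ[z|m₁]) μ := integrable_condExp
  have hpi : IsPiSystem {t | ∃ A B, MeasurableSet[m₁] A ∧ MeasurableSet[m₂] B ∧ t = A ∩ B} := by
    rintro _ ⟨A, B, hA, hB, rfl⟩ _ ⟨A', B', hA', hB', rfl⟩ _
    exact ⟨A ∩ A', B ∩ B', hA.inter hA', hB.inter hB', Set.inter_inter_inter_comm _ _ _ _⟩
  have huniv : ∫ ω, (μ[z|m₁]) ω ∂μ = ∫ ω, z ω ∂μ := integral_condExp hm1
  refine MeasurableSpace.induction_on_inter
    (C := fun s _ => ∫ ω in s, (μ[z|m₁]) ω ∂μ = ∫ ω in s, z ω ∂μ) hgen hpi ?_ ?_ ?_ ?_ s hs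
  · simp
  · rintro _ ⟨A, B, hA, hB, rfl⟩
    rw [rect _ (stronglyMeasurable_condExp.mono h11) hzc A B hA hB, rect z hz hzi A B hA hB,
      setIntegral_condExp hm1 hzi hA]
  · intro t ht h
    rw [setIntegral_compl (hle _ ht) hzc, setIntegral_compl (hle _ ht) hzi, h, huniv]
  · intro g hd hg h
    rw [integral_iUnion (fun i => hle _ (hg i)) hd hzc.integrableOn,
      integral_iUnion (fun i => hle _ (hg i)) hd hzi.integrableOn]
    exact tsum_congr h

end Conditioning

/-! ### Almost supermartingales and identification of their limit. -/

section AlmostSupermartingale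

variable {Ω : Type*} {mΩ : MeasurableSpace Ω} {μ : Measure Ω}

theorem exists_tendsto_prod_one_add {α : ℕ → ℝ} (h0 : ∀ k, 0 ≤ α k) (hs : Summable α) :
    ∃ l, Tendsto (fun K => ∏ k ∈ Finset.range K, (1 + α k)) atTop (𝓝 l) := by
  have hmono : Monotone fun K => ∏ k ∈ Finset.range K, (1 + α k) := by
    refine monotone_nat_of_le_succ fun K => ?_
    rw [Finset.prod_range_succ]
    have : 0 ≤ ∏ k ∈ Finset.range K, (1 + α k) :=
      Finset.prod_nonneg fun k _ => by linarith [h0 k]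
    nlinarith [h0 K]
  refine ⟨_, tendsto_atTop_ciSup hmono ⟨Real.exp (∑' k, α k), ?_⟩⟩
  rintro _ ⟨K, rfl⟩
  calc ∏ k ∈ Finset.range K, (1 + α k) ≤ ∏ k ∈ Finset.range K, Real.exp (α k) :=
        Finset.prod_le_prod (fun k _ => by linarith [h0 k])
          (fun k _ => by linarith [Real.add_one_le_exp (α k)])
    _ = Real.exp (∑ k ∈ Finset.range K, α k) := (Real.exp_sum _ _).symm
    _ ≤ _ := Real.exp_le_exp.2 (hs.sum_le_tsum _ fun k _ => h0 k)

/-- Almost sure convergence of nonnegative almost supermartingales. -/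
theorem ae_exists_tendsto_of_almost_supermartingale [IsProbabilityMeasure μ]
    (ℱ : Filtration ℕ mΩ) {V : ℕ → Ω → ℝ} {α : ℕ → ℝ} (hV0 : ∀ k ω, 0 ≤ V k ω)
    (hVm : ∀ k, StronglyMeasurable[ℱ k] (V k)) (hVi : ∀ k, Integrable (V k) μ)
    (h0 : ∀ k, 0 ≤ α k) (hs : Summable α)
    (hstep : ∀ k s, MeasurableSet[ℱ k] s → ∫ ω in s, V (k + 1) ω ∂μ ≤
      ∫ ω in s, V k ω ∂μ + α k * (∫ ω in s, V k ω ∂μ + μ.real s)) :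
    ∀ᵐ ω ∂μ, ∃ l, Tendsto (fun k => V k ω) atTop (𝓝 l) := by
  -- On average `V + 1` grows by a factor of at most `1 + α k`. Dividing by the accumulated product
  -- leaves a nonnegative supermartingale, and summability of `α` gives the product a finite limit,
  -- so convergence transfers back.
  set P : ℕ → ℝ := fun K => ∏ k ∈ Finset.range K, (1 + α k) with hP
  have hPpos : ∀ K, 0 < P K := fun K => Finset.prod_pos fun k _ => by linarith [h0 k]
  have hPs : ∀ K, P (K + 1) = P K * (1 + α K) := fun K => Finset.prod_range_succ _ _
  obtain ⟨p, hp⟩ := exists_tendsto_prod_one_add h0 hs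
  set Z : ℕ → Ω → ℝ := fun k ω => (P k)⁻¹ * (V k ω + 1) with hZ
  have hZ0 : ∀ k ω, 0 ≤ Z k ω := fun k ω =>
    mul_nonneg (inv_nonneg.2 (hPpos k).le) (by linarith [hV0 k ω])
  have hZi : ∀ k, Integrable (Z k) μ := fun k => ((hVi k).add (integrable_const 1)).const_mul _
  have hZs : ∀ k s, MeasurableSet[ℱ k] s → ∫ ω in s, Z k ω ∂μ
      = (P k)⁻¹ * (∫ ω in s, V k ω ∂μ + μ.real s) := by
    intro k s hms
    rw [hZ]
    simp only
    rw [integral_const_mul, integral_add (hVi k).integrableOn (integrable_const _),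
      setIntegral_const]
    simp
  have hsup : Supermartingale Z ℱ μ := by
    refine supermartingale_of_setIntegral_succ_le
      (fun k => ((hVm k).add stronglyMeasurable_const).const_mul _) hZi ?_
    intro k s hms
    rw [hZs k s hms, hZs (k + 1) s (ℱ.mono k.le_succ _ hms), hPs]
    rw [mul_inv, mul_assoc]
    refine mul_le_mul_of_nonneg_left ?_ (inv_nonneg.2 (hPpos k).le)
    rw [inv_mul_le_iff₀ (by linarith [h0 k])]
    have := hstep k s hms
    nlinarith
  have hint : ∀ k, ∫ ω, Z k ω ∂μ ≤ ∫ ω, Z 0 ω ∂μ := fun k => by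
    simpa using hsup.setIntegral_le (Nat.zero_le k) MeasurableSet.univ
  -- For a nonnegative supermartingale the `L¹` norm is the expectation, which never exceeds its
  -- initial value.
  have hbdd : ∀ k, eLpNorm ((-Z) k) 1 μ ≤ (∫ ω, Z 0 ω ∂μ).toNNReal := by
    intro k
    have e : (-Z) k = -(Z k) := rfl
    rw [e, eLpNorm_neg, eLpNorm_one_eq_lintegral_enorm]
    have : ∫⁻ ω, ‖Z k ω‖ₑ ∂μ = ENNReal.ofReal (∫ ω, Z k ω ∂μ) := by
      rw [ofReal_integral_eq_lintegral_ofReal (hZi k) (ae_of_all _ (hZ0 k))]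
      refine lintegral_congr fun ω => ?_
      rw [Real.enorm_eq_ofReal (hZ0 k ω)]
    rw [this]
    exact ENNReal.ofReal_le_ofReal (hint k)
  filter_upwards [hsup.neg.exists_ae_tendsto_of_bdd hbdd] with ω ⟨c, hc⟩
  refine ⟨p * (-c) - 1, ?_⟩
  have h1 := (hp.mul hc.neg).sub_const 1
  refine h1.congr fun k => ?_
  have hk := (hPpos k).ne'
  have e : -((-Z) k ω) = (P k)⁻¹ * (V k ω + 1) := neg_neg _
  rw [e, mul_inv_cancel_left₀ hk]
  ring

/-- A convergent nonnegative sequence whose expectation is frequently small tends to `0`. -/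
theorem ae_tendsto_zero_of_frequently_integral_lt [IsFiniteMeasure μ]
    {V : ℕ → Ω → ℝ} (hV0 : ∀ k ω, 0 ≤ V k ω) (hVm : ∀ k, Measurable (V k))
    (hVi : ∀ k, Integrable (V k) μ)
    (hconv : ∀ᵐ ω ∂μ, ∃ l, Tendsto (fun k => V k ω) atTop (𝓝 l))
    (hfreq : ∀ δ > 0, ∃ᶠ k in atTop, ∫ ω, V k ω ∂μ < δ) :
    ∀ᵐ ω ∂μ, Tendsto (fun k => V k ω) atTop (𝓝 0) := by
  have hm : ∀ k, Measurable (fun ω => ENNReal.ofReal (V k ω)) := fun k =>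
    (hVm k).ennreal_ofReal
  -- Fatou's lemma: expectations that are small infinitely often force the integral of the pointwise
  -- liminf to vanish.
  have hz : ∫⁻ ω, liminf (fun k => ENNReal.ofReal (V k ω)) atTop ∂μ = 0 := by
    refine le_antisymm (ENNReal.le_of_forall_pos_le_add fun δ hδ _ => ?_) bot_le
    rw [zero_add]
    refine (lintegral_liminf_le hm).trans ?_
    refine liminf_le_of_frequently_le ?_
    refine (hfreq δ hδ).mono fun k hk => ?_
    rw [← ofReal_integral_eq_lintegral_ofReal (hVi k) (ae_of_all _ (hV0 k))]
    refine (ENNReal.ofReal_le_ofReal hk.le).trans ?_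
    simp
  have hae := (lintegral_eq_zero_iff (Measurable.liminf hm)).1 hz
  filter_upwards [hae, hconv] with ω h1 ⟨l, hl⟩
  have h2 : liminf (fun k => ENNReal.ofReal (V k ω)) atTop = ENNReal.ofReal l :=
    ((ENNReal.continuous_ofReal.tendsto l).comp hl).liminf_eq
  have hl0 : l = 0 := by
    have h3 : ENNReal.ofReal l = 0 := by rw [← h2]; exact h1
    exact le_antisymm (ENNReal.ofReal_eq_zero.1 h3)
      (ge_of_tendsto' hl fun k => hV0 k ω)
  rwa [hl0] at hl

end AlmostSupermartingale

/-! ### From eigenvalue bounds to quadratic form bounds. -/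

section Spectral

open Matrix

theorem inner_toEuclideanLin_transpose {p q : ℕ} (M : Matrix (Fin p) (Fin q) ℝ)
    (z : EuclideanSpace ℝ (Fin p)) (y : EuclideanSpace ℝ (Fin q)) :
    inner ℝ (Matrix.toEuclideanLin Mᵀ z) y = inner ℝ z (Matrix.toEuclideanLin M y) := by
  have h := Matrix.toEuclideanLin_conjTranspose_eq_adjoint (𝕜 := ℝ) M
  rw [conjTranspose_eq_transpose_of_trivial] at h
  rw [h, LinearMap.adjoint_inner_left]

theorem inner_toEuclideanLin_eq_sum {p : ℕ} (M : Matrix (Fin p) (Fin p) ℝ)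
    (x : EuclideanSpace ℝ (Fin p)) :
    inner ℝ x (Matrix.toEuclideanLin M x) = ∑ r, ∑ s, M r s * (x r * x s) := by
  simp only [PiLp.inner_apply, Matrix.toLpLin_apply, Matrix.mulVec, dotProduct]
  refine Finset.sum_congr rfl fun r _ => ?_
  simp only [RCLike.inner_apply, conj_trivial, Finset.sum_mul]
  exact Finset.sum_congr rfl fun s _ => by ring

theorem inner_toEuclideanLin_eq_sum_eigenvalues {p : ℕ} {M : Matrix (Fin p) (Fin p) ℝ}
    (hM : M.IsHermitian) (x : EuclideanSpace ℝ (Fin p)) :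
    inner ℝ x (Matrix.toEuclideanLin M x)
      = ∑ i, hM.eigenvalues i * inner ℝ (hM.eigenvectorBasis i) x ^ 2 := by
  have hs := isSymmetric_toEuclideanLin_iff.mpr hM
  rw [← hM.eigenvectorBasis.sum_inner_mul_inner x]
  refine Finset.sum_congr rfl fun i _ => ?_
  have h1 : Matrix.toEuclideanLin M (hM.eigenvectorBasis i)
      = hM.eigenvalues i • hM.eigenvectorBasis i := by
    ext j
    have := congrFun (hM.mulVec_eigenvectorBasis i) j
    simpa [Matrix.toLpLin_apply] using this
  rw [← hs, h1, inner_smul_left, real_inner_comm]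
  simp only [conj_trivial]
  ring

/-- A positive lower bound rules out the default value `0`, which is how symmetry of `M` and `r < p`
are recovered. Since `eigenvalues₀` is decreasing, the `r`-th smallest eigenvalue sits at position
`p - 1 - r` and bounds every earlier position from below. -/
theorem le_eigenvalues_of_le_ascEigenvalue {p r : ℕ} {M : Matrix (Fin p) (Fin p) ℝ} {θ : ℝ}
    (hθ : 0 < θ) (h : θ ≤ ascEigenvalue r M) :
    ∃ hM : M.IsHermitian, r < p ∧ ∀ i, (((Fintype.equivOfCardEq (Fintype.card_fin
      (Fintype.card (Fin p)))).symm i : Fin (Fintype.card (Fin p))) : ℕ) + r + 1 ≤ p →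
      θ ≤ hM.eigenvalues i := by
  unfold ascEigenvalue at h
  split_ifs at h with hc
  · refine ⟨hc.1, hc.2, fun i hi => h.trans ?_⟩
    refine hc.1.eigenvalues₀_antitone ?_
    rw [Fin.le_def]
    simp only
    omega
  · exact absurd h (not_le.2 hθ)

theorem le_quadratic_form_of_le_lambdaMin {p : ℕ} {M : Matrix (Fin p) (Fin p) ℝ} {θ : ℝ}
    (hθ : 0 < θ) (h : θ ≤ lambdaMin M) (x : EuclideanSpace ℝ (Fin p)) :
    θ * ‖x‖ ^ 2 ≤ ∑ r, ∑ s, M r s * (x r * x s) := by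
  obtain ⟨hM, -, hle⟩ := le_eigenvalues_of_le_ascEigenvalue hθ h
  rw [← inner_toEuclideanLin_eq_sum, inner_toEuclideanLin_eq_sum_eigenvalues hM,
    ← real_inner_self_eq_norm_sq, ← hM.eigenvectorBasis.sum_inner_mul_inner x, Finset.mul_sum]
  refine Finset.sum_le_sum fun i _ => ?_
  rw [real_inner_comm, ← sq]
  refine mul_le_mul_of_nonneg_right (hle i ?_) (sq_nonneg _)
  have := ((Fintype.equivOfCardEq (Fintype.card_fin (Fintype.card (Fin p)))).symm i).2
  have hc := Fintype.card_fin p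
  omega

/-- The all-ones vector lies in the kernel. Every eigenvector except the last has eigenvalue at
least `θ > 0`, hence is orthogonal to it, so the all-ones vector spans the last eigendirection and
the last eigenvalue is `0`. The subtracted term is the squared component of `x` along that
direction. -/
theorem le_quadratic_form_of_le_lambdaTwo {p : ℕ} {M : Matrix (Fin p) (Fin p) ℝ} {θ : ℝ}
    (hθ : 0 < θ) (h : θ ≤ lambdaTwo M) (h1 : ∀ r, ∑ s, M r s = 0)
    (x : EuclideanSpace ℝ (Fin p)) :
    θ * (‖x‖ ^ 2 - (∑ r, x r) ^ 2 / p) ≤ ∑ r, ∑ s, M r s * (x r * x s) := by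
  obtain ⟨hM, hp, hle⟩ := le_eigenvalues_of_le_ascEigenvalue hθ h
  have hs := isSymmetric_toEuclideanLin_iff.mpr hM
  set e := Fintype.equivOfCardEq (Fintype.card_fin (Fintype.card (Fin p))) with he
  -- The index of the smallest eigenvalue, at the last position of the decreasing order.
  set i0 : Fin p := e ⟨p - 1, by rw [Fintype.card_fin]; omega⟩ with hi0
  have hge : ∀ i, i ≠ i0 → θ ≤ hM.eigenvalues i := by
    intro i hi
    refine hle i ?_
    have h2 := (e.symm i).2
    have hc := Fintype.card_fin p
    have h3 : ((e.symm i : Fin (Fintype.card (Fin p))) : ℕ) ≠ p - 1 := by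
      intro h4
      apply hi
      rw [hi0, ← e.apply_symm_apply i]
      congr 1
      exact Fin.ext h4
    omega
  set v := hM.eigenvectorBasis with hv
  set u : EuclideanSpace ℝ (Fin p) := WithLp.toLp 2 fun _ => 1 with hu
  have hux : ∀ y : EuclideanSpace ℝ (Fin p), inner ℝ u y = ∑ r, y r := fun y => by
    simp [PiLp.inner_apply, hu]
  have hMu : Matrix.toEuclideanLin M u = 0 := by
    ext r
    simp [Matrix.toLpLin_apply, hu, Matrix.mulVec, dotProduct, h1]
  have hvM : ∀ i, hM.eigenvalues i * inner ℝ (v i) u = 0 := by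
    intro i
    have h2 : Matrix.toEuclideanLin M (v i) = hM.eigenvalues i • v i := by
      ext j
      have := congrFun (hM.mulVec_eigenvectorBasis i) j
      simpa [Matrix.toLpLin_apply] using this
    have h3 := hs (v i) u
    rw [h2, hMu, inner_zero_right, inner_smul_left] at h3
    simpa using h3
  have hvu : ∀ i, i ≠ i0 → inner ℝ (v i) u = 0 := fun i hi =>
    (mul_eq_zero.1 (hvM i)).resolve_left (by linarith [hge i hi])
  have hexp : ∀ y : EuclideanSpace ℝ (Fin p), inner ℝ u y = inner ℝ (v i0) u * inner ℝ (v i0) y := by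
    intro y
    rw [← v.sum_inner_mul_inner u y, Finset.sum_eq_single i0]
    · rw [real_inner_comm]
    · intro i _ hi
      rw [real_inner_comm, hvu i hi, zero_mul]
    · simp
  set c := inner ℝ (v i0) u with hc
  have hcp : c * c = p := by
    have := hexp u
    rw [hux] at this
    rw [← this]
    simp [hu]
  have hp0 : (0 : ℝ) < p := by exact_mod_cast (by omega : 0 < p)
  have hc0 : c ≠ 0 := by
    intro h0
    rw [h0] at hcp
    simp at hcp
    linarith
  have hl0 : hM.eigenvalues i0 = 0 := (mul_eq_zero.1 (hvM i0)).resolve_right hc0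
  have hmean : (∑ r, x r) ^ 2 / p = inner ℝ (v i0) x ^ 2 := by
    rw [← hux, hexp x, ← hcp]
    field_simp
  rw [← inner_toEuclideanLin_eq_sum, inner_toEuclideanLin_eq_sum_eigenvalues hM, hmean,
    ← real_inner_self_eq_norm_sq, ← v.sum_inner_mul_inner x]
  rw [← Finset.add_sum_erase _ _ (Finset.mem_univ i0),
    ← Finset.add_sum_erase _ (fun i => hM.eigenvalues i * inner ℝ (v i) x ^ 2)
      (Finset.mem_univ i0), hl0]
  have h5 : ∑ i ∈ Finset.univ.erase i0, θ * (inner ℝ x (v i) * inner ℝ (v i) x)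
      ≤ ∑ i ∈ Finset.univ.erase i0, hM.eigenvalues i * inner ℝ (v i) x ^ 2 := by
    refine Finset.sum_le_sum fun i hi => ?_
    rw [real_inner_comm, ← sq]
    exact mul_le_mul_of_nonneg_right (hge i (Finset.ne_of_mem_erase hi)) (sq_nonneg _)
  rw [← Finset.mul_sum] at h5
  rw [real_inner_comm x]
  nlinarith

end Spectral

/-! ### Bounds by the spectral norms of the Laplacian and of the Gram matrix. -/

section Bounds

open Matrix

variable {N n : ℕ}

theorem specNorm_nonneg {ι : Type*} [Fintype ι] [DecidableEq ι] (M : Matrix ι ι ℝ) :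
    0 ≤ specNorm M := norm_nonneg _

theorem abs_apply_le_specNorm {ι : Type*} [Fintype ι] [DecidableEq ι] (M : Matrix ι ι ℝ)
    (i j : ι) : |M i j| ≤ specNorm M := by
  have h := (Matrix.toEuclideanCLM (n := ι) (𝕜 := ℝ) M).le_opNorm (EuclideanSpace.single j 1)
  rw [PiLp.norm_single, norm_one, mul_one] at h
  have h2 := (PiLp.norm_apply_le ((Matrix.toEuclideanCLM (n := ι) (𝕜 := ℝ) M)
    (EuclideanSpace.single j 1)) i).trans h
  have e : (Matrix.toEuclideanCLM (n := ι) (𝕜 := ℝ) M (EuclideanSpace.single j 1)) i = M i j := by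
    change (M *ᵥ (EuclideanSpace.single j (1 : ℝ)).ofLp) i = M i j
    simp
  rwa [e] at h2

/-- Off the diagonal the Laplacian is `-w`, so a bound on its norm bounds each weight. -/
theorem abs_adjacency_le_specNorm_laplacian (w : Matrix (Fin N) (Fin N) ℝ)
    (hw : ∀ i, w i i = 0) (i j : Fin N) : |w i j| ≤ specNorm (laplacian w) := by
  by_cases hij : i = j
  · subst hij
    rw [hw, abs_zero]
    exact specNorm_nonneg _
  · have := abs_apply_le_specNorm (laplacian w) i j
    simpa [laplacian, Matrix.diagonal_apply_ne _ hij] using this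

variable {Ω : Type*} [MeasurableSpace Ω] {d : Fin N → ℕ}

theorem Network.gram_eq (net : Network Ω N n d) (k : ℕ) (ω : Ω) :
    net.gram k ω = Matrix.blockDiagonal' fun i => (net.H k i ω)ᵀ * net.H k i ω := by
  rw [Network.gram, Matrix.blockDiagonal'_transpose, Matrix.blockDiagonal'_mul]

/-- Place `y` in block `i` and zero elsewhere: the quadratic form of the block diagonal Gram matrix
at this vector is `‖Hᵢ y‖²`. -/
theorem Network.norm_sq_H_le (net : Network Ω N n d) (k : ℕ) (ω : Ω) (i : Fin N)
    (y : EuclideanSpace ℝ (Fin n)) :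
    ‖Matrix.toEuclideanLin (net.H k i ω) y‖ ^ 2 ≤ specNorm (net.gram k ω) * ‖y‖ ^ 2 := by
  set Y : EuclideanSpace ℝ ((_ : Fin N) × Fin n) :=
    WithLp.toLp 2 fun p => if p.1 = i then y p.2 else 0 with hY
  have hYn : ‖Y‖ ^ 2 = ‖y‖ ^ 2 := by
    rw [EuclideanSpace.norm_sq_eq, EuclideanSpace.norm_sq_eq, Fintype.sum_sigma,
      Finset.sum_eq_single i]
    · simp [hY]
    · intro j _ hj
      simp [hY, hj]
    · simp
  have hin : inner ℝ Y (Matrix.toEuclideanCLM (n := (_ : Fin N) × Fin n) (𝕜 := ℝ) (net.gram k ω) Y)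
      = ‖Matrix.toEuclideanLin (net.H k i ω) y‖ ^ 2 := by
    rw [← real_inner_self_eq_norm_sq, ← inner_toEuclideanLin_transpose, real_inner_comm,
      PiLp.inner_apply, PiLp.inner_apply, Fintype.sum_sigma, Finset.sum_eq_single i]
    · refine Finset.sum_congr rfl fun r _ => ?_
      have e1 : (Matrix.toEuclideanCLM (n := (_ : Fin N) × Fin n) (𝕜 := ℝ) (net.gram k ω) Y) ⟨i, r⟩
          = (Matrix.toEuclideanLin (net.H k i ω)ᵀ (Matrix.toEuclideanLin (net.H k i ω) y)) r := by
        change (net.gram k ω *ᵥ Y.ofLp) ⟨i, r⟩ = ((net.H k i ω)ᵀ *ᵥ (net.H k i ω *ᵥ y.ofLp)) r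
        rw [Matrix.mulVec_mulVec, net.gram_eq, Matrix.mulVec, Matrix.mulVec, dotProduct, dotProduct,
          Fintype.sum_sigma, Finset.sum_eq_single i]
        · simp [hY]
        · intro j _ hj
          simp [hY, hj]
        · simp
      rw [e1]
      simp [hY]
    · intro j _ hj
      simp [hY, hj]
    · simp
  rw [← hin, ← hYn]
  refine (real_inner_le_norm _ _).trans ?_
  rw [sq, ← mul_assoc, mul_comm (specNorm _), mul_assoc]
  exact mul_le_mul_of_nonneg_left (ContinuousLinearMap.le_opNorm _ _) (norm_nonneg _)

/-- Duality: with `y = Hᵢᵀ z` one has `‖y‖² = ⟨z, Hᵢ y⟩ ≤ ‖z‖ ‖Hᵢ y‖`; square, apply the bound for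
`Hᵢ`, and cancel `‖y‖²`. -/
theorem Network.norm_sq_H_transpose_le (net : Network Ω N n d) (k : ℕ) (ω : Ω) (i : Fin N)
    (z : EuclideanSpace ℝ (Fin (d i))) :
    ‖Matrix.toEuclideanLin (net.H k i ω)ᵀ z‖ ^ 2 ≤ specNorm (net.gram k ω) * ‖z‖ ^ 2 := by
  set y := Matrix.toEuclideanLin (net.H k i ω)ᵀ z with hy
  have h1 : ‖y‖ ^ 2 ≤ ‖z‖ * ‖Matrix.toEuclideanLin (net.H k i ω) y‖ := by
    rw [← real_inner_self_eq_norm_sq]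
    nth_rw 1 [hy]
    rw [inner_toEuclideanLin_transpose]
    exact real_inner_le_norm _ _
  have h2 := net.norm_sq_H_le k ω i y
  set G := specNorm (net.gram k ω)
  set t := ‖Matrix.toEuclideanLin (net.H k i ω) y‖
  by_cases h0 : ‖y‖ ^ 2 = 0
  · rw [h0]
    exact mul_nonneg (specNorm_nonneg _) (sq_nonneg _)
  · have hpos : 0 < ‖y‖ ^ 2 := lt_of_le_of_ne (sq_nonneg _) (Ne.symm h0)
    have h3 : (‖y‖ ^ 2) ^ 2 ≤ (‖z‖ * t) ^ 2 := pow_le_pow_left₀ hpos.le h1 2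
    have h4 : (‖y‖ ^ 2) * ‖y‖ ^ 2 ≤ (G * ‖z‖ ^ 2) * ‖y‖ ^ 2 := by
      nlinarith [mul_le_mul_of_nonneg_left h2 (sq_nonneg ‖z‖)]
    exact le_of_mul_le_mul_right h4 hpos

end Bounds

/-! ### Deterministic recursions over blocks. -/

section Sequences

open Finset

theorem tendsto_block_index {h : ℕ} (hh : 0 < h) (r : ℕ) :
    Tendsto (fun m => m * h + r) atTop atTop :=
  tendsto_atTop_mono (fun m => (Nat.le_mul_of_pos_right m hh).trans (Nat.le_add_right _ _))
    tendsto_id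

/-- Inside one block, `u` is the mean square error, `q` the energy dissipated by the current state,
`w` the mean square displacement from the start of the block, and `p`, `o` are the graph and
observation energies of the state frozen at the start. The dissipation is at least half the frozen
energies minus a multiple of the displacement, and the displacement is of the order of the
accumulated `ε`. In the final constant, `(1 + C E) ^ h` bounds the growth of `1 + u`, `2 ^ h` the
growth of the displacement, `2 h C` the accumulated cost of freezing, and `1` stands for the direct
error terms. -/
theorem block_descent {h : ℕ} {C E c g : ℝ} {u q w p o a b ε : ℕ → ℝ}
    (hC : 0 ≤ C) (hE : 0 ≤ E) (hg : 0 ≤ g)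
    (hu : ∀ j, 0 ≤ u j) (hq : ∀ j, 0 ≤ q j)
    (hp : ∀ j, 0 ≤ p j) (ho : ∀ j, 0 ≤ o j)
    (hε : ∀ j, 0 ≤ ε j ∧ ε j ≤ E)
    (hstep : ∀ j < h, u (j + 1) ≤ u j - 2 * q j + C * ε j * (1 + u j))
    (hqw : ∀ j < h, (b j * p j + a j * o j) / 2 - C * w j ≤ q j)
    (hw0 : w 0 ≤ 0) (hw : ∀ j < h, w (j + 1) ≤ 2 * w j + C * ε j * (1 + u j))
    (ha : ∀ j < h, g ≤ a j) (hb : ∀ j < h, g ≤ b j)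
    (hc : c * u 0 ≤ ∑ j ∈ range h, (p j + o j)) :
    u h ≤ u 0 - c * g * u 0 + (2 * h * 2 ^ h * C + 1) * C * (1 + C * E) ^ h *
      (∑ j ∈ range h, ε j) * (1 + u 0) := by
  have hK : 1 ≤ 1 + C * E := by nlinarith
  have hu0 := hu 0
  -- Crude growth bound, ignoring dissipation; it makes all error terms comparable with `1 + u 0`.
  have h1 : ∀ j ≤ h, 1 + u j ≤ (1 + C * E) ^ j * (1 + u 0) := by
    intro j
    induction j with
    | zero => intro _; simp
    | succ j ih =>
      intro hj
      have i1 := ih (by omega)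
      have i2 := hstep j (by omega)
      have i3 : C * ε j * (1 + u j) ≤ C * E * (1 + u j) :=
        mul_le_mul_of_nonneg_right (mul_le_mul_of_nonneg_left (hε j).2 hC) (by linarith [hu j])
      have i4 : (1 + C * E) * (1 + u j) ≤ (1 + C * E) * ((1 + C * E) ^ j * (1 + u 0)) :=
        mul_le_mul_of_nonneg_left i1 (by linarith)
      rw [pow_succ']
      linarith [hq j]
  set B := (1 + C * E) ^ h * (1 + u 0) with hB
  have hB0 : 0 ≤ B := by positivity
  have h2 : ∀ j ≤ h, 1 + u j ≤ B := fun j hj =>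
    (h1 j hj).trans (mul_le_mul_of_nonneg_right (pow_le_pow_right₀ hK hj) (by linarith))
  have h3 : ∀ j < h, C * ε j * (1 + u j) ≤ C * ε j * B := fun j hj =>
    mul_le_mul_of_nonneg_left (h2 j hj.le) (mul_nonneg hC (hε j).1)
  set S : ℕ → ℝ := fun j => ∑ i ∈ range j, ε i with hS
  have hS0 : ∀ j, 0 ≤ S j := fun j => sum_nonneg fun i _ => (hε i).1
  have hSs : ∀ j, S (j + 1) = S j + ε j := fun j => sum_range_succ _ _
  have hSm : ∀ j ≤ h, S j ≤ S h := fun j hj =>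
    sum_le_sum_of_subset_of_nonneg (range_mono hj) fun i _ _ => (hε i).1
  have h4 : ∀ j ≤ h, w j ≤ 2 ^ j * (C * B * S j) := by
    intro j
    induction j with
    | zero => intro _; simpa [hS] using hw0
    | succ j ih =>
      intro hj
      have i1 := ih (by omega)
      have i2 := hw j (by omega)
      have i3 := h3 j (by omega)
      have i4 : C * ε j * B ≤ 2 ^ (j + 1) * (C * B * ε j) := by
        have : (1 : ℝ) ≤ 2 ^ (j + 1) := one_le_pow₀ (by norm_num)
        have hn : 0 ≤ C * B * ε j := mul_nonneg (mul_nonneg hC hB0) (hε j).1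
        nlinarith
      rw [hSs, mul_add, mul_add]
      calc w (j + 1) ≤ 2 * (2 ^ j * (C * B * S j)) + C * ε j * B := by linarith
        _ ≤ 2 ^ (j + 1) * (C * B * S j) + 2 ^ (j + 1) * (C * B * ε j) := by
          rw [pow_succ'] at i4 ⊢; linarith
  set W := 2 ^ h * (C * B * S h) with hW
  have h5 : ∀ j ≤ h, w j ≤ W := by
    intro j hj
    refine (h4 j hj).trans ?_
    refine mul_le_mul (pow_le_pow_right₀ (by norm_num) hj) ?_ ?_ (by positivity)
    · exact mul_le_mul_of_nonneg_left (hSm j hj) (mul_nonneg hC hB0)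
    · exact mul_nonneg (mul_nonneg hC hB0) (hS0 j)
  -- The factor `2` in front of `q` cancels the `1 / 2` lost by freezing, which leaves `g (p + o)`
  -- at each step.
  have h6 : ∀ j ≤ h, u j ≤ u 0 - g * ∑ i ∈ range j, (p i + o i) + j * (2 * C * W) + C * B * S j := by
    intro j
    induction j with
    | zero => intro _; simp [hS]
    | succ j ih =>
      intro hj
      have i1 := ih (by omega)
      have hj' : j < h := by omega
      have i2 := hstep j hj'
      have i3 := h3 j hj'
      have i4 := hqw j hj'
      have i5 : C * w j ≤ C * W := mul_le_mul_of_nonneg_left (h5 j hj'.le) hC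
      have i6 : g * p j ≤ b j * p j := mul_le_mul_of_nonneg_right (hb j hj') (hp j)
      have i7 : g * o j ≤ a j * o j := mul_le_mul_of_nonneg_right (ha j hj') (ho j)
      rw [sum_range_succ, hSs]
      push_cast
      nlinarith
  have h7 := h6 h le_rfl
  have h8 : g * (c * u 0) ≤ g * ∑ i ∈ range h, (p i + o i) := mul_le_mul_of_nonneg_left hc hg
  have h9 : (2 * h * 2 ^ h * C + 1) * C * (1 + C * E) ^ h * S h * (1 + u 0)
      = h * (2 * C * W) + C * B * S h := by
    rw [hW, hB]; ring
  change u h ≤ u 0 - c * g * u 0 + (2 * h * 2 ^ h * C + 1) * C * (1 + C * E) ^ h * S h * (1 + u 0)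
  rw [h9]
  linarith

/-- By monotonicity the value at the end of one block bounds all values in the next one. Hence `h`
times the sampled sum, plus the first block, bounds the divergent sum. -/
theorem tendsto_sum_block_ends {g : ℕ → ℝ} (hg : Antitone g)
    (hdiv : Tendsto (fun T => ∑ k ∈ range T, g k) atTop atTop) {h : ℕ} (hh : 0 < h) :
    Tendsto (fun M => ∑ m ∈ range M, g ((m + 1) * h)) atTop atTop := by
  have key : ∀ M, ∑ k ∈ range ((M + 1) * h), g k ≤ h * g 0 + h * ∑ m ∈ range M, g ((m + 1) * h) := by
    intro M
    induction M with
    | zero =>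
      have : ∑ k ∈ range h, g k ≤ ∑ _k ∈ range h, g 0 := sum_le_sum fun k _ => hg (Nat.zero_le k)
      simpa using this
    | succ M ih =>
      have e : (M + 1 + 1) * h = (M + 1) * h + h := by ring
      rw [e, sum_range_add, sum_range_succ]
      have : ∑ k ∈ range h, g ((M + 1) * h + k) ≤ ∑ _k ∈ range h, g ((M + 1) * h) :=
        sum_le_sum fun k _ => hg (Nat.le_add_right _ _)
      rw [sum_const, card_range, nsmul_eq_mul] at this
      linarith
  have hh' : (0 : ℝ) < h := by exact_mod_cast hh
  have h1 : Tendsto (fun M => ∑ k ∈ range ((M + 1) * h), g k) atTop atTop :=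
    hdiv.comp (by simpa only [Nat.succ_mul] using tendsto_block_index hh h)
  have h2 := (tendsto_atTop_add_const_right _ (-(h * g 0)) h1).atTop_div_const hh'
  refine tendsto_atTop_mono (fun M => ?_) h2
  rw [div_le_iff₀ hh']
  linarith [key M]

theorem summable_sum_blocks {ε : ℕ → ℝ} (hε : ∀ k, 0 ≤ ε k) (hs : Summable ε) (h : ℕ) :
    Summable fun m => ∑ j ∈ range h, ε (m * h + j) := by
  refine summable_of_sum_range_le (c := ∑' k, ε k) (fun m => sum_nonneg fun j _ => hε _) fun M => ?_
  have key : ∑ m ∈ range M, ∑ j ∈ range h, ε (m * h + j) = ∑ k ∈ range (M * h), ε k := by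
    induction M with
    | zero => simp
    | succ M ih => rw [sum_range_succ, ih, Nat.succ_mul, sum_range_add]
  rw [key]
  exact hs.sum_le_tsum _ fun k _ => hε k

/-- If `U` stayed above `δ`, the decrements would be at least `c δ G m`, with divergent sum. A
discrete Grönwall bound keeps `U` bounded, so the increments `η m (1 + U m)` have finite sum and
cannot compensate. -/
theorem frequently_lt_of_descent {U G η : ℕ → ℝ} {c : ℝ} (hc : 0 < c)
    (hU : ∀ m, 0 ≤ U m) (hG : ∀ m, 0 ≤ G m) (hη : ∀ m, 0 ≤ η m)
    (hrec : ∀ m, U (m + 1) ≤ U m - c * G m * U m + η m * (1 + U m))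
    (hs : Summable η) (hdiv : Tendsto (fun M => ∑ m ∈ range M, G m) atTop atTop)
    {δ : ℝ} (hδ : 0 < δ) : ∃ᶠ m in atTop, U m < δ := by
  by_contra hcon
  rw [not_frequently, eventually_atTop] at hcon
  obtain ⟨M, hM⟩ := hcon
  have h1 : ∀ m, 1 + U m ≤ (1 + U 0) * Real.exp (∑ i ∈ range m, η i) := by
    intro m
    induction m with
    | zero => simp
    | succ m ih =>
      rw [sum_range_succ, Real.exp_add, ← mul_assoc]
      have i1 : 1 + U (m + 1) ≤ (1 + U m) * (1 + η m) := by
        nlinarith [hrec m, mul_nonneg (mul_nonneg hc.le (hG m)) (hU m)]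
      refine i1.trans (mul_le_mul ih (by linarith [Real.add_one_le_exp (η m)])
        (by linarith [hη m]) (mul_nonneg (by linarith [hU 0]) (Real.exp_pos _).le))
  set K := (1 + U 0) * Real.exp (∑' i, η i) with hK
  have h2 : ∀ m, 1 + U m ≤ K := fun m => (h1 m).trans
    (mul_le_mul_of_nonneg_left (Real.exp_le_exp.2 (hs.sum_le_tsum _ fun i _ => hη i))
      (by linarith [hU 0]))
  have h3 : ∀ n, c * δ * ∑ i ∈ range n, G (M + i) ≤ U M - U (M + n) + K * ∑ i ∈ range n, η (M + i) := by
    intro n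
    induction n with
    | zero => simp
    | succ n ih =>
      rw [sum_range_succ, sum_range_succ, ← add_assoc]
      have i1 := hrec (M + n)
      have i2 : δ ≤ U (M + n) := not_lt.1 (hM (M + n) (by omega))
      have i3 : c * G (M + n) * δ ≤ c * G (M + n) * U (M + n) :=
        mul_le_mul_of_nonneg_left i2 (mul_nonneg hc.le (hG _))
      have i4 : η (M + n) * (1 + U (M + n)) ≤ η (M + n) * K :=
        mul_le_mul_of_nonneg_left (h2 _) (hη _)
      nlinarith
  have hK0 : 0 ≤ K := by linarith [h2 0, hU 0]
  have h4 : ∀ n, ∑ i ∈ range n, G (M + i) ≤ (U M + K * ∑' i, η i) / (c * δ) := by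
    intro n
    rw [le_div_iff₀ (mul_pos hc hδ)]
    have i1 : ∑ i ∈ range n, η (M + i) ≤ ∑' i, η i := by
      have : ∑ i ∈ range n, η (M + i) ≤ ∑ i ∈ range (M + n), η i := by
        rw [sum_range_add]
        linarith [sum_nonneg fun i (_ : i ∈ range M) => hη i]
      exact this.trans (hs.sum_le_tsum _ fun i _ => hη i)
    have i2 := mul_le_mul_of_nonneg_left i1 hK0
    linarith [h3 n, hU (M + n)]
  obtain ⟨n, hn, hn'⟩ := ((tendsto_atTop.1 hdiv (∑ i ∈ range M, G i +
    (U M + K * ∑' i, η i) / (c * δ) + 1)).and (eventually_ge_atTop M)).exists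
  obtain ⟨l, rfl⟩ := Nat.exists_eq_add_of_le hn'
  rw [sum_range_add] at hn
  linarith [h4 l]

/-- Once `η ≤ τ G`, the quantity `U - 2 τ / c` is multiplied by at most `1 - c G / 2 ≤ exp (-c G /
2)` whenever that factor acts on a nonnegative bound. The divergence of `∑ G` then drives `U` below
any level above `2 τ / c`, and `τ` is arbitrary. -/
theorem tendsto_zero_of_descent {U G η : ℕ → ℝ} {c : ℝ} (hc : 0 < c)
    (hU : ∀ m, 0 ≤ U m) (hG : ∀ m, 0 ≤ G m)
    (hrec : ∀ m, U (m + 1) ≤ U m - c * G m * U m + η m * (1 + U m))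
    (hη : ∀ τ > 0, ∀ᶠ m in atTop, η m ≤ τ * G m) (hG0 : Tendsto G atTop (𝓝 0))
    (hdiv : Tendsto (fun M => ∑ m ∈ range M, G m) atTop atTop) :
    Tendsto U atTop (𝓝 0) := by
  rw [Metric.tendsto_atTop]
  intro δ hδ
  -- The first bound lets half of the decay absorb `τ G U`; the second gives `2 τ / c ≤ δ / 4`.
  set τ := min (c / 2) (c * δ / 8) with hτ
  have hτ0 : 0 < τ := lt_min (by linarith) (by positivity)
  have e1 := hη τ hτ0
  -- This keeps the contraction factor `1 - c G / 2` nonnegative.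
  have e2 : ∀ᶠ m in atTop, G m ≤ 2 / c :=
    (hG0.eventually_lt_const (by positivity : (0 : ℝ) < 2 / c)).mono fun m hm => hm.le
  obtain ⟨M, hM⟩ := eventually_atTop.1 (e1.and e2)
  set Z := max (U M - 2 * τ / c) 0 with hZ
  have hZ0 : 0 ≤ Z := le_max_right _ _
  have h1 : ∀ n, U (M + n) - 2 * τ / c ≤ Z * Real.exp (-(c / 2) * ∑ i ∈ range n, G (M + i)) := by
    intro n
    induction n with
    | zero => simp [hZ]
    | succ n ih =>
      obtain ⟨m1, m2⟩ := hM (M + n) (by omega)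
      rw [sum_range_succ, mul_add, Real.exp_add, ← mul_assoc, ← add_assoc]
      set y := U (M + n) with hy
      have hy0 : 0 ≤ y := hU _
      set x := G (M + n) with hx
      have hx0 : 0 ≤ x := hG _
      have i1 := hrec (M + n)
      rw [← hy, ← hx] at i1
      have i2 : η (M + n) * (1 + y) ≤ τ * x * (1 + y) :=
        mul_le_mul_of_nonneg_right m1 (by linarith)
      have i3 : τ * x * y ≤ c / 2 * x * y :=
        mul_le_mul_of_nonneg_right (mul_le_mul_of_nonneg_right (min_le_left _ _) hx0) hy0
      have i4 : U (M + n + 1) - 2 * τ / c ≤ (1 - c / 2 * x) * (y - 2 * τ / c) := by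
        have : (1 - c / 2 * x) * (y - 2 * τ / c) = y - 2 * τ / c - c / 2 * x * y + τ * x := by
          field_simp
          ring
        rw [this]
        nlinarith
      have i5 : 0 ≤ 1 - c / 2 * x := by
        rw [le_div_iff₀ hc] at m2
        linarith
      calc _ ≤ (1 - c / 2 * x) * (y - 2 * τ / c) := i4
        _ ≤ (1 - c / 2 * x) * (Z * Real.exp (-(c / 2) * ∑ i ∈ range n, G (M + i))) :=
          mul_le_mul_of_nonneg_left ih i5
        _ ≤ Real.exp (-(c / 2) * x) * (Z * Real.exp (-(c / 2) * ∑ i ∈ range n, G (M + i))) :=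
          mul_le_mul_of_nonneg_right (by linarith [Real.add_one_le_exp (-(c / 2) * x)])
            (mul_nonneg hZ0 (Real.exp_pos _).le)
        _ = _ := by ring
  have h2 : Tendsto (fun n => ∑ i ∈ range n, G (M + i)) atTop atTop := by
    have := tendsto_atTop_add_const_right _ (-(∑ i ∈ range M, G i))
      (hdiv.comp (tendsto_add_atTop_nat M))
    refine this.congr fun n => ?_
    simp only [Function.comp]
    rw [add_comm n M, sum_range_add]
    ring
  have h3 : Tendsto (fun n => Z * Real.exp (-(c / 2) * ∑ i ∈ range n, G (M + i))) atTop (𝓝 0) := by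
    have := (Real.tendsto_exp_atBot.comp
      (h2.const_mul_atTop_of_neg (by linarith : -(c / 2) < 0))).const_mul Z
    simpa using this
  obtain ⟨n0, hn0⟩ := eventually_atTop.1 (h3.eventually_lt_const (half_pos hδ))
  refine ⟨M + n0, fun n hn => ?_⟩
  obtain ⟨l, rfl⟩ := Nat.exists_eq_add_of_le (le_trans (Nat.le_add_right _ _) hn)
  have i1 := hn0 l (by omega)
  have i2 := h1 l
  have i3 : 2 * τ / c ≤ δ / 4 := by
    rw [div_le_iff₀ hc]
    have := min_le_right (c / 2) (c * δ / 8)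
    linarith
  rw [Real.dist_eq, sub_zero, abs_of_nonneg (hU _)]
  linarith

theorem tendsto_of_tendsto_blocks {u : ℕ → ℝ} {h : ℕ} (hh : 0 < h) {l : ℝ}
    (hu : ∀ r < h, Tendsto (fun m => u (m * h + r)) atTop (𝓝 l)) : Tendsto u atTop (𝓝 l) := by
  rw [Metric.tendsto_atTop]
  intro δ hδ
  have h1 : ∀ᶠ m in atTop, ∀ r ∈ range h, dist (u (m * h + r)) l < δ := by
    rw [eventually_all_finset]
    intro r hr
    exact (hu r (mem_range.1 hr)).eventually (Metric.ball_mem_nhds l hδ)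
  obtain ⟨M, hM⟩ := eventually_atTop.1 h1
  refine ⟨M * h, fun n hn => ?_⟩
  have := hM (n / h) ((Nat.le_div_iff_mul_le hh).2 hn) (n % h) (mem_range.2 (Nat.mod_lt _ hh))
  rwa [Nat.div_add_mod'] at this

/-- One step adds a vanishing amount, so convergence to `0` passes from position `r` of the blocks
to position `r + 1`. -/
theorem tendsto_of_tendsto_block_starts {u ε : ℕ → ℝ} {h : ℕ} (hh : 0 < h) {C : ℝ}
    (hu : ∀ k, 0 ≤ u k) (hε : Tendsto ε atTop (𝓝 0))
    (hstep : ∀ k, u (k + 1) ≤ u k + C * ε k * (1 + u k))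
    (h0 : Tendsto (fun m => u (m * h)) atTop (𝓝 0)) : Tendsto u atTop (𝓝 0) := by
  refine tendsto_of_tendsto_blocks hh fun r _ => ?_
  induction r with
  | zero => simpa using h0
  | succ r ih =>
    have ih := ih (by omega)
    have he : Tendsto (fun m => ε (m * h + r)) atTop (𝓝 0) :=
      hε.comp (tendsto_block_index hh r)
    have h1 : Tendsto (fun m => u (m * h + r) + C * ε (m * h + r) * (1 + u (m * h + r)))
        atTop (𝓝 (0 + C * 0 * (1 + 0))) := ih.add ((he.const_mul C).mul (ih.const_add 1))
    rw [mul_zero, zero_mul, add_zero] at h1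
    exact squeeze_zero (fun m => hu _) (fun m => hstep _) h1

variable {a b lam : ℕ → ℝ}

theorem frequently_lt_of_gainC1 (hg : GainC1 a b lam) {u : ℕ → ℝ} {h : ℕ} (hh : 0 < h) {c C : ℝ}
    (hc : 0 < c) (hC : 0 ≤ C) (hu : ∀ k, 0 ≤ u k)
    (hblock : ∀ m, u ((m + 1) * h) ≤ u (m * h)
      - c * min (a ((m + 1) * h)) (b ((m + 1) * h)) * u (m * h)
      + C * (∑ j ∈ range h, (a (m * h + j) ^ 2 + b (m * h + j) ^ 2 + lam (m * h + j)))
        * (1 + u (m * h)))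
    {δ : ℝ} (hδ : 0 < δ) : ∃ᶠ k in atTop, u k < δ := by
  have hpos : ∀ k, 0 ≤ a k ^ 2 + b k ^ 2 + lam k := fun k => by
    have := (hg.nonneg k).2.2
    positivity
  have hanti : Antitone fun k => min (a k) (b k) := hg.anti.1.min hg.anti.2.1
  have key := frequently_lt_of_descent (U := fun m => u (m * h))
    (G := fun m => min (a ((m + 1) * h)) (b ((m + 1) * h)))
    (η := fun m => C * ∑ j ∈ range h, (a (m * h + j) ^ 2 + b (m * h + j) ^ 2 + lam (m * h + j)))
    hc (fun m => hu _) (fun m => le_min (hg.nonneg _).1 (hg.nonneg _).2.1)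
    (fun m => mul_nonneg hC (sum_nonneg fun j _ => hpos _)) hblock
    ((summable_sum_blocks hpos hg.summable h).mul_left C)
    (tendsto_sum_block_ends hanti hg.diverge hh) hδ
  have ht : Tendsto (fun m : ℕ => m * h) atTop atTop :=
    by simpa using tendsto_block_index hh 0
  exact ht.frequently key

/-- The error `ε` is small relative to the gain at the same time, while the block inequality has the
gain at the end of the block. The ratio conditions bridge the two: over at most `h` steps the gain
drops by no more than a factor `K ^ h`. -/
theorem tendsto_zero_of_gainC2 (hg : GainC2 a b lam) {u : ℕ → ℝ} {h : ℕ} (hh : 0 < h) {c C : ℝ}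
    (hc : 0 < c) (hC : 0 ≤ C) (hu : ∀ k, 0 ≤ u k)
    (hstep : ∀ k, u (k + 1) ≤ u k + C * (a k ^ 2 + b k ^ 2 + lam k) * (1 + u k))
    (hblock : ∀ m, u ((m + 1) * h) ≤ u (m * h)
      - c * min (a ((m + 1) * h)) (b ((m + 1) * h)) * u (m * h)
      + C * (∑ j ∈ range h, (a (m * h + j) ^ 2 + b (m * h + j) ^ 2 + lam (m * h + j)))
        * (1 + u (m * h))) : Tendsto u atTop (𝓝 0) := by
  have ha0 : ∀ k, 0 ≤ a k := fun k => (hg.nonneg k).1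
  have hb0 : ∀ k, 0 ≤ b k := fun k => (hg.nonneg k).2.1
  have hg0 : ∀ k, 0 ≤ min (a k) (b k) := fun k => le_min (ha0 k) (hb0 k)
  have hanti : Antitone fun k => min (a k) (b k) := hg.anti.1.min hg.anti.2.1
  have hε0 : Tendsto (fun k => a k ^ 2 + b k ^ 2 + lam k) atTop (𝓝 0) := by
    have := ((hg.tendsto_zero.1.pow 2).add (hg.tendsto_zero.2.1.pow 2)).add hg.tendsto_zero.2.2
    simpa using this
  have hgt : Tendsto (fun k => min (a k) (b k)) atTop (𝓝 0) := by
    simpa using hg.tendsto_zero.1.min hg.tendsto_zero.2.1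
  have hends : Tendsto (fun m : ℕ => (m + 1) * h) atTop atTop :=
    by simpa only [Nat.succ_mul] using tendsto_block_index hh h
  refine tendsto_of_tendsto_block_starts hh hu hε0 hstep ?_
  refine tendsto_zero_of_descent (U := fun m => u (m * h))
    (G := fun m => min (a ((m + 1) * h)) (b ((m + 1) * h))) hc (fun m => hu _) (fun m => hg0 _)
    hblock ?_ (hgt.comp hends) (tendsto_sum_block_ends hanti hg.diverge hh)
  obtain ⟨Ka, hKa⟩ := hg.a_ratio.bound
  obtain ⟨Kb, hKb⟩ := hg.b_ratio.bound
  -- With `K ≥ 1` the single power `K ^ h` serves every position in the block.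
  set K := max 1 (max Ka Kb) with hK
  have hK1 : 1 ≤ K := le_max_left _ _
  have hratio : ∀ᶠ k in atTop, min (a k) (b k) ≤ K * min (a (k + 1)) (b (k + 1)) := by
    filter_upwards [hKa, hKb] with k h1 h2
    rw [Real.norm_of_nonneg (ha0 _), Real.norm_of_nonneg (ha0 _)] at h1
    rw [Real.norm_of_nonneg (hb0 _), Real.norm_of_nonneg (hb0 _)] at h2
    have h3 : a k ≤ K * a (k + 1) := h1.trans (mul_le_mul_of_nonneg_right
      ((le_max_left _ _).trans (le_max_right _ _)) (ha0 _))
    have h4 : b k ≤ K * b (k + 1) := h2.trans (mul_le_mul_of_nonneg_right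
      ((le_max_right _ _).trans (le_max_right _ _)) (hb0 _))
    rw [mul_min_of_nonneg _ _ (by linarith)]
    exact min_le_min h3 h4
  obtain ⟨M1, hM1⟩ := eventually_atTop.1 hratio
  have hback : ∀ i k, M1 ≤ k → min (a k) (b k) ≤ K ^ i * min (a (k + i)) (b (k + i)) := by
    intro i
    induction i with
    | zero => intro k _; simp
    | succ i ih =>
      intro k hk
      refine (ih k hk).trans ?_
      rw [pow_succ, mul_assoc]
      exact mul_le_mul_of_nonneg_left (hM1 (k + i) (by omega)) (by positivity)
  intro τ hτ
  -- Chosen so that `C h K ^ h τ' ≤ τ`; the added `1` keeps the denominator positive.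
  set τ' := τ / (C * h * K ^ h + 1) with hτ'
  have hden : 0 < C * h * K ^ h + 1 := by positivity
  have hτ'0 : 0 < τ' := div_pos hτ hden
  obtain ⟨M2, hM2⟩ := eventually_atTop.1 (hg.small.bound hτ'0)
  filter_upwards [eventually_ge_atTop (max M1 M2)] with m hm
  have hmh : m ≤ m * h := Nat.le_mul_of_pos_right m hh
  set g := min (a ((m + 1) * h)) (b ((m + 1) * h)) with hgdef
  have hterm : ∀ j ∈ range h, a (m * h + j) ^ 2 + b (m * h + j) ^ 2 + lam (m * h + j)
      ≤ τ' * (K ^ h * g) := by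
    intro j hj
    have hj' := mem_range.1 hj
    have h1 := hM2 (m * h + j) (by have := le_max_right M1 M2; omega)
    rw [Real.norm_of_nonneg (hg0 _)] at h1
    refine (le_trans (le_abs_self _) h1).trans (mul_le_mul_of_nonneg_left ?_ hτ'0.le)
    have h2 := hback (h - j) (m * h + j) (by have := le_max_left M1 M2; omega)
    have e : m * h + j + (h - j) = (m + 1) * h := by
      rw [Nat.add_assoc, Nat.add_sub_cancel' hj'.le, Nat.succ_mul]
    rw [e] at h2
    exact h2.trans (mul_le_mul_of_nonneg_right (pow_le_pow_right₀ hK1 (Nat.sub_le _ _)) (hg0 _))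
  have hsum := sum_le_sum hterm
  rw [sum_const, card_range, nsmul_eq_mul] at hsum
  calc C * _ ≤ C * (h * (τ' * (K ^ h * g))) := mul_le_mul_of_nonneg_left hsum hC
    _ = (C * h * K ^ h) * τ' * g := by ring
    _ ≤ τ * g := by
      refine mul_le_mul_of_nonneg_right ?_ (hg0 _)
      have : (C * h * K ^ h + 1) * τ' = τ := by rw [hτ']; field_simp
      linarith

end Sequences

/-! ### Measurability of the data, the enriched past, and uniform moment bounds. -/

section

theorem measurable_toEuclideanLin {Ω : Type*} {m : MeasurableSpace Ω} {p q : ℕ}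
    {M : Ω → Matrix (Fin p) (Fin q) ℝ} {x : Ω → EuclideanSpace ℝ (Fin q)}
    (hM : ∀ r s, Measurable[m] fun ω => M ω r s) (hx : Measurable[m] x) :
    Measurable[m] fun ω => Matrix.toEuclideanLin (M ω) (x ω) := by
  refine (PiLp.continuous_toLp 2 _).measurable.comp (measurable_pi_iff.2 fun r => ?_)
  refine Finset.measurable_sum (s := Finset.univ) (f := fun s ω => M ω r s * x ω s)
    fun s _ => (hM r s).mul ?_
  exact (measurable_pi_apply s).comp ((PiLp.continuous_ofLp 2 _).measurable.comp hx)

theorem continuous_specNorm {ι : Type*} [Fintype ι] [DecidableEq ι] :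
    Continuous fun M : ι → ι → ℝ => specNorm (Matrix.of M) := by
  let L : (ι → ι → ℝ) →ₗ[ℝ] (EuclideanSpace ℝ ι →L[ℝ] EuclideanSpace ℝ ι) :=
    { toFun := fun M => Matrix.toEuclideanCLM (n := ι) (𝕜 := ℝ) (Matrix.of M)
      map_add' := fun M M' => map_add (Matrix.toEuclideanCLM (n := ι) (𝕜 := ℝ)) _ _
      map_smul' := fun c M => map_smul (Matrix.toEuclideanCLM (n := ι) (𝕜 := ℝ)) c (Matrix.of M) }
  exact continuous_norm.comp L.continuous_of_finiteDimensional

theorem measurable_specNorm_blockDiagonal {Ω : Type*} {m : MeasurableSpace Ω} {N n : ℕ}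
    {d : Fin N → ℕ} {H : (i : Fin N) → Ω → Matrix (Fin (d i)) (Fin n) ℝ}
    (hH : ∀ i r s, Measurable fun ω => H i ω r s) :
    Measurable fun ω => specNorm (Matrix.blockDiagonal' fun i => (H i ω).transpose * H i ω) := by
  refine (continuous_specNorm (ι := (_ : Fin N) × Fin n)).measurable.comp
    (measurable_pi_iff.2 fun p => measurable_pi_iff.2 fun q => ?_)
  obtain ⟨i, r⟩ := p
  obtain ⟨j, s⟩ := q
  by_cases hij : i = j
  · subst hij
    simp only [Matrix.mul_apply, Matrix.transpose_apply]
    exact Finset.measurable_sum _ fun t _ => (hH i t r).mul (hH i t s)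
  · simp only [hij, dite_false]
    exact measurable_const

variable {Ω : Type*} [mΩ : MeasurableSpace Ω] {N n : ℕ} {d : Fin N → ℕ}

namespace Network

variable (net : Network Ω N n d)

theorem sigmaAH_le (k : ℕ) : net.sigmaAH k ≤ mΩ :=
  sup_le (iSup_le fun i => iSup_le fun j => (net.measurable_A k i j).comap_le)
    (iSup_le fun i => iSup_le fun r => iSup_le fun s => (net.measurable_H k i r s).comap_le)

theorem sigmaNoise_le (k : ℕ) : net.sigmaNoise k ≤ mΩ :=
  sup_le (iSup_le fun i => (net.measurable_v k i).comap_le)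
    (iSup_le fun j => iSup_le fun i => (net.measurable_ξ k j i).comap_le)

theorem history_le (k : ℕ) : net.history k ≤ mΩ :=
  iSup_le fun s => iSup_le fun _ => sup_le (net.sigmaAH_le s) (net.sigmaNoise_le s)

theorem history_mono : Monotone net.history := fun _ _ hkl =>
  iSup_le fun s => iSup_le fun hs =>
    le_iSup₂_of_le (f := fun s _ => net.sigmaAH s ⊔ net.sigmaNoise s) s (hs.trans_le hkl) le_rfl

theorem sigmaAH_le_history (k : ℕ) : net.sigmaAH k ≤ net.history (k + 1) :=
  le_iSup₂_of_le (f := fun s _ => net.sigmaAH s ⊔ net.sigmaNoise s) k k.lt_succ_self le_sup_left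

theorem sigmaNoise_le_history (k : ℕ) : net.sigmaNoise k ≤ net.history (k + 1) :=
  le_iSup₂_of_le (f := fun s _ => net.sigmaAH s ⊔ net.sigmaNoise s) k k.lt_succ_self le_sup_right

/-- The filtration `k ↦ 𝓕(k - 1)`. -/
def filtration : Filtration ℕ mΩ where
  seq := net.history
  mono' := net.history_mono
  le' := net.history_le

/-- The σ-algebra generated by the noises at the times `s < k`. -/
@[reducible]
def noiseHistory (k : ℕ) : MeasurableSpace Ω := ⨆ s, ⨆ _ : s < k, net.sigmaNoise s

/-- The σ-algebra generated by the noises at the times `s < k` together with all graphs and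
regression matrices. -/
@[reducible]
def enriched (k : ℕ) : MeasurableSpace Ω := net.noiseHistory k ⊔ ⨆ s, net.sigmaAH s

theorem noiseHistory_le_history (k : ℕ) : net.noiseHistory k ≤ net.history k :=
  iSup₂_mono fun _ _ => le_sup_right

theorem noiseHistory_le_iSup (k : ℕ) : net.noiseHistory k ≤ ⨆ s, net.sigmaNoise s :=
  iSup_le fun s => iSup_le fun _ => le_iSup net.sigmaNoise s

theorem enriched_le (k : ℕ) : net.enriched k ≤ mΩ :=
  sup_le ((net.noiseHistory_le_history k).trans (net.history_le k)) (iSup_le net.sigmaAH_le)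

theorem history_le_enriched (k : ℕ) : net.history k ≤ net.enriched k :=
  iSup₂_le fun s hs => sup_le ((le_iSup net.sigmaAH s).trans le_sup_right)
    ((le_iSup₂_of_le (f := fun s _ => net.sigmaNoise s) s hs le_rfl).trans le_sup_left)

theorem sigmaAH_le_enriched (k : ℕ) : net.sigmaAH k ≤ net.enriched k :=
  (le_iSup net.sigmaAH k).trans le_sup_right

theorem measurable_A_sigmaAH (k : ℕ) (i j : Fin N) :
    Measurable[net.sigmaAH k] fun ω => net.A k ω i j :=
  (comap_measurable _).mono (le_trans (le_trans
    (le_iSup (fun j => MeasurableSpace.comap (fun ω => net.A k ω i j) inferInstance) j)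
    (le_iSup (fun i => ⨆ j, MeasurableSpace.comap (fun ω => net.A k ω i j) inferInstance) i))
    le_sup_left) le_rfl

theorem measurable_H_sigmaAH (k : ℕ) (i : Fin N) (r : Fin (d i)) (s : Fin n) :
    Measurable[net.sigmaAH k] fun ω => net.H k i ω r s := by
  refine (comap_measurable _).mono (le_trans ?_ le_sup_right) le_rfl
  refine le_trans ?_ (le_iSup (fun i => ⨆ r, ⨆ s,
    MeasurableSpace.comap (fun ω => net.H k i ω r s) inferInstance) i)
  refine le_trans ?_ (le_iSup (fun r => ⨆ s,
    MeasurableSpace.comap (fun ω => net.H k i ω r s) inferInstance) r)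
  exact le_iSup (fun s => MeasurableSpace.comap (fun ω => net.H k i ω r s) inferInstance) s

theorem measurable_v_sigmaNoise (k : ℕ) (i : Fin N) : Measurable[net.sigmaNoise k] (net.v k i) :=
  (comap_measurable _).mono (le_trans
    (le_iSup (fun i => MeasurableSpace.comap (net.v k i) inferInstance) i) le_sup_left) le_rfl

theorem measurable_ξ_sigmaNoise (k : ℕ) (j i : Fin N) :
    Measurable[net.sigmaNoise k] (net.ξ k j i) :=
  (comap_measurable _).mono (le_trans (le_trans
    (le_iSup (fun i => MeasurableSpace.comap (net.ξ k j i) inferInstance) i)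
    (le_iSup (fun j => ⨆ i, MeasurableSpace.comap (net.ξ k j i) inferInstance) j))
    le_sup_right) le_rfl

theorem measurable_noiseSq (k : ℕ) : Measurable[net.sigmaNoise k] (net.noiseSq k) := by
  refine Measurable.add (Finset.measurable_sum _ fun i _ => ?_)
    (Finset.measurable_sum _ fun j _ => Finset.measurable_sum _ fun i _ => ?_)
  · exact ((net.measurable_v_sigmaNoise k i).stronglyMeasurable.norm.pow 2).measurable
  · exact ((net.measurable_ξ_sigmaNoise k j i).stronglyMeasurable.norm.pow 2).measurable

theorem noiseSq_nonneg (k : ℕ) (ω : Ω) : 0 ≤ net.noiseSq k ω :=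
  add_nonneg (Finset.sum_nonneg fun _ _ => sq_nonneg _)
    (Finset.sum_nonneg fun _ _ => Finset.sum_nonneg fun _ _ => sq_nonneg _)

theorem norm_ξ_sq_le_noiseSq (k : ℕ) (j i : Fin N) (ω : Ω) :
    ‖net.ξ k j i ω‖ ^ 2 ≤ net.noiseSq k ω := by
  have h1 := Finset.single_le_sum (f := fun i => ‖net.ξ k j i ω‖ ^ 2)
    (fun _ _ => sq_nonneg _) (Finset.mem_univ i)
  have h2 := Finset.single_le_sum (f := fun j => ∑ i, ‖net.ξ k j i ω‖ ^ 2)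
    (fun _ _ => Finset.sum_nonneg fun _ _ => sq_nonneg _) (Finset.mem_univ j)
  have h3 : 0 ≤ ∑ i, ‖net.v k i ω‖ ^ 2 := Finset.sum_nonneg fun _ _ => sq_nonneg _
  rw [noiseSq]
  linarith

theorem measurable_specNorm_gram (k : ℕ) :
    Measurable[net.sigmaAH k] fun ω => specNorm (net.gram k ω) := by
  simp only [gram_eq]
  exact measurable_specNorm_blockDiagonal (net.measurable_H_sigmaAH k)

end Network

/-- Uniform bounds on the random data, in the form in which the analysis of the algorithm uses
them. -/
structure DataBounds (μ : Measure Ω) (net : Network Ω N n d) (ρ R β : ℝ) : Prop where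
  ρ_nonneg : 0 ≤ ρ
  R_nonneg : 0 ≤ R
  β_nonneg : 0 ≤ β
  A_le : ∀ᵐ ω ∂μ, ∀ k i j, |net.A k ω i j| ≤ ρ
  integrable_gram : ∀ k, Integrable (fun ω => specNorm (net.gram k ω)) μ
  integrable_gram_sq : ∀ k, Integrable (fun ω => specNorm (net.gram k ω) ^ 2) μ
  condExp_gram : ∀ k, ∀ᵐ ω ∂μ, (μ[fun ω => specNorm (net.gram k ω)|net.history k]) ω ≤ R
  condExp_gram_sq : ∀ k, ∀ᵐ ω ∂μ, (μ[fun ω => specNorm (net.gram k ω) ^ 2|net.history k]) ω ≤ R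
  integrable_noiseSq : ∀ k, Integrable (net.noiseSq k) μ
  condExp_noiseSq : ∀ k, ∀ᵐ ω ∂μ, (μ[net.noiseSq k|net.enriched k]) ω ≤ β
  integrable_v : ∀ k i, Integrable (net.v k i) μ
  integrable_ξ : ∀ k j i, Integrable (net.ξ k j i) μ
  condExp_v : ∀ k i, μ[net.v k i|net.enriched k] =ᵐ[μ] 0
  condExp_ξ : ∀ k j i, μ[net.ξ k j i|net.enriched k] =ᵐ[μ] 0

/-- By independence, adjoining the graphs and regression matrices of all times to the past noises
does not change the conditional law of the present noise; the tower property then passes through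
`𝓕(k-1)`. Thus `𝓐(k)` and `𝓗(k)` may be treated as known when the noise at time `k` is averaged,
although they do not belong to `𝓕(k-1)`. -/
theorem condExp_enriched {μ : Measure Ω} [IsProbabilityMeasure μ] (net : Network Ω N n d)
    (hind : Indep (⨆ k, net.sigmaNoise k) (⨆ k, net.sigmaAH k) μ) {E : Type*}
    [NormedAddCommGroup E] [NormedSpace ℝ E] [CompleteSpace E] {k : ℕ} {z : Ω → E}
    (hz : StronglyMeasurable[net.sigmaNoise k] z) (hzi : Integrable z μ) :
    μ[z|net.enriched k] =ᵐ[μ] μ[μ[z|net.history k]|net.noiseHistory k] :=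
  (condExp_sup_of_indep (net.noiseHistory_le_iSup k) (iSup_le net.sigmaNoise_le)
    (iSup_le net.sigmaAH_le) hind (hz.mono (le_iSup net.sigmaNoise k)) hzi).trans
    (condExp_condExp_of_le (net.noiseHistory_le_history k) (net.history_le k)).symm

theorem condExp_le_const {μ : Measure Ω} [IsProbabilityMeasure μ] {m : MeasurableSpace Ω}
    (hm : m ≤ mΩ) {X : Ω → ℝ} (hX : Integrable X μ) {C : ℝ} (h : ∀ᵐ ω ∂μ, X ω ≤ C) :
    ∀ᵐ ω ∂μ, (μ[X|m]) ω ≤ C := by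
  have := condExp_mono (m := m) hX (integrable_const C) h
  rwa [condExp_const hm] at this

/-- The exponent `p` is at least `4`, so the first and second powers of the Gram norm are dominated
by `1 + x ^ p`. The noise bounds are transported to the enriched past by `condExp_enriched`. -/
theorem exists_dataBounds {μ : Measure Ω} [IsProbabilityMeasure μ] {net : Network Ω N n d}
    (hA2 : NoiseAssumption μ net) {h : ℕ} {ρ : ℝ} (hmom : MomentBound μ net h ρ) :
    ∃ ρ R β, DataBounds μ net ρ R β := by
  obtain ⟨β, hβ⟩ := hA2.bounded
  set p := 2 ^ max h 2 with hp
  have hp4 : 4 ≤ p := by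
    calc 4 = 2 ^ 2 := by norm_num
      _ ≤ p := Nat.pow_le_pow_right (by norm_num) (le_max_right _ _)
  have hG0 : ∀ k ω, 0 ≤ specNorm (net.gram k ω) := fun k ω => specNorm_nonneg _
  have hGm : ∀ k, Measurable fun ω => specNorm (net.gram k ω) := fun k =>
    (net.measurable_specNorm_gram k).mono (net.sigmaAH_le k) le_rfl
  have hGp : ∀ k, ∀ᵐ ω ∂μ,
      0 ≤ (μ[fun ω' => specNorm (net.gram k ω') ^ p|net.history k]) ω := fun k =>
    condExp_nonneg (ae_of_all _ fun ω => pow_nonneg (hG0 k ω) _)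
  have hGp' := ae_all_iff.2 hGp
  have hρ : ∀ᵐ ω ∂μ, ∀ k, (μ[fun ω' => specNorm (net.gram k ω') ^ p|net.history k]) ω ≤ ρ ^ p ∧
      specNorm (laplacian (net.A k ω)) ≤ ρ := by
    filter_upwards [hmom.bound, hGp'] with ω h1 h2 k
    have h3 := h1 k
    set c := (μ[fun ω' => specNorm (net.gram k ω') ^ p|net.history k]) ω with hc
    have h4 : 0 ≤ c ^ (1 / (2 ^ max h 2 : ℝ)) := Real.rpow_nonneg (h2 k) _
    have h5 := specNorm_nonneg (laplacian (net.A k ω))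
    refine ⟨?_, by linarith⟩
    have h6 : c ^ (1 / (2 ^ max h 2 : ℝ)) ≤ ρ := by linarith
    -- Undoing the `p`-th root requires `c ≥ 0`, which holds only almost surely.
    have h7 : (c ^ (1 / (2 ^ max h 2 : ℝ))) ^ p = c := by
      rw [← Real.rpow_natCast, ← Real.rpow_mul (h2 k), hp]
      push_cast
      rw [one_div, inv_mul_cancel₀ (by positivity), Real.rpow_one]
    rw [← h7]
    exact pow_le_pow_left₀ h4 h6 p
  have hpow : ∀ x : ℝ, 0 ≤ x → ∀ q ≤ p, x ^ q ≤ 1 + x ^ p := by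
    intro x hx q hq
    rcases le_total x 1 with h1 | h1
    · have := pow_le_one₀ hx h1 (n := q)
      linarith [pow_nonneg hx p]
    · have := pow_le_pow_right₀ h1 hq
      linarith
  have hdom : ∀ k, Integrable (fun ω => 1 + specNorm (net.gram k ω) ^ p) μ := fun k =>
    (integrable_const 1).add (hmom.integrable k)
  have hint : ∀ k, ∀ q ≤ p, Integrable (fun ω => specNorm (net.gram k ω) ^ q) μ := by
    intro k q hq
    refine (hdom k).mono' ((hGm k).pow_const q).aestronglyMeasurable (ae_of_all _ fun ω => ?_)
    rw [Real.norm_of_nonneg (pow_nonneg (hG0 k ω) _)]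
    exact hpow _ (hG0 k ω) q hq
  have hcond : ∀ k, ∀ q ≤ p, ∀ᵐ ω ∂μ,
      (μ[fun ω => specNorm (net.gram k ω) ^ q|net.history k]) ω ≤ 1 + |ρ| ^ p := by
    intro k q hq
    have h1 : μ[fun ω => specNorm (net.gram k ω) ^ q|net.history k] ≤ᵐ[μ]
        μ[fun ω => 1 + specNorm (net.gram k ω) ^ p|net.history k] :=
      condExp_mono (hint k q hq) (hdom k) (ae_of_all _ fun ω => hpow _ (hG0 k ω) q hq)
    have h2 : μ[fun ω => 1 + specNorm (net.gram k ω) ^ p|net.history k] =ᵐ[μ]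
        μ[fun _ => (1 : ℝ)|net.history k] +
          μ[fun ω => specNorm (net.gram k ω) ^ p|net.history k] :=
      condExp_add (integrable_const 1) (hmom.integrable k) _
    rw [condExp_const (net.history_le k)] at h2
    filter_upwards [h1, h2, hρ] with ω e1 e2 e3
    rw [e2] at e1
    refine e1.trans (add_le_add le_rfl ((e3 k).1.trans ?_))
    rw [← abs_pow]
    exact le_abs_self _
  have hnoise : ∀ k, ∀ᵐ ω ∂μ, (μ[net.noiseSq k|net.enriched k]) ω ≤ β := by
    intro k
    filter_upwards [condExp_enriched net hA2.indep (net.measurable_noiseSq k).stronglyMeasurable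
      (hA2.integrable_sq k), condExp_le_const (m := net.noiseHistory k)
      ((net.noiseHistory_le_history k).trans (net.history_le k)) integrable_condExp
      (hβ.mono fun ω hω => hω k)] with ω e1 e2
    rwa [e1]
  -- Absolute values make the three constants nonnegative.
  refine ⟨|ρ|, 1 + |ρ| ^ p, |β|, abs_nonneg _, by positivity, abs_nonneg _, ?_, ?_, ?_, ?_, ?_,
    hA2.integrable_sq, fun k => (hnoise k).mono fun ω hω => hω.trans (le_abs_self _),
    hA2.integrable_v, hA2.integrable_ξ, ?_, ?_⟩
  · filter_upwards [hρ] with ω hω k i j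
    exact ((abs_adjacency_le_specNorm_laplacian _ (net.A_diag k ω) i j).trans (hω k).2).trans
      (le_abs_self _)
  · exact fun k => by simpa using hint k 1 (by omega)
  · exact fun k => hint k 2 (by omega)
  · exact fun k => by simpa using hcond k 1 (by omega)
  · exact fun k => hcond k 2 (by omega)
  · intro k i
    refine (condExp_enriched net hA2.indep (net.measurable_v_sigmaNoise k i).stronglyMeasurable
      (hA2.integrable_v k i)).trans ?_
    exact (condExp_congr_ae (hA2.condExp_v k i)).trans (by rw [condExp_zero])
  · intro k j i
    refine (condExp_enriched net hA2.indep (net.measurable_ξ_sigmaNoise k j i).stronglyMeasurable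
      (hA2.integrable_ξ k j i)).trans ?_
    exact (condExp_congr_ae (hA2.condExp_ξ k j i)).trans (by rw [condExp_zero])

end

/-! ### Dirichlet energy and the splitting into average and disagreement. -/

section Energies

variable {N n : ℕ}

/-- The squared norm of a stacked vector. -/
def sqSum (e : Fin N → EuclideanSpace ℝ (Fin n)) : ℝ := ∑ i, ‖e i‖ ^ 2

/-- The Dirichlet energy of a stacked vector on a weighted graph. -/
def dirichlet (w : Matrix (Fin N) (Fin N) ℝ) (e : Fin N → EuclideanSpace ℝ (Fin n)) : ℝ :=
  ∑ i, ∑ j, w i j * (‖e i - e j‖ ^ 2 / 2)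

/-- The average of a stacked vector. -/
def average (e : Fin N → EuclideanSpace ℝ (Fin n)) : EuclideanSpace ℝ (Fin n) :=
  (N : ℝ)⁻¹ • ∑ i, e i

theorem sqSum_nonneg (e : Fin N → EuclideanSpace ℝ (Fin n)) : 0 ≤ sqSum e :=
  Finset.sum_nonneg fun _ _ => sq_nonneg _

theorem norm_sq_le_sqSum (e : Fin N → EuclideanSpace ℝ (Fin n)) (i : Fin N) :
    ‖e i‖ ^ 2 ≤ sqSum e :=
  Finset.single_le_sum (f := fun i => ‖e i‖ ^ 2) (fun _ _ => sq_nonneg _) (Finset.mem_univ i)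

theorem norm_add_sq_le {E : Type*} [NormedAddCommGroup E] [InnerProductSpace ℝ E] (x y : E) :
    ‖x + y‖ ^ 2 ≤ 2 * ‖x‖ ^ 2 + 2 * ‖y‖ ^ 2 := by
  have h1 := norm_add_sq_real x y
  have h2 := norm_sub_sq_real x y
  nlinarith [sq_nonneg ‖x - y‖]

theorem norm_sub_sq_le {E : Type*} [NormedAddCommGroup E] [InnerProductSpace ℝ E] (x y : E) :
    ‖x - y‖ ^ 2 ≤ 2 * ‖x‖ ^ 2 + 2 * ‖y‖ ^ 2 := by
  have := norm_add_sq_le x (-y)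
  rwa [← sub_eq_add_neg, norm_neg] at this

theorem sqSum_add_le (e e' : Fin N → EuclideanSpace ℝ (Fin n)) :
    sqSum (e + e') ≤ 2 * sqSum e + 2 * sqSum e' := by
  unfold sqSum
  rw [Finset.mul_sum, Finset.mul_sum, ← Finset.sum_add_distrib]
  exact Finset.sum_le_sum fun i _ => norm_add_sq_le _ _

theorem sum_norm_sub_sq_le (e : Fin N → EuclideanSpace ℝ (Fin n)) :
    ∑ i, ∑ j, ‖e i - e j‖ ^ 2 ≤ 4 * N * sqSum e := by
  have h : ∑ i, ∑ j, ‖e i - e j‖ ^ 2 ≤ ∑ i, ∑ j, (2 * ‖e i‖ ^ 2 + 2 * ‖e j‖ ^ 2) :=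
    Finset.sum_le_sum fun i _ => Finset.sum_le_sum fun j _ => norm_sub_sq_le _ _
  refine h.trans (le_of_eq ?_)
  simp only [Finset.sum_add_distrib, ← Finset.mul_sum, Finset.sum_const, Finset.card_univ,
    Fintype.card_fin, nsmul_eq_mul, sqSum]
  ring

theorem abs_dirichlet_le {w : Matrix (Fin N) (Fin N) ℝ} {ρ : ℝ} (hw : ∀ i j, |w i j| ≤ ρ)
    (e : Fin N → EuclideanSpace ℝ (Fin n)) (hρ : 0 ≤ ρ) :
    |dirichlet w e| ≤ 2 * N * ρ * sqSum e := by
  have h1 : |dirichlet w e| ≤ ∑ i, ∑ j, ρ / 2 * ‖e i - e j‖ ^ 2 := by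
    refine (Finset.abs_sum_le_sum_abs _ _).trans (Finset.sum_le_sum fun i _ =>
      (Finset.abs_sum_le_sum_abs _ _).trans (Finset.sum_le_sum fun j _ => ?_))
    rw [abs_mul, abs_of_nonneg (by positivity : 0 ≤ ‖e i - e j‖ ^ 2 / 2)]
    have := mul_le_mul_of_nonneg_right (hw i j) (by positivity : 0 ≤ ‖e i - e j‖ ^ 2 / 2)
    linarith
  simp only [← Finset.mul_sum] at h1
  have h2 := mul_le_mul_of_nonneg_left (sum_norm_sub_sq_le e) (by linarith : 0 ≤ ρ / 2)
  linarith

theorem dirichlet_nonneg {w : Matrix (Fin N) (Fin N) ℝ} (hw : ∀ i j, 0 ≤ w i j)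
    (e : Fin N → EuclideanSpace ℝ (Fin n)) : 0 ≤ dirichlet w e :=
  Finset.sum_nonneg fun i _ => Finset.sum_nonneg fun j _ => mul_nonneg (hw i j) (by positivity)

/-- This is `‖u'‖² ≤ 2 ‖u‖² + 2 ‖u - u'‖²` on each edge, summed with nonnegative weights. It allows
the current state to be replaced by an earlier one. -/
theorem half_dirichlet_sub_le {w : Matrix (Fin N) (Fin N) ℝ} (hw : ∀ i j, 0 ≤ w i j)
    (e e' : Fin N → EuclideanSpace ℝ (Fin n)) :
    dirichlet w e' / 2 - dirichlet w (e - e') ≤ dirichlet w e := by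
  unfold dirichlet
  rw [Finset.sum_div, ← Finset.sum_sub_distrib]
  refine Finset.sum_le_sum fun i _ => ?_
  rw [Finset.sum_div, ← Finset.sum_sub_distrib]
  refine Finset.sum_le_sum fun j _ => ?_
  have h := norm_sub_sq_le (e i - e j) ((e - e') i - (e - e') j)
  have e1 : e i - e j - ((e - e') i - (e - e') j) = e' i - e' j := by
    simp only [Pi.sub_apply]; abel
  rw [e1] at h
  have := mul_le_mul_of_nonneg_left h (hw i j)
  linarith

/-- Polarization produces the energy plus the terms `wᵢⱼ (‖eᵢ‖² - ‖eⱼ‖²) / 2`, whose total vanishes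
because in-degrees equal out-degrees. -/
theorem sum_inner_eq_dirichlet {w : Matrix (Fin N) (Fin N) ℝ} (hw : IsBalanced w)
    (e : Fin N → EuclideanSpace ℝ (Fin n)) :
    ∑ i, ∑ j, w i j * inner ℝ (e i) (e i - e j) = dirichlet w e := by
  have h1 : ∑ i, ∑ j, w i j * ‖e j‖ ^ 2 = ∑ i, ∑ j, w i j * ‖e i‖ ^ 2 := by
    rw [Finset.sum_comm]
    refine Finset.sum_congr rfl fun j _ => ?_
    rw [← Finset.sum_mul, ← Finset.sum_mul]
    congr 1
    exact (hw j).symm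
  have h2 : ∀ i j, w i j * inner ℝ (e i) (e i - e j) =
      w i j * (‖e i - e j‖ ^ 2 / 2) + (w i j * ‖e i‖ ^ 2 - w i j * ‖e j‖ ^ 2) / 2 := by
    intro i j
    rw [norm_sub_sq_real, inner_sub_right, real_inner_self_eq_norm_sq]
    ring
  simp only [h2, Finset.sum_add_distrib, ← Finset.sum_div, Finset.sum_sub_distrib, h1, sub_self,
    zero_div, add_zero]
  rfl

/-- Since `‖eᵢ - eⱼ‖²` is symmetric in `i` and `j`, symmetrizing the weights leaves the energy
unchanged; balance plays no role here. -/
theorem sum_laplacian_symmetrized_inner (w : Matrix (Fin N) (Fin N) ℝ)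
    (e : Fin N → EuclideanSpace ℝ (Fin n)) :
    ∑ i, ∑ j, laplacian (symmetrized w) i j * inner ℝ (e i) (e j) = dirichlet w e := by
  have hs : ∀ i j, symmetrized w i j = (w i j + w j i) / 2 := fun i j => by
    simp only [symmetrized, Matrix.smul_apply, Matrix.add_apply, Matrix.transpose_apply,
      smul_eq_mul]
    ring
  have h1 : ∀ i, ∑ j, laplacian (symmetrized w) i j * inner ℝ (e i) (e j)
      = ∑ j, (w i j + w j i) / 2 * (‖e i‖ ^ 2 - inner ℝ (e i) (e j)) := by
    intro i
    simp only [laplacian, Matrix.sub_apply, sub_mul, Finset.sum_sub_distrib, mul_sub]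
    congr 1
    · rw [Finset.sum_eq_single i]
      · rw [Matrix.diagonal_apply_eq, real_inner_self_eq_norm_sq, inDegree, Finset.sum_mul]
        refine Finset.sum_congr rfl fun j _ => ?_
        rw [hs]
      · intro j _ hj
        rw [Matrix.diagonal_apply_ne _ hj.symm, zero_mul]
      · simp
    · refine Finset.sum_congr rfl fun j _ => ?_
      rw [hs]
  have h2 : ∑ i, ∑ j, w j i * (‖e i‖ ^ 2 - inner ℝ (e i) (e j))
      = ∑ i, ∑ j, w i j * (‖e j‖ ^ 2 - inner ℝ (e i) (e j)) := by
    rw [Finset.sum_comm]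
    refine Finset.sum_congr rfl fun i _ => Finset.sum_congr rfl fun j _ => ?_
    rw [real_inner_comm]
  have h3 : ∀ i j, (w i j + w j i) / 2 * (‖e i‖ ^ 2 - inner ℝ (e i) (e j))
      = w i j * (‖e i‖ ^ 2 - inner ℝ (e i) (e j)) / 2
        + w j i * (‖e i‖ ^ 2 - inner ℝ (e i) (e j)) / 2 := fun i j => by ring
  simp only [h1, h3, Finset.sum_add_distrib, ← Finset.sum_div]
  rw [h2, ← add_div, ← Finset.sum_add_distrib, Finset.sum_div]
  refine Finset.sum_congr rfl fun i _ => ?_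
  rw [← Finset.sum_add_distrib, Finset.sum_div]
  refine Finset.sum_congr rfl fun j _ => ?_
  rw [norm_sub_sq_real]
  ring

theorem sqSum_sub_average (hN : N ≠ 0) (e : Fin N → EuclideanSpace ℝ (Fin n)) :
    sqSum (fun i => e i - average e) = sqSum e - N * ‖average e‖ ^ 2 := by
  have hN' : (N : ℝ) ≠ 0 := Nat.cast_ne_zero.2 hN
  have h1 : ∑ i, inner ℝ (e i) (average e) = N * ‖average e‖ ^ 2 := by
    rw [← sum_inner]
    have : ∑ i, e i = (N : ℝ) • average e := by rw [average, smul_inv_smul₀ hN']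
    rw [this, inner_smul_left, real_inner_self_eq_norm_sq]
    simp
  simp only [sqSum, norm_sub_sq_real, Finset.sum_add_distrib, Finset.sum_sub_distrib,
    ← Finset.mul_sum, h1, Finset.sum_const, Finset.card_univ, Fintype.card_fin, nsmul_eq_mul]
  ring

theorem sum_mul_inner_eq_sum_coord {p : ℕ} (M : Matrix (Fin p) (Fin p) ℝ)
    (e : Fin p → EuclideanSpace ℝ (Fin n)) :
    ∑ i, ∑ j, M i j * inner ℝ (e i) (e j) = ∑ t, ∑ i, ∑ j, M i j * (e i t * e j t) := by
  have : ∀ i j, M i j * inner ℝ (e i) (e j) = ∑ t, M i j * (e i t * e j t) := by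
    intro i j
    rw [PiLp.inner_apply, Finset.mul_sum]
    refine Finset.sum_congr rfl fun t _ => ?_
    simp [mul_comm]
  simp only [this]
  rw [Finset.sum_comm (γ := Fin n)]
  exact Finset.sum_congr rfl fun i _ => Finset.sum_comm

/-- The scalar bound is applied in each coordinate of `ℝⁿ`; the squared means add up to `N ‖average
e‖²`. -/
theorem le_sum_inner_of_le_lambdaTwo (hN : N ≠ 0) {M : Matrix (Fin N) (Fin N) ℝ} {θ : ℝ}
    (hθ : 0 < θ) (h : θ ≤ lambdaTwo M) (h1 : ∀ r, ∑ s, M r s = 0)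
    (e : Fin N → EuclideanSpace ℝ (Fin n)) :
    θ * sqSum (fun i => e i - average e) ≤ ∑ i, ∑ j, M i j * inner ℝ (e i) (e j) := by
  have hN' : (N : ℝ) ≠ 0 := Nat.cast_ne_zero.2 hN
  rw [sum_mul_inner_eq_sum_coord, sqSum_sub_average hN]
  have h2 : sqSum e - N * ‖average e‖ ^ 2 = ∑ t, (∑ i, e i t ^ 2 - (∑ i, e i t) ^ 2 / N) := by
    rw [Finset.sum_sub_distrib, Finset.sum_comm]
    congr 1
    · simp only [sqSum, EuclideanSpace.real_norm_sq_eq]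
    · rw [average, norm_smul, mul_pow, EuclideanSpace.real_norm_sq_eq, ← Finset.sum_div]
      simp only [WithLp.ofLp_sum, Finset.sum_apply, norm_inv, RCLike.norm_natCast]
      field_simp
  rw [h2, Finset.mul_sum]
  refine Finset.sum_le_sum fun t _ => ?_
  have := le_quadratic_form_of_le_lambdaTwo hθ h h1 (WithLp.toLp 2 fun i => e i t)
  rwa [EuclideanSpace.real_norm_sq_eq] at this

end Energies

/-! ### Expected energies of states known from the past; connectivity and observability in
integrated form. -/

section

variable {Ω : Type*} [mΩ : MeasurableSpace Ω] {N n : ℕ} {d : Fin N → ℕ}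

theorem integrable_sum_condExpMatrix_mul {μ : Measure Ω} {m : MeasurableSpace Ω}
    {ι κ : Type*} [Fintype ι] [Fintype κ] {X : Ω → Matrix ι κ ℝ} {g : ι → κ → Ω → ℝ}
    (hX : ∀ r s, Integrable (fun ω => X ω r s) μ) (hg : ∀ r s, StronglyMeasurable[m] (g r s))
    (hXg : ∀ r s, Integrable (fun ω => X ω r s * g r s ω) μ) :
    Integrable (fun ω => ∑ r, ∑ s, condExpMatrix μ m X ω r s * g r s ω) μ :=
  integrable_finsetSum _ fun r _ => integrable_finsetSum _ fun s _ =>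
    integrable_condExp_mul (hX r s) (hg r s) (hXg r s)

theorem setIntegral_sum_condExpMatrix_mul {μ : Measure Ω} [IsFiniteMeasure μ]
    {m : MeasurableSpace Ω} (hm : m ≤ mΩ)
    {ι κ : Type*} [Fintype ι] [Fintype κ] {X : Ω → Matrix ι κ ℝ} {g : ι → κ → Ω → ℝ}
    (hX : ∀ r s, Integrable (fun ω => X ω r s) μ) (hg : ∀ r s, StronglyMeasurable[m] (g r s))
    (hXg : ∀ r s, Integrable (fun ω => X ω r s * g r s ω) μ) {S : Set Ω}
    (hS : MeasurableSet[m] S) :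
    ∫ ω in S, ∑ r, ∑ s, condExpMatrix μ m X ω r s * g r s ω ∂μ
      = ∫ ω in S, ∑ r, ∑ s, X ω r s * g r s ω ∂μ := by
  have h1 := fun r s => (integrable_condExp_mul (hX r s) (hg r s) (hXg r s)).integrableOn (s := S)
  have h2 := fun r s => (hXg r s).integrableOn (s := S)
  rw [integral_finsetSum _ fun r _ => integrable_finsetSum _ fun s _ => h2 r s]
  refine (integral_finsetSum _ fun r _ => integrable_finsetSum _ fun s _ => h1 r s).trans ?_
  refine Finset.sum_congr rfl fun r _ => ?_
  rw [integral_finsetSum _ fun s _ => h2 r s]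
  refine (integral_finsetSum _ fun s _ => h1 r s).trans ?_
  exact Finset.sum_congr rfl fun s _ => setIntegral_condExp_mul hm (hX r s) (hg r s) (hXg r s) hS

/-- `y` is a square integrable random stacked vector which is determined by the data before
time `k`. -/
structure IsState (μ : Measure Ω) (net : Network Ω N n d) (k : ℕ)
    (y : Ω → Fin N → EuclideanSpace ℝ (Fin n)) : Prop where
  meas : ∀ i, StronglyMeasurable[net.history k] fun ω => y ω i
  memLp : ∀ i, MemLp (fun ω => y ω i) 2 μ

/-- The observation energy `∑ᵢ ‖Hᵢ(k) eᵢ‖²`. -/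
def Network.obsEnergy (net : Network Ω N n d) (k : ℕ) (ω : Ω)
    (e : Fin N → EuclideanSpace ℝ (Fin n)) : ℝ :=
  ∑ i, ‖Matrix.toEuclideanLin (net.H k i ω) (e i)‖ ^ 2

theorem Network.obsEnergy_nonneg (net : Network Ω N n d) (k : ℕ) (ω : Ω)
    (e : Fin N → EuclideanSpace ℝ (Fin n)) : 0 ≤ net.obsEnergy k ω e :=
  Finset.sum_nonneg fun _ _ => sq_nonneg _

theorem Network.obsEnergy_le (net : Network Ω N n d) (k : ℕ) (ω : Ω)
    (e : Fin N → EuclideanSpace ℝ (Fin n)) :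
    net.obsEnergy k ω e ≤ specNorm (net.gram k ω) * sqSum e := by
  rw [sqSum, Finset.mul_sum]
  exact Finset.sum_le_sum fun i _ => net.norm_sq_H_le k ω i (e i)

theorem Network.half_obsEnergy_sub_le (net : Network Ω N n d) (k : ℕ) (ω : Ω)
    (e e' : Fin N → EuclideanSpace ℝ (Fin n)) :
    net.obsEnergy k ω e' / 2 - net.obsEnergy k ω (e - e') ≤ net.obsEnergy k ω e := by
  unfold obsEnergy
  rw [Finset.sum_div, ← Finset.sum_sub_distrib]
  refine Finset.sum_le_sum fun i _ => ?_
  have h := norm_sub_sq_le (Matrix.toEuclideanLin (net.H k i ω) (e i))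
    (Matrix.toEuclideanLin (net.H k i ω) ((e - e') i))
  rw [← map_sub, Pi.sub_apply, sub_sub_cancel] at h
  rw [Pi.sub_apply]
  linarith

variable {μ : Measure Ω} {net : Network Ω N n d} {k : ℕ}
  {y z : Ω → Fin N → EuclideanSpace ℝ (Fin n)} {ρ R β : ℝ}

namespace IsState

theorem mono (hy : IsState μ net k y) {l : ℕ} (hkl : k ≤ l) : IsState μ net l y :=
  ⟨fun i => (hy.meas i).mono (net.history_mono hkl), hy.memLp⟩

theorem sub (hy : IsState μ net k y) (hz : IsState μ net k z) :
    IsState μ net k fun ω => y ω - z ω :=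
  ⟨fun i => (hy.meas i).sub (hz.meas i), fun i => (hy.memLp i).sub (hz.memLp i)⟩

theorem measurable (hy : IsState μ net k y) (i : Fin N) : Measurable fun ω => y ω i :=
  ((hy.meas i).mono (net.history_le k)).measurable

theorem integrable_norm_sq (hy : IsState μ net k y) (i : Fin N) :
    Integrable (fun ω => ‖y ω i‖ ^ 2) μ :=
  (memLp_two_iff_integrable_sq_norm (hy.memLp i).1).1 (hy.memLp i)

theorem stronglyMeasurable_norm_sq (hy : IsState μ net k y) (i : Fin N) :
    StronglyMeasurable[net.history k] fun ω => ‖y ω i‖ ^ 2 :=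
  (hy.meas i).norm.pow 2

theorem integrable_sqSum (hy : IsState μ net k y) : Integrable (fun ω => sqSum (y ω)) μ :=
  integrable_finsetSum _ fun i _ => hy.integrable_norm_sq i

theorem stronglyMeasurable_sqSum (hy : IsState μ net k y) :
    StronglyMeasurable[net.history k] fun ω => sqSum (y ω) :=
  Finset.stronglyMeasurable_fun_sum _ fun i _ => hy.stronglyMeasurable_norm_sq i

theorem average (hy : IsState μ net k y) : IsState μ net k fun ω _ => average (y ω) := by
  have e : (fun ω => DecReg.average (y ω)) = (N : ℝ)⁻¹ • fun ω => ∑ i, y ω i := rfl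
  refine ⟨fun _ => ?_, fun _ => ?_⟩
  · rw [e]
    exact (Finset.stronglyMeasurable_fun_sum _ fun i _ => hy.meas i).const_smul _
  · rw [e]
    exact (memLp_finsetSum Finset.univ fun i _ => hy.memLp i).const_smul _

theorem sub_average (hy : IsState μ net k y) :
    IsState μ net k fun ω i => y ω i - DecReg.average (y ω) :=
  hy.sub hy.average

theorem integrable_inner (hy : IsState μ net k y) (i j : Fin N) :
    Integrable (fun ω => inner ℝ (y ω i) (y ω j)) μ := by
  refine ((hy.integrable_norm_sq i).add (hy.integrable_norm_sq j)).mono'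
    ((hy.memLp i).1.inner (hy.memLp j).1) (ae_of_all _ fun ω => ?_)
  refine (norm_inner_le_norm _ _).trans ?_
  simp only [Pi.add_apply]
  nlinarith [sq_nonneg (‖y ω i‖ - ‖y ω j‖), sq_nonneg ‖y ω i‖, sq_nonneg ‖y ω j‖]

theorem stronglyMeasurable_inner (hy : IsState μ net k y) (i j : Fin N) :
    StronglyMeasurable[net.history k] fun ω => inner ℝ (y ω i) (y ω j) :=
  (hy.meas i).inner (hy.meas j)

end IsState

namespace DataBounds

variable [IsProbabilityMeasure μ]

theorem integrable_A (hB : DataBounds μ net ρ R β) (k : ℕ) (i j : Fin N) :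
    Integrable (fun ω => net.A k ω i j) μ :=
  (integrable_const ρ).mono' (net.measurable_A k i j).aestronglyMeasurable
    (hB.A_le.mono fun ω h => h k i j)

theorem integrable_A_mul (hB : DataBounds μ net ρ R β) (k : ℕ) (i j : Fin N) {g : Ω → ℝ}
    (hg : Integrable g μ) : Integrable (fun ω => net.A k ω i j * g ω) μ :=
  hg.bdd_mul (net.measurable_A k i j).aestronglyMeasurable (hB.A_le.mono fun ω h => h k i j)

theorem integrable_gram_mul (hB : DataBounds μ net ρ R β) {g : Ω → ℝ} (hg0 : 0 ≤ g)
    (hgm : StronglyMeasurable[net.history k] g) (hg : Integrable g μ) :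
    Integrable (fun ω => specNorm (net.gram k ω) * g ω) μ :=
  integrable_mul_of_condExp_le (net.history_le k) (hB.integrable_gram k)
    (ae_of_all _ fun ω => specNorm_nonneg _) (hB.condExp_gram k) hgm hg0 hg

theorem integrable_obsEnergy (hB : DataBounds μ net ρ R β) (hy : IsState μ net k y) :
    Integrable (fun ω => net.obsEnergy k ω (y ω)) μ := by
  refine (hB.integrable_gram_mul (fun ω => sqSum_nonneg (y ω)) hy.stronglyMeasurable_sqSum
    hy.integrable_sqSum).mono' ?_ (ae_of_all _ fun ω => ?_)
  · exact (Finset.measurable_sum _ fun i _ =>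
      (measurable_toEuclideanLin (net.measurable_H k i)
        (hy.measurable i)).norm.pow_const 2).aestronglyMeasurable
  · rw [Real.norm_of_nonneg (net.obsEnergy_nonneg k ω _)]
    exact net.obsEnergy_le k ω _

theorem setIntegral_obsEnergy_le (hB : DataBounds μ net ρ R β) (hy : IsState μ net k y)
    {S : Set Ω} (hS : MeasurableSet[net.history k] S) :
    ∫ ω in S, net.obsEnergy k ω (y ω) ∂μ ≤ R * ∫ ω in S, sqSum (y ω) ∂μ := by
  refine (setIntegral_mono (hB.integrable_obsEnergy hy).integrableOn
    (hB.integrable_gram_mul (fun ω => sqSum_nonneg (y ω)) hy.stronglyMeasurable_sqSum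
      hy.integrable_sqSum).integrableOn fun ω => net.obsEnergy_le k ω (y ω)).trans ?_
  exact setIntegral_mul_le_of_condExp_le (net.history_le k) (hB.integrable_gram k)
    (ae_of_all _ fun ω => specNorm_nonneg _) (hB.condExp_gram k) hy.stronglyMeasurable_sqSum
    (fun ω => sqSum_nonneg (y ω)) hy.integrable_sqSum hS

theorem integral_obsEnergy_le (hB : DataBounds μ net ρ R β) (hy : IsState μ net k y) :
    ∫ ω, net.obsEnergy k ω (y ω) ∂μ ≤ R * ∫ ω, sqSum (y ω) ∂μ := by
  simpa using hB.setIntegral_obsEnergy_le hy MeasurableSet.univ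

theorem integral_half_obsEnergy_sub_le (hB : DataBounds μ net ρ R β) (hy : IsState μ net k y)
    (hz : IsState μ net k z) :
    (∫ ω, net.obsEnergy k ω (z ω) ∂μ) / 2 - R * ∫ ω, sqSum (y ω - z ω) ∂μ
      ≤ ∫ ω, net.obsEnergy k ω (y ω) ∂μ := by
  have h1 := hB.integrable_obsEnergy hz
  have h2 := hB.integrable_obsEnergy (hy.sub hz)
  have h3 := integral_mono ((h1.div_const 2).sub h2) (hB.integrable_obsEnergy hy)
    fun ω => net.half_obsEnergy_sub_le k ω (y ω) (z ω)
  have h4 := hB.integral_obsEnergy_le (hy.sub hz)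
  simp only [Pi.sub_apply] at h3
  rw [integral_sub (h1.div_const 2) h2, integral_div] at h3
  linarith

theorem integrable_sub_sq (hy : IsState μ net k y) (i j : Fin N) :
    Integrable (fun ω => ‖y ω i - y ω j‖ ^ 2 / 2) μ :=
  ((memLp_two_iff_integrable_sq_norm ((hy.memLp i).sub (hy.memLp j)).1).1
    ((hy.memLp i).sub (hy.memLp j))).div_const 2

theorem stronglyMeasurable_sub_sq (hy : IsState μ net k y) (i j : Fin N) :
    StronglyMeasurable[net.history k] (fun ω => ‖y ω i - y ω j‖ ^ 2 / 2) :=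
  (((hy.meas i).sub (hy.meas j)).norm.pow 2).div stronglyMeasurable_const

theorem integrable_dirichlet (hB : DataBounds μ net ρ R β) (hy : IsState μ net k y) (l : ℕ) :
    Integrable (fun ω => dirichlet (net.A l ω) (y ω)) μ :=
  integrable_finsetSum _ fun i _ => integrable_finsetSum _ fun j _ =>
    hB.integrable_A_mul l i j (integrable_sub_sq hy i j)

theorem integrable_dirichlet_condExp (hB : DataBounds μ net ρ R β) (hy : IsState μ net k y) :
    Integrable (fun ω => dirichlet (condExpMatrix μ (net.history k) (net.A k) ω) (y ω)) μ :=
  integrable_sum_condExpMatrix_mul (hB.integrable_A k) (stronglyMeasurable_sub_sq hy)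
    fun i j => hB.integrable_A_mul k i j (integrable_sub_sq hy i j)

theorem setIntegral_dirichlet_condExp (hB : DataBounds μ net ρ R β) (hy : IsState μ net k y)
    {S : Set Ω} (hS : MeasurableSet[net.history k] S) :
    ∫ ω in S, dirichlet (condExpMatrix μ (net.history k) (net.A k) ω) (y ω) ∂μ
      = ∫ ω in S, dirichlet (net.A k ω) (y ω) ∂μ :=
  setIntegral_sum_condExpMatrix_mul (net.history_le k) (hB.integrable_A k)
    (stronglyMeasurable_sub_sq hy)
    (fun i j => hB.integrable_A_mul k i j (integrable_sub_sq hy i j)) hS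

/-- The random weights may be negative; only their conditional means are nonnegative. On a past
event, with a past-measurable state, the weights can be replaced by these means. -/
theorem setIntegral_dirichlet_nonneg (hB : DataBounds μ net ρ R β) (hbal : CondBalanced μ net)
    (hy : IsState μ net k y) {S : Set Ω} (hS : MeasurableSet[net.history k] S) :
    0 ≤ ∫ ω in S, dirichlet (net.A k ω) (y ω) ∂μ := by
  rw [← hB.setIntegral_dirichlet_condExp hy hS]
  exact integral_nonneg_of_ae (ae_restrict_of_ae
    ((hbal.nonneg k).mono fun ω hω => dirichlet_nonneg hω _))

theorem integral_dirichlet_nonneg (hB : DataBounds μ net ρ R β) (hbal : CondBalanced μ net)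
    (hy : IsState μ net k y) : 0 ≤ ∫ ω, dirichlet (net.A k ω) (y ω) ∂μ := by
  simpa using hB.setIntegral_dirichlet_nonneg hbal hy MeasurableSet.univ

theorem integral_dirichlet_le (hB : DataBounds μ net ρ R β) (hy : IsState μ net k y) (l : ℕ) :
    ∫ ω, dirichlet (net.A l ω) (y ω) ∂μ ≤ 2 * N * ρ * ∫ ω, sqSum (y ω) ∂μ := by
  rw [← integral_const_mul]
  refine integral_mono_ae (hB.integrable_dirichlet hy l) (hy.integrable_sqSum.const_mul _)
    (hB.A_le.mono fun ω hω => ?_)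
  exact (le_abs_self _).trans (abs_dirichlet_le (hω l) _ hB.ρ_nonneg)

/-- The pointwise comparison needs nonnegative weights, so it is applied to the conditional
adjacency matrix and then transferred back to the random one. -/
theorem integral_half_dirichlet_sub_le (hB : DataBounds μ net ρ R β) (hbal : CondBalanced μ net)
    (hy : IsState μ net k y) (hz : IsState μ net k z) :
    (∫ ω, dirichlet (net.A k ω) (z ω) ∂μ) / 2 - 2 * N * ρ * ∫ ω, sqSum (y ω - z ω) ∂μ
      ≤ ∫ ω, dirichlet (net.A k ω) (y ω) ∂μ := by
  have e : ∀ {x : Ω → Fin N → EuclideanSpace ℝ (Fin n)}, IsState μ net k x →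
      ∫ ω, dirichlet (net.A k ω) (x ω) ∂μ
        = ∫ ω, dirichlet (condExpMatrix μ (net.history k) (net.A k) ω) (x ω) ∂μ := fun hx => by
    simpa using (hB.setIntegral_dirichlet_condExp hx MeasurableSet.univ).symm
  have h1 := hB.integrable_dirichlet_condExp hz
  have h2 := hB.integrable_dirichlet_condExp (hy.sub hz)
  have h3 := integral_mono_ae ((h1.div_const 2).sub h2) (hB.integrable_dirichlet_condExp hy)
    ((hbal.nonneg k).mono fun ω hω => half_dirichlet_sub_le hω (y ω) (z ω))
  have h4 := hB.integral_dirichlet_le (hy.sub hz) k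
  simp only [Pi.sub_apply] at h3
  rw [integral_sub (h1.div_const 2) h2, integral_div, ← e hy, ← e hz, ← e (hy.sub hz)] at h3
  linarith

theorem integrable_inner_sub (hy : IsState μ net k y) (i j : Fin N) :
    Integrable (fun ω => inner ℝ (y ω i) (y ω i - y ω j)) μ := by
  simp only [inner_sub_right]
  exact (hy.integrable_inner i i).sub (hy.integrable_inner i j)

/-- Balance too holds only for the conditional adjacency matrix. Both sides are linear in the
weights with past-measurable coefficients, so the identity survives integration. -/
theorem setIntegral_sum_inner_eq_dirichlet (hB : DataBounds μ net ρ R β)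
    (hbal : CondBalanced μ net) (hy : IsState μ net k y) {S : Set Ω}
    (hS : MeasurableSet[net.history k] S) :
    ∫ ω in S, ∑ i, ∑ j, net.A k ω i j * inner ℝ (y ω i) (y ω i - y ω j) ∂μ
      = ∫ ω in S, dirichlet (net.A k ω) (y ω) ∂μ := by
  have h := setIntegral_sum_condExpMatrix_mul (net.history_le k) (hB.integrable_A k)
    (g := fun i j ω => inner ℝ (y ω i) (y ω i - y ω j))
    (fun i j => (hy.meas i).inner ((hy.meas i).sub (hy.meas j)))
    (fun i j => hB.integrable_A_mul k i j (integrable_inner_sub hy i j)) hS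
  rw [← hB.setIntegral_dirichlet_condExp hy hS]
  refine h.symm.trans ?_
  exact integral_congr_ae (ae_restrict_of_ae
    ((hbal.balanced k).mono fun ω hω => sum_inner_eq_dirichlet hω (y ω)))

end DataBounds

section Excitation

variable [IsProbabilityMeasure μ]

theorem integrable_laplacian {B : Ω → Matrix (Fin N) (Fin N) ℝ}
    (hB : ∀ i j, Integrable (fun ω => B ω i j) μ) (i j : Fin N) :
    Integrable (fun ω => laplacian (B ω) i j) μ := by
  by_cases hij : i = j
  · subst hij
    simp only [laplacian, Matrix.sub_apply, Matrix.diagonal_apply_eq, inDegree]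
    exact (integrable_finsetSum _ fun l _ => hB i l).sub (hB i i)
  · simp only [laplacian, Matrix.sub_apply, Matrix.diagonal_apply_ne _ hij, zero_sub]
    exact (hB i j).neg

theorem sum_laplacian (w : Matrix (Fin N) (Fin N) ℝ) (i : Fin N) : ∑ j, laplacian w i j = 0 := by
  simp only [laplacian, Matrix.sub_apply, Finset.sum_sub_distrib]
  rw [Finset.sum_eq_single i]
  · rw [Matrix.diagonal_apply_eq, inDegree, sub_self]
  · intro j _ hj
    exact Matrix.diagonal_apply_ne _ hj.symm
  · simp

theorem sum_condExpMatrix_laplacian {B : Ω → Matrix (Fin N) (Fin N) ℝ}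
    (hB : ∀ i j, Integrable (fun ω => B ω i j) μ) (i : Fin N) :
    ∀ m : MeasurableSpace Ω, ∀ᵐ ω ∂μ,
      ∑ j, condExpMatrix μ m (fun ω => laplacian (B ω)) ω i j = 0 := by
  have hi := fun j (_ : j ∈ Finset.univ) => integrable_laplacian hB i j
  intro m
  have h := condExp_finsetSum hi m
  have h0 : (∑ j, fun ω => laplacian (B ω) i j) = (0 : Ω → ℝ) := by
    ext ω
    rw [Finset.sum_apply, sum_laplacian]
    rfl
  rw [h0, condExp_zero] at h
  filter_upwards [h] with ω hω
  rw [Finset.sum_apply] at hω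
  exact hω.symm

/-- Joint connectivity in integrated form. -/
theorem DataBounds.connectivity (hB : DataBounds μ net ρ R β) (hN : N ≠ 0)
    (hconn : UniformlyCondJointlyConnected μ net.history fun k ω => symmetrized (net.A k ω)) :
    ∃ h : ℕ, 0 < h ∧ ∃ θ : ℝ, 0 < θ ∧ ∀ k y, IsState μ net (k * h) y →
      θ * ∫ ω, sqSum (fun i => y ω i - average (y ω)) ∂μ
        ≤ ∑ l ∈ Finset.Ico (k * h) ((k + 1) * h), ∫ ω, dirichlet (net.A l ω) (y ω) ∂μ := by
  obtain ⟨hint, h, hh, θ, hθ, hle⟩ := hconn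
  refine ⟨h, hh, θ, hθ, fun k y hy => ?_⟩
  set I := Finset.Ico (k * h) ((k + 1) * h)
  have hL := fun l => integrable_laplacian (hint l)
  have hbd : ∀ l i j, Integrable (fun ω => laplacian (symmetrized (net.A l ω)) i j *
      inner ℝ (y ω i) (y ω j)) μ := by
    intro l i j
    have hA : ∀ p q, Integrable (fun ω => symmetrized (net.A l ω) p q *
        inner ℝ (y ω i) (y ω j)) μ := by
      intro p q
      simp only [symmetrized, Matrix.smul_apply, Matrix.add_apply, Matrix.transpose_apply,
        smul_eq_mul, mul_assoc, add_mul]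
      exact ((hB.integrable_A_mul l p q (hy.integrable_inner i j)).add
        (hB.integrable_A_mul l q p (hy.integrable_inner i j))).const_mul _
    by_cases hij : i = j
    · subst hij
      simp only [laplacian, Matrix.sub_apply, Matrix.diagonal_apply_eq, inDegree, sub_mul,
        Finset.sum_mul]
      exact (integrable_finsetSum _ fun q _ => hA i q).sub (hA i i)
    · simp only [laplacian, Matrix.sub_apply, Matrix.diagonal_apply_ne _ hij, zero_sub, neg_mul]
      exact (hA i j).neg
  -- The state is known at time `k * h`, so for every `l` in the block the Laplacian can be replaced
  -- by its conditional expectation given the start of the block.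
  have e : ∀ l, ∫ ω, dirichlet (net.A l ω) (y ω) ∂μ = ∫ ω, ∑ i, ∑ j,
      condExpMatrix μ (net.history (k * h)) (fun ω' => laplacian (symmetrized (net.A l ω'))) ω i j
        * inner ℝ (y ω i) (y ω j) ∂μ := by
    intro l
    have := setIntegral_sum_condExpMatrix_mul (net.history_le (k * h)) (hL l)
      hy.stronglyMeasurable_inner (hbd l) (S := Set.univ) MeasurableSet.univ
    simp only [setIntegral_univ, sum_laplacian_symmetrized_inner] at this
    exact this.symm
  have hi := fun l => integrable_sum_condExpMatrix_mul (hL l) hy.stronglyMeasurable_inner (hbd l)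
  simp only [e]
  rw [← integral_finsetSum _ fun l _ => hi l, ← integral_const_mul]
  refine integral_mono_ae (hy.sub_average.integrable_sqSum.const_mul θ)
    (integrable_finsetSum _ fun l _ => hi l) ?_
  -- Conditioning preserves zero row sums almost surely; this makes the all-ones vector a kernel
  -- vector in the spectral bound.
  have hz : ∀ᵐ ω ∂μ, ∀ l i, ∑ j, condExpMatrix μ (net.history (k * h))
      (fun ω' => laplacian (symmetrized (net.A l ω'))) ω i j = 0 :=
    ae_all_iff.2 fun l => ae_all_iff.2 fun i => sum_condExpMatrix_laplacian (hint l) i _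
  filter_upwards [hle, hz] with ω h1 h2
  refine (le_sum_inner_of_le_lambdaTwo hN hθ (h1 k) (fun r => ?_) (y ω)).trans (le_of_eq ?_)
  · simp only [Matrix.sum_apply]
    rw [Finset.sum_comm]
    exact Finset.sum_eq_zero fun l _ => h2 l r
  · simp only [Matrix.sum_apply, Finset.sum_mul]
    rw [Finset.sum_comm' (t' := Finset.univ) (s' := fun _ => I) (by simp)]
    refine Finset.sum_congr rfl fun i _ => ?_
    rw [Finset.sum_comm]

theorem abs_gram_block_le (net : Network Ω N n d) (k : ℕ) (ω : Ω) (i : Fin N) (r s : Fin n) :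
    |((net.H k i ω).transpose * net.H k i ω) r s| ≤ specNorm (net.gram k ω) := by
  have := abs_apply_le_specNorm (net.gram k ω) ⟨i, r⟩ ⟨i, s⟩
  rwa [net.gram_eq, Matrix.blockDiagonal'_apply_eq, ← net.gram_eq] at this

/-- Joint observability in integrated form. -/
theorem DataBounds.observability (hB : DataBounds μ net ρ R β)
    (hobs : UniformlyCondJointlyObservable μ net) :
    ∃ h : ℕ, 0 < h ∧ ∃ θ : ℝ, 0 < θ ∧ ∀ k (z : Ω → EuclideanSpace ℝ (Fin n)),
      IsState μ net (k * h) (fun ω _ => z ω) → StronglyMeasurable[net.history (k * h)] z →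
      MemLp z 2 μ →
      θ * ∫ ω, ‖z ω‖ ^ 2 ∂μ
        ≤ ∑ l ∈ Finset.Ico (k * h) ((k + 1) * h), ∫ ω, net.obsEnergy l ω (fun _ => z ω) ∂μ := by
  obtain ⟨hint, h, hh, θ, hθ, hle⟩ := hobs
  refine ⟨h, hh, θ, hθ, fun k z hz hzm hz2 => ?_⟩
  set I := Finset.Ico (k * h) ((k + 1) * h) with hI
  have hzi : Integrable (fun ω => ‖z ω‖ ^ 2) μ := (memLp_two_iff_integrable_sq_norm hz2.1).1 hz2
  have hcm : ∀ r, StronglyMeasurable[net.history (k * h)] fun ω => z ω r := fun r =>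
    ((PiLp.continuous_apply 2 _ r).comp_stronglyMeasurable hzm)
  have hgm : ∀ r s, StronglyMeasurable[net.history (k * h)] fun ω => z ω r * z ω s := fun r s =>
    (hcm r).mul (hcm s)
  have hprod : ∀ ω r s, |z ω r * z ω s| ≤ ‖z ω‖ ^ 2 := by
    intro ω r s
    rw [abs_mul, sq]
    exact mul_le_mul (PiLp.norm_apply_le (z ω) r) (PiLp.norm_apply_le (z ω) s) (abs_nonneg _)
      (norm_nonneg _)
  have hHm : ∀ l i r s, Measurable fun ω => ((net.H l i ω).transpose * net.H l i ω) r s := by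
    intro l i r s
    simp only [Matrix.mul_apply, Matrix.transpose_apply]
    exact Finset.measurable_sum _ fun t _ => (net.measurable_H l i t r).mul (net.measurable_H l i t s)
  -- For `l ≥ k * h` the state also belongs to the past of `l`, so the conditional moment bound at
  -- time `l` gives integrability.
  have hbd : ∀ l ∈ I, ∀ i r s, Integrable (fun ω =>
      ((net.H l i ω).transpose * net.H l i ω) r s * (z ω r * z ω s)) μ := by
    intro l hl i r s
    have hkl : k * h ≤ l := (Finset.mem_Ico.1 hl).1
    refine (hB.integrable_gram_mul (k := l) (g := fun ω => ‖z ω‖ ^ 2) (fun ω => sq_nonneg _)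
      ((hzm.mono (net.history_mono hkl)).norm.pow 2) hzi).mono' ?_ (ae_of_all _ fun ω => ?_)
    · exact (hHm l i r s).aestronglyMeasurable.mul
        ((hgm r s).mono (net.history_le _)).aestronglyMeasurable
    · rw [norm_mul]
      exact mul_le_mul (abs_gram_block_le net l ω i r s) (hprod ω r s) (norm_nonneg _)
        (specNorm_nonneg _)
  have hH : ∀ l i ω, ‖Matrix.toEuclideanLin (net.H l i ω) (z ω)‖ ^ 2 =
      ∑ r, ∑ s, ((net.H l i ω).transpose * net.H l i ω) r s * (z ω r * z ω s) := by
    intro l i ω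
    rw [← inner_toEuclideanLin_eq_sum, ← real_inner_self_eq_norm_sq,
      ← inner_toEuclideanLin_transpose, real_inner_comm]
    congr 1
    ext r
    simp [Matrix.toLpLin_apply, Matrix.mulVec_mulVec]
  have hi := fun l (hl : l ∈ I) i => integrable_sum_condExpMatrix_mul
    (m := net.history (k * h)) (hint l i) hgm (hbd l hl i)
  have e : ∀ l ∈ I, ∫ ω, net.obsEnergy l ω (fun _ => z ω) ∂μ = ∑ i, ∫ ω, ∑ r, ∑ s,
      condExpMatrix μ (net.history (k * h))
        (fun ω' => (net.H l i ω').transpose * net.H l i ω') ω r s * (z ω r * z ω s) ∂μ := by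
    intro l hl
    simp only [Network.obsEnergy, hH]
    rw [integral_finsetSum _ fun i _ => integrable_finsetSum _ fun r _ =>
      integrable_finsetSum _ fun s _ => hbd l hl i r s]
    refine Finset.sum_congr rfl fun i _ => ?_
    have := setIntegral_sum_condExpMatrix_mul (net.history_le (k * h)) (hint l i)
      hgm (hbd l hl i) (S := Set.univ) MeasurableSet.univ
    simp only [setIntegral_univ] at this
    exact this.symm
  rw [Finset.sum_congr rfl e, Finset.sum_comm]
  rw [Finset.sum_congr rfl fun i _ => (integral_finsetSum I fun l hl => hi l hl i).symm,
    ← integral_finsetSum _ fun i _ => integrable_finsetSum _ fun l hl => hi l hl i,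
    ← integral_const_mul]
  refine integral_mono_ae (hzi.const_mul θ)
    (integrable_finsetSum _ fun i _ => integrable_finsetSum _ fun l hl => hi l hl i) ?_
  filter_upwards [hle] with ω h1
  refine (le_quadratic_form_of_le_lambdaMin hθ (h1 k) (z ω)).trans (le_of_eq ?_)
  simp only [Matrix.sum_apply, Finset.sum_mul]
  rw [Finset.sum_congr rfl fun r _ => Finset.sum_comm, Finset.sum_comm]
  refine Finset.sum_congr rfl fun i _ => ?_
  rw [Finset.sum_congr rfl fun r _ => Finset.sum_comm, Finset.sum_comm]

end Excitation

end

/-! ### Combining connectivity and observability over a common block. -/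

section ExcitationBlock

variable {Ω : Type*} [mΩ : MeasurableSpace Ω] {N n : ℕ} {d : Fin N → ℕ}
  {μ : Measure Ω} {net : Network Ω N n d} {ρ R β : ℝ}

/-- Joint connectivity and joint observability together make the graph and observation energies
over a block of bounded length dominate the squared norm. -/
theorem DataBounds.excitation [IsProbabilityMeasure μ] (hB : DataBounds μ net ρ R β)
    (hbal : CondBalanced μ net) (hN : N ≠ 0)
    (hconn : UniformlyCondJointlyConnected μ net.history fun k ω => symmetrized (net.A k ω))
    (hobs : UniformlyCondJointlyObservable μ net) :
    ∃ h : ℕ, 0 < h ∧ ∃ c : ℝ, 0 < c ∧ ∀ m y, IsState μ net (m * h) y →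
      c * ∫ ω, sqSum (y ω) ∂μ ≤ ∑ j ∈ Finset.range h,
        (∫ ω, dirichlet (net.A (m * h + j) ω) (y ω) ∂μ
          + ∫ ω, net.obsEnergy (m * h + j) ω (y ω) ∂μ) := by
  obtain ⟨h1, hh1, θ1, hθ1, hc⟩ := hB.connectivity hN hconn
  obtain ⟨h2, hh2, θ2, hθ2, ho⟩ := hB.observability hobs
  have hN' : (0 : ℝ) < N := by exact_mod_cast Nat.pos_of_ne_zero hN
  -- Bounds the factor by which the observation energies over `h2` steps can amplify the squared
  -- deviation from the average.
  set K := h2 * R with hK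
  have hK0 : 0 ≤ K := mul_nonneg (Nat.cast_nonneg _) hB.R_nonneg
  -- Only a fraction `ε` of the observation energy is used, so that replacing the state by its
  -- average costs at most half of the disagreement term supplied by connectivity.
  set ε := θ1 / (2 * (K + θ1)) with hε
  have hε0 : 0 < ε := by positivity
  have hε1 : ε ≤ 1 := by
    rw [hε, div_le_one (by positivity)]
    linarith
  have hεK : ε * K ≤ θ1 / 2 := by
    rw [hε, div_mul_eq_mul_div, div_le_div_iff₀ (by positivity) (by norm_num)]
    nlinarith
  -- Starting at a multiple of `h1 * h2`, the block contains a full aligned connectivity window and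
  -- a full aligned observability window. The constant is the smaller of the rates left for the
  -- disagreement and for the average, the latter divided by `N` because the average is counted `N`
  -- times.
  refine ⟨h1 * h2, Nat.mul_pos hh1 hh2, min (θ1 / 2) (ε * θ2 / (2 * N)),
    lt_min (by positivity) (by positivity), fun m y hy => ?_⟩
  set T := m * (h1 * h2) with hT
  have hT1 : T = (m * h2) * h1 := by rw [hT]; ring
  have hT2 : T = (m * h1) * h2 := by rw [hT]; ring
  set P : ℕ → ℝ := fun l => ∫ ω, dirichlet (net.A l ω) (y ω) ∂μ with hP
  set Q : ℕ → ℝ := fun l => ∫ ω, net.obsEnergy l ω (y ω) ∂μ with hQ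
  have hP0 : ∀ l, T ≤ l → 0 ≤ P l := fun l hl => hB.integral_dirichlet_nonneg hbal (hy.mono hl)
  have hQ0 : ∀ l, 0 ≤ Q l := fun l => integral_nonneg fun ω => net.obsEnergy_nonneg l ω _
  set D := ∫ ω, sqSum (fun i => y ω i - average (y ω)) ∂μ with hD
  set A := ∫ ω, ‖average (y ω)‖ ^ 2 ∂μ with hA
  have hD0 : 0 ≤ D := integral_nonneg fun ω => sqSum_nonneg _
  have hA0 : 0 ≤ A := integral_nonneg fun ω => sq_nonneg _
  have i0 : Fin N := ⟨0, Nat.pos_of_ne_zero hN⟩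
  have hsum : ∫ ω, sqSum (y ω) ∂μ = D + N * A := by
    rw [hD, hA, ← integral_const_mul, ← integral_add hy.sub_average.integrable_sqSum
      ((hy.average.integrable_norm_sq i0).const_mul _)]
    refine integral_congr_ae (ae_of_all _ fun ω => ?_)
    simp only [sqSum_sub_average hN]
    ring
  have hconn' : θ1 * D ≤ ∑ l ∈ Finset.Ico T (T + h1 * h2), P l := by
    refine (hc (m * h2) y (by rwa [← hT1])).trans ?_
    refine Finset.sum_le_sum_of_subset_of_nonneg (Finset.Ico_subset_Ico hT1.le ?_) ?_
    · rw [Nat.succ_mul, ← hT1]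
      exact Nat.add_le_add_left (Nat.le_mul_of_pos_right _ hh2) _
    · exact fun l hl _ => hP0 l (Finset.mem_Ico.1 hl).1
  -- Observability concerns one common vector at all nodes; it is applied to the average, and the
  -- deviation is paid for by `K * D`.
  have hobs' : θ2 / 2 * A - K * D ≤ ∑ l ∈ Finset.Ico T (T + h1 * h2), Q l := by
    have e1 := ho (m * h1) (fun ω => average (y ω)) (by rw [← hT2]; exact hy.average)
      (by rw [← hT2]; exact hy.average.meas i0) (hy.average.memLp i0)
    set I := Finset.Ico (m * h1 * h2) ((m * h1 + 1) * h2) with hI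
    have e2 : ∑ l ∈ I, ((∫ ω, net.obsEnergy l ω (fun _ => average (y ω)) ∂μ) / 2 - R * D)
        ≤ ∑ l ∈ I, Q l := by
      refine Finset.sum_le_sum fun l hl => ?_
      have hl' : T ≤ l := by rw [hT2]; exact (Finset.mem_Ico.1 hl).1
      exact hB.integral_half_obsEnergy_sub_le (hy.mono hl') (hy.average.mono hl')
    have e3 : ∑ l ∈ I, Q l ≤ ∑ l ∈ Finset.Ico T (T + h1 * h2), Q l := by
      refine Finset.sum_le_sum_of_subset_of_nonneg (Finset.Ico_subset_Ico hT2.le ?_)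
        fun l _ _ => hQ0 l
      rw [Nat.succ_mul, ← hT2]
      exact Nat.add_le_add_left (Nat.le_mul_of_pos_left _ hh1) _
    have e4 : I.card = h2 := by rw [hI, Nat.card_Ico, Nat.succ_mul, Nat.add_sub_cancel_left]
    rw [Finset.sum_sub_distrib, ← Finset.sum_div, Finset.sum_const, e4, nsmul_eq_mul] at e2
    rw [hK]
    linarith
  have hQs : 0 ≤ ∑ l ∈ Finset.Ico T (T + h1 * h2), Q l := Finset.sum_nonneg fun l _ => hQ0 l
  have hrange : ∑ j ∈ Finset.range (h1 * h2), (P (T + j) + Q (T + j))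
      = ∑ l ∈ Finset.Ico T (T + h1 * h2), P l + ∑ l ∈ Finset.Ico T (T + h1 * h2), Q l := by
    rw [← Finset.sum_add_distrib, Finset.sum_Ico_eq_sum_range, Nat.add_sub_cancel_left]
  change _ ≤ ∑ j ∈ Finset.range (h1 * h2), (P (T + j) + Q (T + j))
  rw [hrange, hsum]
  set SP := ∑ l ∈ Finset.Ico T (T + h1 * h2), P l
  set SQ := ∑ l ∈ Finset.Ico T (T + h1 * h2), Q l
  have f1 : ε * SQ ≤ SQ := mul_le_of_le_one_left hQs hε1
  have f2 : ε * (θ2 / 2 * A - K * D) ≤ ε * SQ := mul_le_mul_of_nonneg_left hobs' hε0.le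
  have f3 : ε * K * D ≤ θ1 / 2 * D := mul_le_mul_of_nonneg_right hεK hD0
  have f4 := mul_le_mul_of_nonneg_right (min_le_left (θ1 / 2) (ε * θ2 / (2 * N))) hD0
  have f5 := mul_le_mul_of_nonneg_right (min_le_right (θ1 / 2) (ε * θ2 / (2 * N)))
    (mul_nonneg hN'.le hA0)
  have f6 : ε * θ2 / (2 * N) * (N * A) = ε * (θ2 / 2 * A) := by field_simp
  rw [mul_add]
  linarith

end ExcitationBlock

/-! ### Pointwise estimates for the drift and the noise. -/

section Increments

variable {N n : ℕ} {d : Fin N → ℕ}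

/-- The stacked innovation `Hᵢᵀ Hᵢ eᵢ`. -/
def innovation (H : (i : Fin N) → Matrix (Fin (d i)) (Fin n) ℝ)
    (e : Fin N → EuclideanSpace ℝ (Fin n)) (i : Fin N) : EuclideanSpace ℝ (Fin n) :=
  Matrix.toEuclideanLin (H i).transpose (Matrix.toEuclideanLin (H i) (e i))

/-- The stacked consensus term `∑ⱼ wᵢⱼ (eⱼ - eᵢ)`. -/
def consensus (w : Matrix (Fin N) (Fin N) ℝ) (e : Fin N → EuclideanSpace ℝ (Fin n)) (i : Fin N) :
    EuclideanSpace ℝ (Fin n) :=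
  ∑ j, w i j • (e j - e i)

/-- The stacked contribution `Hᵢᵀ vᵢ` of the measurement noise. -/
def measurementNoise (H : (i : Fin N) → Matrix (Fin (d i)) (Fin n) ℝ)
    (v : (i : Fin N) → EuclideanSpace ℝ (Fin (d i))) (i : Fin N) : EuclideanSpace ℝ (Fin n) :=
  Matrix.toEuclideanLin (H i).transpose (v i)

/-- The stacked contribution of the communication noise. -/
def channelNoise (w : Matrix (Fin N) (Fin N) ℝ)
    (f : Fin N → Fin N → EuclideanSpace ℝ (Fin n) → ℝ)
    (ξ : Fin N → Fin N → EuclideanSpace ℝ (Fin n)) (e : Fin N → EuclideanSpace ℝ (Fin n))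
    (i : Fin N) : EuclideanSpace ℝ (Fin n) :=
  ∑ j, (w i j * f j i (e j - e i)) • ξ j i

/-- The conditionally predictable part of the increment of the error. -/
def drift (H : (i : Fin N) → Matrix (Fin (d i)) (Fin n) ℝ) (w : Matrix (Fin N) (Fin N) ℝ)
    (x0 : EuclideanSpace ℝ (Fin n)) (a b lam : ℝ) (e : Fin N → EuclideanSpace ℝ (Fin n))
    (i : Fin N) : EuclideanSpace ℝ (Fin n) :=
  b • consensus w e i - a • innovation H e i - lam • (e i + x0)

/-- The noise part of the increment of the error. -/
def noisePart (H : (i : Fin N) → Matrix (Fin (d i)) (Fin n) ℝ) (w : Matrix (Fin N) (Fin N) ℝ)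
    (f : Fin N → Fin N → EuclideanSpace ℝ (Fin n) → ℝ)
    (v : (i : Fin N) → EuclideanSpace ℝ (Fin (d i)))
    (ξ : Fin N → Fin N → EuclideanSpace ℝ (Fin n)) (a b : ℝ)
    (e : Fin N → EuclideanSpace ℝ (Fin n)) (i : Fin N) : EuclideanSpace ℝ (Fin n) :=
  a • measurementNoise H v i + b • channelNoise w f ξ e i

theorem norm_sum_sq_le {E ι : Type*} [SeminormedAddCommGroup E] [Fintype ι] (z : ι → E) :
    ‖∑ i, z i‖ ^ 2 ≤ Fintype.card ι * ∑ i, ‖z i‖ ^ 2 :=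
  (pow_le_pow_left₀ (norm_nonneg _) (norm_sum_le _ _) 2).trans
    (by simpa using sq_sum_le_card_mul_sum_sq (s := Finset.univ) (f := fun i => ‖z i‖))

theorem sqSum_consensus_le {w : Matrix (Fin N) (Fin N) ℝ} {ρ : ℝ} (hw : ∀ i j, |w i j| ≤ ρ)
    (e : Fin N → EuclideanSpace ℝ (Fin n)) :
    sqSum (consensus w e) ≤ 4 * N ^ 2 * ρ ^ 2 * sqSum e := by
  have h1 : sqSum (consensus w e) ≤ ∑ i, ∑ j, N * ρ ^ 2 * ‖e i - e j‖ ^ 2 := by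
    refine Finset.sum_le_sum fun i _ => (norm_sum_sq_le _).trans ?_
    rw [Fintype.card_fin, Finset.mul_sum]
    refine Finset.sum_le_sum fun j _ => ?_
    rw [norm_smul, mul_pow, mul_assoc, norm_sub_rev]
    refine mul_le_mul_of_nonneg_left (mul_le_mul_of_nonneg_right ?_ (sq_nonneg _))
      (Nat.cast_nonneg _)
    exact pow_le_pow_left₀ (norm_nonneg _) (hw i j) 2
  simp only [← Finset.mul_sum] at h1
  have h2 := mul_le_mul_of_nonneg_left (sum_norm_sub_sq_le e)
    (by positivity : 0 ≤ (N : ℝ) * ρ ^ 2)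
  linarith

theorem intensity_sq_le {σ c : ℝ} {f : Fin N → Fin N → EuclideanSpace ℝ (Fin n) → ℝ}
    (hf : ∀ j i x, |f j i x| ≤ σ * ‖x‖ + c) (e : Fin N → EuclideanSpace ℝ (Fin n)) (i j : Fin N) :
    f j i (e j - e i) ^ 2 ≤ (8 * σ ^ 2 + 2 * c ^ 2) * (1 + sqSum e) := by
  have h1 : f j i (e j - e i) ^ 2 ≤ (σ * ‖e j - e i‖ + c) ^ 2 := by
    rw [← sq_abs]
    exact pow_le_pow_left₀ (abs_nonneg _) (hf j i _) 2
  have h2 := norm_sub_sq_le (e j) (e i)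
  have h3 := norm_sq_le_sqSum e i
  have h4 := norm_sq_le_sqSum e j
  have h5 := sqSum_nonneg e
  nlinarith [sq_nonneg (σ * ‖e j - e i‖ - c), sq_nonneg σ, sq_nonneg c,
    mul_nonneg (sq_nonneg c) h5, mul_le_mul_of_nonneg_left h2 (sq_nonneg σ),
    mul_le_mul_of_nonneg_left h3 (sq_nonneg σ), mul_le_mul_of_nonneg_left h4 (sq_nonneg σ)]

theorem norm_channel_sq_le {σ c ρ : ℝ} {f : Fin N → Fin N → EuclideanSpace ℝ (Fin n) → ℝ}
    (hf : ∀ j i x, |f j i x| ≤ σ * ‖x‖ + c) {w : Matrix (Fin N) (Fin N) ℝ}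
    (hw : ∀ i j, |w i j| ≤ ρ) (ξ : Fin N → Fin N → EuclideanSpace ℝ (Fin n))
    (e : Fin N → EuclideanSpace ℝ (Fin n)) (i j : Fin N) :
    ‖(w i j * f j i (e j - e i)) • ξ j i‖ ^ 2
      ≤ ρ ^ 2 * (8 * σ ^ 2 + 2 * c ^ 2) * ‖ξ j i‖ ^ 2 * (1 + sqSum e) := by
  rw [norm_smul, norm_mul, mul_pow, mul_pow, Real.norm_eq_abs, Real.norm_eq_abs, sq_abs (f _ _ _)]
  have h1 := pow_le_pow_left₀ (abs_nonneg _) (hw i j) 2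
  have h2 := intensity_sq_le hf e i j
  have h3 := mul_le_mul h1 h2 (sq_nonneg _) (sq_nonneg ρ)
  have h4 := mul_le_mul_of_nonneg_right h3 (sq_nonneg ‖ξ j i‖)
  linarith

theorem sqSum_channelNoise_le {σ c ρ : ℝ} {f : Fin N → Fin N → EuclideanSpace ℝ (Fin n) → ℝ}
    (hf : ∀ j i x, |f j i x| ≤ σ * ‖x‖ + c) {w : Matrix (Fin N) (Fin N) ℝ}
    (hw : ∀ i j, |w i j| ≤ ρ) (ξ : Fin N → Fin N → EuclideanSpace ℝ (Fin n))
    (e : Fin N → EuclideanSpace ℝ (Fin n)) :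
    sqSum (channelNoise w f ξ e)
      ≤ N * ρ ^ 2 * (8 * σ ^ 2 + 2 * c ^ 2) * (∑ j, ∑ i, ‖ξ j i‖ ^ 2) * (1 + sqSum e) := by
  have h1 : sqSum (channelNoise w f ξ e) ≤
      ∑ i, ∑ j, N * (ρ ^ 2 * (8 * σ ^ 2 + 2 * c ^ 2) * ‖ξ j i‖ ^ 2 * (1 + sqSum e)) := by
    refine Finset.sum_le_sum fun i _ => (norm_sum_sq_le _).trans ?_
    rw [Fintype.card_fin, Finset.mul_sum]
    exact Finset.sum_le_sum fun j _ =>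
      mul_le_mul_of_nonneg_left (norm_channel_sq_le hf hw ξ e i j) (Nat.cast_nonneg _)
  rw [Finset.sum_comm] at h1
  simp only [← Finset.mul_sum, ← Finset.sum_mul] at h1
  linarith

theorem sqSum_drift_le (H : (i : Fin N) → Matrix (Fin (d i)) (Fin n) ℝ)
    (w : Matrix (Fin N) (Fin N) ℝ) (x0 : EuclideanSpace ℝ (Fin n)) (a b lam : ℝ)
    (e : Fin N → EuclideanSpace ℝ (Fin n)) :
    sqSum (drift H w x0 a b lam e) ≤ 3 * b ^ 2 * sqSum (consensus w e)
      + 3 * a ^ 2 * sqSum (innovation H e) + 6 * lam ^ 2 * (sqSum e + N * ‖x0‖ ^ 2) := by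
  have h : ∀ i, ‖drift H w x0 a b lam e i‖ ^ 2 ≤ 3 * b ^ 2 * ‖consensus w e i‖ ^ 2
      + 3 * a ^ 2 * ‖innovation H e i‖ ^ 2 + 6 * lam ^ 2 * (‖e i‖ ^ 2 + ‖x0‖ ^ 2) := by
    intro i
    set x := b • consensus w e i with hx
    set y := a • innovation H e i with hy
    set z := lam • (e i + x0) with hz
    have hx' : ‖x‖ ^ 2 = b ^ 2 * ‖consensus w e i‖ ^ 2 := by
      rw [hx, norm_smul, mul_pow, Real.norm_eq_abs, sq_abs]
    have hy' : ‖y‖ ^ 2 = a ^ 2 * ‖innovation H e i‖ ^ 2 := by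
      rw [hy, norm_smul, mul_pow, Real.norm_eq_abs, sq_abs]
    have hz' : ‖z‖ ^ 2 ≤ lam ^ 2 * (2 * ‖e i‖ ^ 2 + 2 * ‖x0‖ ^ 2) := by
      rw [hz, norm_smul, mul_pow, Real.norm_eq_abs, sq_abs]
      exact mul_le_mul_of_nonneg_left (norm_add_sq_le _ _) (sq_nonneg _)
    have h3 : ‖x - y - z‖ ≤ ‖x‖ + ‖y‖ + ‖z‖ :=
      (norm_sub_le _ _).trans (add_le_add (norm_sub_le _ _) le_rfl)
    have h4 : ‖x - y - z‖ ^ 2 ≤ 3 * (‖x‖ ^ 2 + ‖y‖ ^ 2 + ‖z‖ ^ 2) := by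
      refine (pow_le_pow_left₀ (norm_nonneg _) h3 2).trans ?_
      nlinarith [sq_nonneg (‖x‖ - ‖y‖), sq_nonneg (‖x‖ - ‖z‖), sq_nonneg (‖y‖ - ‖z‖)]
    change ‖x - y - z‖ ^ 2 ≤ _
    linarith
  refine (Finset.sum_le_sum fun i _ => h i).trans (le_of_eq ?_)
  simp only [Finset.sum_add_distrib, ← Finset.mul_sum, Finset.sum_const, Finset.card_univ,
    Fintype.card_fin, nsmul_eq_mul, sqSum]

theorem sqSum_noisePart_le (H : (i : Fin N) → Matrix (Fin (d i)) (Fin n) ℝ)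
    (w : Matrix (Fin N) (Fin N) ℝ) (f : Fin N → Fin N → EuclideanSpace ℝ (Fin n) → ℝ)
    (v : (i : Fin N) → EuclideanSpace ℝ (Fin (d i)))
    (ξ : Fin N → Fin N → EuclideanSpace ℝ (Fin n)) (a b : ℝ)
    (e : Fin N → EuclideanSpace ℝ (Fin n)) :
    sqSum (noisePart H w f v ξ a b e) ≤ 2 * a ^ 2 * sqSum (measurementNoise H v)
      + 2 * b ^ 2 * sqSum (channelNoise w f ξ e) := by
  have h : ∀ i, ‖noisePart H w f v ξ a b e i‖ ^ 2 ≤ 2 * a ^ 2 * ‖measurementNoise H v i‖ ^ 2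
      + 2 * b ^ 2 * ‖channelNoise w f ξ e i‖ ^ 2 := by
    intro i
    refine (norm_add_sq_le _ _).trans (le_of_eq ?_)
    rw [norm_smul, norm_smul, mul_pow, mul_pow, Real.norm_eq_abs, Real.norm_eq_abs, sq_abs, sq_abs]
    ring
  refine (Finset.sum_le_sum fun i _ => h i).trans (le_of_eq ?_)
  simp only [Finset.sum_add_distrib, ← Finset.mul_sum, sqSum]

/-- The regularization is harmless because `-2⟨e, e + x₀⟩ = ‖x₀‖² - ‖e‖² - ‖e + x₀‖² ≤ ‖x₀‖²`: its
contribution is of order `λ` and does not grow with the error. -/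
theorem inner_drift_le {H : (i : Fin N) → Matrix (Fin (d i)) (Fin n) ℝ}
    (w : Matrix (Fin N) (Fin N) ℝ) (x0 : EuclideanSpace ℝ (Fin n)) (a b : ℝ) {lam : ℝ}
    (hlam : 0 ≤ lam) (e : Fin N → EuclideanSpace ℝ (Fin n)) :
    2 * ∑ i, inner ℝ (e i) (drift H w x0 a b lam e i) ≤
      -(2 * a) * ∑ i, ‖Matrix.toEuclideanLin (H i) (e i)‖ ^ 2
      - 2 * b * ∑ i, ∑ j, w i j * inner ℝ (e i) (e i - e j) + lam * (N * ‖x0‖ ^ 2) := by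
  have h : ∀ i, 2 * inner ℝ (e i) (drift H w x0 a b lam e i) ≤
      -(2 * a) * ‖Matrix.toEuclideanLin (H i) (e i)‖ ^ 2
      - 2 * b * ∑ j, w i j * inner ℝ (e i) (e i - e j) + lam * ‖x0‖ ^ 2 := by
    intro i
    have h1 : inner ℝ (e i) (innovation H e i) = ‖Matrix.toEuclideanLin (H i) (e i)‖ ^ 2 := by
      rw [innovation, real_inner_comm, inner_toEuclideanLin_transpose, real_inner_self_eq_norm_sq]
    have h2 : inner ℝ (e i) (consensus w e i) = -∑ j, w i j * inner ℝ (e i) (e i - e j) := by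
      rw [consensus, inner_sum, ← Finset.sum_neg_distrib]
      refine Finset.sum_congr rfl fun j _ => ?_
      rw [inner_smul_right, ← mul_neg, ← inner_neg_right, neg_sub]
    have h3 : -(2 * inner ℝ (e i) (e i + x0)) ≤ ‖x0‖ ^ 2 := by
      have := norm_add_sq_real (e i) x0
      rw [inner_add_right, real_inner_self_eq_norm_sq]
      nlinarith [sq_nonneg ‖e i + x0‖, sq_nonneg ‖e i‖]
    rw [drift, inner_sub_right, inner_sub_right, inner_smul_right, inner_smul_right,
      inner_smul_right, h1, h2]
    have := mul_le_mul_of_nonneg_left h3 hlam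
    linarith
  rw [Finset.mul_sum]
  refine (Finset.sum_le_sum fun i _ => h i).trans (le_of_eq ?_)
  simp only [Finset.sum_add_distrib, Finset.sum_sub_distrib, ← Finset.mul_sum, Finset.sum_const,
    Finset.card_univ, Fintype.card_fin, nsmul_eq_mul]

end Increments

/-! ### Measurability of the drift and the noise over an arbitrary σ-algebra. -/

section IncrementMeasurability

variable {Ω : Type*} {m : MeasurableSpace Ω} {N n : ℕ} {d : Fin N → ℕ}
  {H : (i : Fin N) → Ω → Matrix (Fin (d i)) (Fin n) ℝ} {w : Ω → Matrix (Fin N) (Fin N) ℝ}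
  {f : Fin N → Fin N → EuclideanSpace ℝ (Fin n) → ℝ}
  {v : (i : Fin N) → Ω → EuclideanSpace ℝ (Fin (d i))}
  {ξ : Fin N → Fin N → Ω → EuclideanSpace ℝ (Fin n)} {e : Ω → Fin N → EuclideanSpace ℝ (Fin n)}

theorem measurable_channel (hw : ∀ i j, Measurable fun ω => w ω i j)
    (hf : ∀ j i, Measurable (f j i)) (he : ∀ i, Measurable fun ω => e ω i) (i j : Fin N) :
    Measurable fun ω => w ω i j * f j i (e ω j - e ω i) :=
  (hw i j).mul ((hf j i).comp ((he j).sub (he i)))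

theorem measurable_drift (hH : ∀ i r s, Measurable fun ω => H i ω r s)
    (hw : ∀ i j, Measurable fun ω => w ω i j) (he : ∀ i, Measurable fun ω => e ω i)
    (x0 : EuclideanSpace ℝ (Fin n)) (a b lam : ℝ) (i : Fin N) :
    Measurable fun ω => drift (fun i => H i ω) (w ω) x0 a b lam (e ω) i := by
  refine ((Measurable.const_smul ?_ b).sub (Measurable.const_smul ?_ a)).sub
    (((he i).add_const x0).const_smul lam)
  · exact Finset.measurable_sum _ fun j _ => (hw i j).smul ((he j).sub (he i))
  · exact measurable_toEuclideanLin (fun r s => hH i s r)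
      (measurable_toEuclideanLin (hH i) (he i))

theorem measurable_noisePart (hH : ∀ i r s, Measurable fun ω => H i ω r s)
    (hw : ∀ i j, Measurable fun ω => w ω i j) (hf : ∀ j i, Measurable (f j i))
    (hv : ∀ i, Measurable (v i)) (hξ : ∀ j i, Measurable (ξ j i))
    (he : ∀ i, Measurable fun ω => e ω i) (a b : ℝ) (i : Fin N) :
    Measurable fun ω =>
      noisePart (fun i => H i ω) (w ω) f (fun i => v i ω) (fun j i => ξ j i ω) a b (e ω) i := by
  refine (Measurable.const_smul ?_ a).add (Measurable.const_smul ?_ b)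
  · exact measurable_toEuclideanLin (fun r s => hH i s r) (hv i)
  · exact Finset.measurable_sum _ fun j _ => (measurable_channel hw hf he i j).smul (hξ j i)

end IncrementMeasurability

/-! ### Second moments of the drift and the noise. -/

section

theorem setIntegral_inner_eq_zero {Ω : Type*} {mΩ : MeasurableSpace Ω} {μ : Measure Ω}
    [IsFiniteMeasure μ] {m : MeasurableSpace Ω} (hm : m ≤ mΩ) {E : Type*} [NormedAddCommGroup E]
    [InnerProductSpace ℝ E] [CompleteSpace E] {P z : Ω → E} (hP : StronglyMeasurable[m] P)
    (hPz : Integrable (fun ω => inner ℝ (P ω) (z ω)) μ) (hz : Integrable z μ)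
    (hz0 : μ[z|m] =ᵐ[μ] 0) {S : Set Ω} (hS : MeasurableSet[m] S) :
    ∫ ω in S, inner ℝ (P ω) (z ω) ∂μ = 0 := by
  rw [← setIntegral_condExp hm hPz hS]
  have h := condExp_bilin_of_stronglyMeasurable_left (innerSL ℝ) hP hPz hz
  rw [← integral_zero Ω ℝ (μ := μ.restrict S)]
  refine integral_congr_ae (ae_restrict_of_ae ?_)
  filter_upwards [h, hz0] with ω h1 h2
  refine h1.trans ?_
  rw [h2]
  simp

theorem memLp_two_of_norm_sq_le {Ω : Type*} {mΩ : MeasurableSpace Ω} {μ : Measure Ω} {E : Type*}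
    [NormedAddCommGroup E] {z : Ω → E} {g : Ω → ℝ} (hz : AEStronglyMeasurable z μ)
    (hg : Integrable g μ) (h : ∀ᵐ ω ∂μ, ‖z ω‖ ^ 2 ≤ g ω) : MemLp z 2 μ := by
  refine (memLp_two_iff_integrable_sq_norm hz).2 (hg.mono' (hz.norm.pow 2) ?_)
  filter_upwards [h] with ω hω
  rwa [Real.norm_of_nonneg (sq_nonneg _)]

theorem integrable_inner_of_memLp {Ω : Type*} {mΩ : MeasurableSpace Ω} {μ : Measure Ω} {E : Type*}
    [NormedAddCommGroup E] [InnerProductSpace ℝ E] {y z : Ω → E} (hy : MemLp y 2 μ)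
    (hz : MemLp z 2 μ) : Integrable (fun ω => inner ℝ (y ω) (z ω)) μ := by
  refine (((memLp_two_iff_integrable_sq_norm hy.1).1 hy).add
    ((memLp_two_iff_integrable_sq_norm hz.1).1 hz)).mono' (hy.1.inner hz.1) (ae_of_all _ fun ω => ?_)
  refine (norm_inner_le_norm _ _).trans ?_
  simp only [Pi.add_apply]
  nlinarith [sq_nonneg (‖y ω‖ - ‖z ω‖), sq_nonneg ‖y ω‖, sq_nonneg ‖z ω‖]

variable {Ω : Type*} [mΩ : MeasurableSpace Ω] {N n : ℕ} {d : Fin N → ℕ}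

theorem Network.sqSum_innovation_le (net : Network Ω N n d) (k : ℕ) (ω : Ω)
    (e : Fin N → EuclideanSpace ℝ (Fin n)) :
    sqSum (innovation (fun i => net.H k i ω) e) ≤ specNorm (net.gram k ω) ^ 2 * sqSum e := by
  rw [sqSum, sqSum, Finset.mul_sum]
  refine Finset.sum_le_sum fun i _ => (net.norm_sq_H_transpose_le k ω i _).trans ?_
  rw [sq (specNorm _), mul_assoc]
  exact mul_le_mul_of_nonneg_left (net.norm_sq_H_le k ω i (e i)) (specNorm_nonneg _)

theorem Network.sqSum_measurementNoise_le (net : Network Ω N n d) (k : ℕ) (ω : Ω) :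
    sqSum (measurementNoise (fun i => net.H k i ω) fun i => net.v k i ω)
      ≤ net.noiseSq k ω * specNorm (net.gram k ω) := by
  have h1 : sqSum (measurementNoise (fun i => net.H k i ω) fun i => net.v k i ω)
      ≤ specNorm (net.gram k ω) * ∑ i, ‖net.v k i ω‖ ^ 2 := by
    rw [sqSum, Finset.mul_sum]
    exact Finset.sum_le_sum fun i _ => net.norm_sq_H_transpose_le k ω i _
  have h2 : ∑ i, ‖net.v k i ω‖ ^ 2 ≤ net.noiseSq k ω :=
    le_add_of_nonneg_right (Finset.sum_nonneg fun _ _ => Finset.sum_nonneg fun _ _ => sq_nonneg _)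
  rw [mul_comm (net.noiseSq k ω)]
  exact h1.trans (mul_le_mul_of_nonneg_left h2 (specNorm_nonneg _))

/-- The drift of the error at time `k`. -/
def Network.driftAt (net : Network Ω N n d) (x0 : EuclideanSpace ℝ (Fin n)) (a b lam : ℝ) (k : ℕ)
    (ω : Ω) (e : Fin N → EuclideanSpace ℝ (Fin n)) : Fin N → EuclideanSpace ℝ (Fin n) :=
  drift (fun i => net.H k i ω) (net.A k ω) x0 a b lam e

/-- The noise in the error at time `k`. -/
def Network.noiseAt (net : Network Ω N n d) (f : Fin N → Fin N → EuclideanSpace ℝ (Fin n) → ℝ)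
    (a b : ℝ) (k : ℕ) (ω : Ω) (e : Fin N → EuclideanSpace ℝ (Fin n)) :
    Fin N → EuclideanSpace ℝ (Fin n) :=
  noisePart (fun i => net.H k i ω) (net.A k ω) f (fun i => net.v k i ω)
    (fun j i => net.ξ k j i ω) a b e

variable {μ : Measure Ω} [IsProbabilityMeasure μ] {net : Network Ω N n d} {k : ℕ}
  {y : Ω → Fin N → EuclideanSpace ℝ (Fin n)} {ρ R β σ c : ℝ} {x0 : EuclideanSpace ℝ (Fin n)}
  {f : Fin N → Fin N → EuclideanSpace ℝ (Fin n) → ℝ} {a b lam : ℝ}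

namespace DataBounds

theorem measurable_driftAt (hy : IsState μ net k y) (i : Fin N) :
    Measurable fun ω => net.driftAt x0 a b lam k ω (y ω) i :=
  measurable_drift (net.measurable_H k) (net.measurable_A k) hy.measurable x0 a b lam i

theorem measurable_noiseAt (hfm : ∀ j i, Measurable (f j i)) (hy : IsState μ net k y) (i : Fin N) :
    Measurable fun ω => net.noiseAt f a b k ω (y ω) i :=
  measurable_noisePart (net.measurable_H k) (net.measurable_A k) hfm (net.measurable_v k)
    (net.measurable_ξ k) hy.measurable a b i

theorem integrable_gram_sq_mul (hB : DataBounds μ net ρ R β) (hy : IsState μ net k y) :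
    Integrable (fun ω => specNorm (net.gram k ω) ^ 2 * sqSum (y ω)) μ :=
  integrable_mul_of_condExp_le (net.history_le k) (hB.integrable_gram_sq k)
    (ae_of_all _ fun ω => sq_nonneg _) (hB.condExp_gram_sq k) hy.stronglyMeasurable_sqSum
    (fun ω => sqSum_nonneg (y ω)) hy.integrable_sqSum

theorem driftAt_le (hB : DataBounds μ net ρ R β) :
    ∀ᵐ ω ∂μ, sqSum (net.driftAt x0 a b lam k ω (y ω)) ≤
      12 * b ^ 2 * N ^ 2 * ρ ^ 2 * sqSum (y ω)
        + 3 * a ^ 2 * (specNorm (net.gram k ω) ^ 2 * sqSum (y ω))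
        + 6 * lam ^ 2 * (sqSum (y ω) + N * ‖x0‖ ^ 2) := by
  filter_upwards [hB.A_le] with ω hω
  refine (sqSum_drift_le _ _ x0 a b lam (y ω)).trans ?_
  have h1 := mul_le_mul_of_nonneg_left (sqSum_consensus_le (hω k) (y ω))
    (by positivity : 0 ≤ 3 * b ^ 2)
  have h2 := mul_le_mul_of_nonneg_left (net.sqSum_innovation_le k ω (y ω))
    (by positivity : 0 ≤ 3 * a ^ 2)
  linarith

theorem integrable_driftAt_bound (hB : DataBounds μ net ρ R β) (hy : IsState μ net k y) :
    Integrable (fun ω => 12 * b ^ 2 * N ^ 2 * ρ ^ 2 * sqSum (y ω)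
        + 3 * a ^ 2 * (specNorm (net.gram k ω) ^ 2 * sqSum (y ω))
        + 6 * lam ^ 2 * (sqSum (y ω) + N * ‖x0‖ ^ 2)) μ :=
  ((hy.integrable_sqSum.const_mul _).add ((hB.integrable_gram_sq_mul hy).const_mul _)).add
    ((hy.integrable_sqSum.add (integrable_const _)).const_mul _)

theorem memLp_driftAt (hB : DataBounds μ net ρ R β) (hy : IsState μ net k y) (i : Fin N) :
    MemLp (fun ω => net.driftAt x0 a b lam k ω (y ω) i) 2 μ :=
  memLp_two_of_norm_sq_le (measurable_driftAt hy i).aestronglyMeasurable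
    (hB.integrable_driftAt_bound (x0 := x0) (a := a) (b := b) (lam := lam) hy)
    (hB.driftAt_le.mono fun ω hω => (norm_sq_le_sqSum _ i).trans hω)

theorem integrable_sqSum_of_memLp {z : Ω → Fin N → EuclideanSpace ℝ (Fin n)}
    (hz : ∀ i, MemLp (fun ω => z ω i) 2 μ) : Integrable (fun ω => sqSum (z ω)) μ :=
  integrable_finsetSum _ fun i _ => (memLp_two_iff_integrable_sq_norm (hz i).1).1 (hz i)

theorem setIntegral_sqSum_driftAt_le (hB : DataBounds μ net ρ R β) (hy : IsState μ net k y)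
    {S : Set Ω} (hS : MeasurableSet[net.history k] S) :
    ∫ ω in S, sqSum (net.driftAt x0 a b lam k ω (y ω)) ∂μ ≤
      (3 * R + 12 * N ^ 2 * ρ ^ 2 + 6 + 6 * N * ‖x0‖ ^ 2) * (a ^ 2 + b ^ 2 + lam ^ 2) *
        (∫ ω in S, sqSum (y ω) ∂μ + μ.real S) := by
  have h1 := setIntegral_mono_ae (s := S)
    (integrable_sqSum_of_memLp (hB.memLp_driftAt (x0 := x0) (a := a) (b := b) (lam := lam)
      hy)).integrableOn
    (hB.integrable_driftAt_bound (x0 := x0) (a := a) (b := b) (lam := lam) hy).integrableOn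
    hB.driftAt_le
  have h2 := setIntegral_mul_le_of_condExp_le (net.history_le k) (hB.integrable_gram_sq k)
    (ae_of_all _ fun ω => sq_nonneg _) (hB.condExp_gram_sq k) hy.stronglyMeasurable_sqSum
    (fun ω => sqSum_nonneg (y ω)) hy.integrable_sqSum hS
  rw [integral_add, integral_add, integral_const_mul, integral_const_mul, integral_const_mul,
    integral_add hy.integrable_sqSum.integrableOn (integrable_const _), setIntegral_const,
    smul_eq_mul] at h1
  · set V := ∫ ω in S, sqSum (y ω) ∂μ with hV
    have hV0 : 0 ≤ V := integral_nonneg fun ω => sqSum_nonneg _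
    set s := μ.real S with hs
    have hs0 : 0 ≤ s := measureReal_nonneg
    have hR := hB.R_nonneg
    set X := N * ‖x0‖ ^ 2 with hX
    have hX0 : 0 ≤ X := by positivity
    set Y := (N : ℝ) ^ 2 * ρ ^ 2 with hY
    have hY0 : 0 ≤ Y := by positivity
    have h3 := mul_le_mul_of_nonneg_left h2 (by positivity : 0 ≤ 3 * a ^ 2)
    refine h1.trans ?_
    -- The target constant splits into the terms needed and a remainder that is visibly nonnegative.
    have e1 : (3 * R + 12 * N ^ 2 * ρ ^ 2 + 6 + 6 * N * ‖x0‖ ^ 2) * (a ^ 2 + b ^ 2 + lam ^ 2) *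
        (V + s) = 3 * a ^ 2 * (R * V) + 12 * b ^ 2 * Y * V + 6 * lam ^ 2 * (V + s * X)
        + (3 * R * (b ^ 2 + lam ^ 2) * V + 3 * R * (a ^ 2 + b ^ 2 + lam ^ 2) * s
        + 12 * Y * (a ^ 2 + lam ^ 2) * V + 12 * Y * (a ^ 2 + b ^ 2 + lam ^ 2) * s
        + 6 * (a ^ 2 + b ^ 2) * V + 6 * (a ^ 2 + b ^ 2 + lam ^ 2) * s
        + 6 * X * (a ^ 2 + b ^ 2) * s + 6 * X * (a ^ 2 + b ^ 2 + lam ^ 2) * V) := by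
      rw [hX, hY]; ring
    rw [e1]
    have e2 : 0 ≤ 3 * R * (b ^ 2 + lam ^ 2) * V + 3 * R * (a ^ 2 + b ^ 2 + lam ^ 2) * s
        + 12 * Y * (a ^ 2 + lam ^ 2) * V + 12 * Y * (a ^ 2 + b ^ 2 + lam ^ 2) * s
        + 6 * (a ^ 2 + b ^ 2) * V + 6 * (a ^ 2 + b ^ 2 + lam ^ 2) * s
        + 6 * X * (a ^ 2 + b ^ 2) * s + 6 * X * (a ^ 2 + b ^ 2 + lam ^ 2) * V := by positivity
    have e3 : 12 * b ^ 2 * N ^ 2 * ρ ^ 2 * V = 12 * b ^ 2 * Y * V := by rw [hY]; ring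
    rw [e3]
    linarith
  · exact (hy.integrable_sqSum.const_mul _).integrableOn
  · exact ((hB.integrable_gram_sq_mul hy).const_mul _).integrableOn
  · exact ((hy.integrable_sqSum.const_mul _).add
      ((hB.integrable_gram_sq_mul hy).const_mul _)).integrableOn
  · exact ((hy.integrable_sqSum.add (integrable_const _)).const_mul _).integrableOn

theorem stronglyMeasurable_one_add_sqSum (hy : IsState μ net k y) :
    StronglyMeasurable[net.enriched k] fun ω => 1 + sqSum (y ω) :=
  stronglyMeasurable_const.add (hy.stronglyMeasurable_sqSum.mono (net.history_le_enriched k))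

theorem stronglyMeasurable_gram (net : Network Ω N n d) (k : ℕ) :
    StronglyMeasurable[net.enriched k] fun ω => specNorm (net.gram k ω) :=
  (net.measurable_specNorm_gram k).stronglyMeasurable.mono (net.sigmaAH_le_enriched k)

/-- The Gram norm at time `k` belongs to the enriched past, so the conditional noise bound applies
although both factors refer to the same time. -/
theorem integrable_noiseSq_mul_gram (hB : DataBounds μ net ρ R β) (k : ℕ) :
    Integrable (fun ω => net.noiseSq k ω * specNorm (net.gram k ω)) μ :=
  integrable_mul_of_condExp_le (net.enriched_le k) (hB.integrable_noiseSq k)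
    (ae_of_all _ fun ω => net.noiseSq_nonneg k ω) (hB.condExp_noiseSq k)
    (stronglyMeasurable_gram net k) (fun ω => specNorm_nonneg _) (hB.integrable_gram k)

theorem integrable_noiseSq_mul_one_add (hB : DataBounds μ net ρ R β) (hy : IsState μ net k y) :
    Integrable (fun ω => net.noiseSq k ω * (1 + sqSum (y ω))) μ :=
  integrable_mul_of_condExp_le (net.enriched_le k) (hB.integrable_noiseSq k)
    (ae_of_all _ fun ω => net.noiseSq_nonneg k ω) (hB.condExp_noiseSq k)
    (stronglyMeasurable_one_add_sqSum hy) (fun ω => add_nonneg zero_le_one (sqSum_nonneg _))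
    ((integrable_const 1).add hy.integrable_sqSum)

theorem noiseAt_le (hB : DataBounds μ net ρ R β) (hf : ∀ j i x, |f j i x| ≤ σ * ‖x‖ + c) :
    ∀ᵐ ω ∂μ, sqSum (net.noiseAt f a b k ω (y ω)) ≤
      2 * a ^ 2 * (net.noiseSq k ω * specNorm (net.gram k ω))
        + 2 * b ^ 2 * (N * ρ ^ 2 * (8 * σ ^ 2 + 2 * c ^ 2)) *
          (net.noiseSq k ω * (1 + sqSum (y ω))) := by
  filter_upwards [hB.A_le] with ω hω
  refine (sqSum_noisePart_le _ _ f _ _ a b (y ω)).trans ?_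
  have h1 := mul_le_mul_of_nonneg_left (net.sqSum_measurementNoise_le k ω)
    (by positivity : 0 ≤ 2 * a ^ 2)
  have h2 := mul_le_mul_of_nonneg_left
    (sqSum_channelNoise_le hf (hω k) (fun j i => net.ξ k j i ω) (y ω))
    (by positivity : 0 ≤ 2 * b ^ 2)
  have h3 : ∑ j, ∑ i, ‖net.ξ k j i ω‖ ^ 2 ≤ net.noiseSq k ω :=
    le_add_of_nonneg_left (Finset.sum_nonneg fun _ _ => sq_nonneg _)
  have h4 := mul_le_mul_of_nonneg_right h3 (add_nonneg zero_le_one (sqSum_nonneg (y ω)))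
  have h5 := mul_le_mul_of_nonneg_left h4
    (by positivity : 0 ≤ 2 * b ^ 2 * (N * ρ ^ 2 * (8 * σ ^ 2 + 2 * c ^ 2)))
  linarith

theorem integrable_noiseAt_bound (hB : DataBounds μ net ρ R β) (hy : IsState μ net k y) :
    Integrable (fun ω => 2 * a ^ 2 * (net.noiseSq k ω * specNorm (net.gram k ω))
        + 2 * b ^ 2 * (N * ρ ^ 2 * (8 * σ ^ 2 + 2 * c ^ 2)) *
          (net.noiseSq k ω * (1 + sqSum (y ω)))) μ :=
  ((hB.integrable_noiseSq_mul_gram k).const_mul _).add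
    ((hB.integrable_noiseSq_mul_one_add hy).const_mul _)

theorem memLp_noiseAt (hB : DataBounds μ net ρ R β) (hf : ∀ j i x, |f j i x| ≤ σ * ‖x‖ + c)
    (hfm : ∀ j i, Measurable (f j i)) (hy : IsState μ net k y) (i : Fin N) :
    MemLp (fun ω => net.noiseAt f a b k ω (y ω) i) 2 μ :=
  memLp_two_of_norm_sq_le (measurable_noiseAt hfm hy i).aestronglyMeasurable
    (hB.integrable_noiseAt_bound (a := a) (b := b) (σ := σ) (c := c) hy)
    ((hB.noiseAt_le hf).mono fun ω hω => (norm_sq_le_sqSum _ i).trans hω)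

/-- The measurement noise is averaged in two stages: the noise energy given the enriched past, then
the Gram norm given `𝓕(k-1)`. -/
theorem setIntegral_sqSum_noiseAt_le (hB : DataBounds μ net ρ R β)
    (hf : ∀ j i x, |f j i x| ≤ σ * ‖x‖ + c) (hfm : ∀ j i, Measurable (f j i))
    (hy : IsState μ net k y) {S : Set Ω} (hS : MeasurableSet[net.history k] S) :
    ∫ ω in S, sqSum (net.noiseAt f a b k ω (y ω)) ∂μ ≤
      (2 * β * R + 2 * (N * ρ ^ 2 * (8 * σ ^ 2 + 2 * c ^ 2)) * β) * (a ^ 2 + b ^ 2) *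
        (∫ ω in S, sqSum (y ω) ∂μ + μ.real S) := by
  have hS' := net.history_le_enriched k S hS
  have h1 := setIntegral_mono_ae (s := S)
    (integrable_sqSum_of_memLp (hB.memLp_noiseAt (a := a) (b := b) hf hfm hy)).integrableOn
    (hB.integrable_noiseAt_bound (a := a) (b := b) (σ := σ) (c := c) hy).integrableOn
    (hB.noiseAt_le hf)
  have h2 := setIntegral_mul_le_of_condExp_le (net.enriched_le k) (hB.integrable_noiseSq k)
    (ae_of_all _ fun ω => net.noiseSq_nonneg k ω) (hB.condExp_noiseSq k)
    (stronglyMeasurable_gram net k) (fun ω => specNorm_nonneg _) (hB.integrable_gram k) hS'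
  have h3 := setIntegral_mul_le_of_condExp_le (net.enriched_le k) (hB.integrable_noiseSq k)
    (ae_of_all _ fun ω => net.noiseSq_nonneg k ω) (hB.condExp_noiseSq k)
    (stronglyMeasurable_one_add_sqSum hy) (fun ω => add_nonneg zero_le_one (sqSum_nonneg _))
    ((integrable_const 1).add hy.integrable_sqSum) hS'
  have h4 := setIntegral_mul_le_of_condExp_le (net.history_le k) (hB.integrable_gram k)
    (ae_of_all _ fun ω => specNorm_nonneg _) (hB.condExp_gram k)
    (stronglyMeasurable_const (b := (1 : ℝ))) (fun ω => zero_le_one) (integrable_const _) hS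
  simp only [mul_one, setIntegral_const, smul_eq_mul] at h4
  rw [integral_add (integrable_const _) hy.integrable_sqSum.integrableOn, setIntegral_const,
    smul_eq_mul, mul_one] at h3
  rw [integral_add ((hB.integrable_noiseSq_mul_gram k).const_mul _).integrableOn
    ((hB.integrable_noiseSq_mul_one_add hy).const_mul _).integrableOn, integral_const_mul,
    integral_const_mul] at h1
  set V := ∫ ω in S, sqSum (y ω) ∂μ with hV
  have hV0 : 0 ≤ V := integral_nonneg fun ω => sqSum_nonneg _
  set s := μ.real S with hs
  have hs0 : 0 ≤ s := measureReal_nonneg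
  have hR := hB.R_nonneg
  have hβ := hB.β_nonneg
  set F := N * ρ ^ 2 * (8 * σ ^ 2 + 2 * c ^ 2) with hF
  have hF0 : 0 ≤ F := by positivity
  have h5 := mul_le_mul_of_nonneg_left (h2.trans (mul_le_mul_of_nonneg_left h4 hβ))
    (by positivity : 0 ≤ 2 * a ^ 2)
  have h6 := mul_le_mul_of_nonneg_left h3 (by positivity : 0 ≤ 2 * b ^ 2 * F)
  refine h1.trans ((add_le_add h5 h6).trans ?_)
  have e1 : (2 * β * R + 2 * F * β) * (a ^ 2 + b ^ 2) * (V + s)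
      = 2 * a ^ 2 * (β * (R * s)) + 2 * b ^ 2 * F * (β * (s + V))
        + (2 * β * R * (a ^ 2 * V + b ^ 2 * (V + s)) + 2 * F * β * a ^ 2 * (V + s)) := by ring
  have e2 : 0 ≤ 2 * β * R * (a ^ 2 * V + b ^ 2 * (V + s)) + 2 * F * β * a ^ 2 * (V + s) := by
    positivity
  rw [e1]
  linarith

end DataBounds

end

/-! ### One step of the algorithm. -/

section

variable {Ω : Type*} [mΩ : MeasurableSpace Ω] {N n : ℕ} {d : Fin N → ℕ}

namespace Network

variable (net : Network Ω N n d)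

theorem measurable_A_enriched (k : ℕ) (i j : Fin N) :
    Measurable[net.enriched k] fun ω => net.A k ω i j :=
  (net.measurable_A_sigmaAH k i j).mono (net.sigmaAH_le_enriched k) le_rfl

theorem measurable_H_enriched (k : ℕ) (i : Fin N) (r : Fin (d i)) (s : Fin n) :
    Measurable[net.enriched k] fun ω => net.H k i ω r s :=
  (net.measurable_H_sigmaAH k i r s).mono (net.sigmaAH_le_enriched k) le_rfl

theorem measurable_A_history (k : ℕ) (i j : Fin N) :
    Measurable[net.history (k + 1)] fun ω => net.A k ω i j :=
  (net.measurable_A_sigmaAH k i j).mono (net.sigmaAH_le_history k) le_rfl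

theorem measurable_H_history (k : ℕ) (i : Fin N) (r : Fin (d i)) (s : Fin n) :
    Measurable[net.history (k + 1)] fun ω => net.H k i ω r s :=
  (net.measurable_H_sigmaAH k i r s).mono (net.sigmaAH_le_history k) le_rfl

theorem measurable_v_history (k : ℕ) (i : Fin N) :
    Measurable[net.history (k + 1)] (net.v k i) :=
  (net.measurable_v_sigmaNoise k i).mono (net.sigmaNoise_le_history k) le_rfl

theorem measurable_ξ_history (k : ℕ) (j i : Fin N) :
    Measurable[net.history (k + 1)] (net.ξ k j i) :=
  (net.measurable_ξ_sigmaNoise k j i).mono (net.sigmaNoise_le_history k) le_rfl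

end Network

variable {μ : Measure Ω} [IsProbabilityMeasure μ] {net : Network Ω N n d} {k : ℕ}
  {y : Ω → Fin N → EuclideanSpace ℝ (Fin n)} {ρ R β σ c : ℝ} {x0 : EuclideanSpace ℝ (Fin n)}
  {f : Fin N → Fin N → EuclideanSpace ℝ (Fin n) → ℝ} {a b lam : ℝ}

namespace DataBounds

theorem measurable_driftAt_enriched (hy : IsState μ net k y) (i : Fin N) :
    Measurable[net.enriched k] fun ω => net.driftAt x0 a b lam k ω (y ω) i :=
  measurable_drift (net.measurable_H_enriched k) (net.measurable_A_enriched k)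
    (fun i => ((hy.meas i).mono (net.history_le_enriched k)).measurable) x0 a b lam i

theorem isState_next (hB : DataBounds μ net ρ R β) (hf : ∀ j i x, |f j i x| ≤ σ * ‖x‖ + c)
    (hfm : ∀ j i, Measurable (f j i)) (hy : IsState μ net k y) :
    IsState μ net (k + 1) fun ω =>
      y ω + net.driftAt x0 a b lam k ω (y ω) + net.noiseAt f a b k ω (y ω) := by
  have hym : ∀ i, Measurable[net.history (k + 1)] fun ω => y ω i := fun i =>
    ((hy.meas i).mono (net.history_mono k.le_succ)).measurable
  have hD : ∀ i, Measurable[net.history (k + 1)] fun ω =>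
      net.driftAt x0 a b lam k ω (y ω) i :=
    measurable_drift (net.measurable_H_history k) (net.measurable_A_history k) hym x0 a b lam
  have hW : ∀ i, Measurable[net.history (k + 1)] fun ω => net.noiseAt f a b k ω (y ω) i :=
    measurable_noisePart (net.measurable_H_history k) (net.measurable_A_history k) hfm
      (net.measurable_v_history k) (net.measurable_ξ_history k) hym a b
  exact ⟨fun i => ((hym i).stronglyMeasurable.add (hD i).stronglyMeasurable).add
      (hW i).stronglyMeasurable,
    fun i => ((hy.memLp i).add (hB.memLp_driftAt hy i)).add (hB.memLp_noiseAt hf hfm hy i)⟩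

theorem memLp_measurementNoise (hB : DataBounds μ net ρ R β) (k : ℕ) (i : Fin N) :
    MemLp (fun ω => measurementNoise (fun i => net.H k i ω) (fun i => net.v k i ω) i) 2 μ :=
  memLp_two_of_norm_sq_le (measurable_toEuclideanLin (fun r s => net.measurable_H k i s r)
      (net.measurable_v k i)).aestronglyMeasurable (hB.integrable_noiseSq_mul_gram k)
    (ae_of_all _ fun ω => (norm_sq_le_sqSum
      (measurementNoise (fun i => net.H k i ω) fun i => net.v k i ω) i).trans
      (net.sqSum_measurementNoise_le k ω))

theorem memLp_channel (hB : DataBounds μ net ρ R β) (hf : ∀ j i x, |f j i x| ≤ σ * ‖x‖ + c)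
    (hfm : ∀ j i, Measurable (f j i)) (hy : IsState μ net k y) (i j : Fin N) :
    MemLp (fun ω => (net.A k ω i j * f j i (y ω j - y ω i)) • net.ξ k j i ω) 2 μ := by
  refine memLp_two_of_norm_sq_le
    ((measurable_channel (net.measurable_A k) hfm hy.measurable i j).smul
      (net.measurable_ξ k j i)).aestronglyMeasurable
    ((hB.integrable_noiseSq_mul_one_add hy).const_mul (ρ ^ 2 * (8 * σ ^ 2 + 2 * c ^ 2)))
    (hB.A_le.mono fun ω hω => ?_)
  refine (norm_channel_sq_le hf (hω k) (fun j i => net.ξ k j i ω) (y ω) i j).trans ?_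
  have h1 := mul_le_mul_of_nonneg_right (net.norm_ξ_sq_le_noiseSq k j i ω)
    (add_nonneg zero_le_one (sqSum_nonneg (y ω)))
  have h2 := mul_le_mul_of_nonneg_left h1
    (by positivity : 0 ≤ ρ ^ 2 * (8 * σ ^ 2 + 2 * c ^ 2))
  linarith

/-- Moving `Hᵢᵀ` and the scalar channel factors onto `P` leaves inner products of an
enriched-measurable vector with a martingale difference. Enriched measurability is required because
`P` will include the drift at time `k`. -/
theorem setIntegral_inner_noiseAt (hB : DataBounds μ net ρ R β)
    (hf : ∀ j i x, |f j i x| ≤ σ * ‖x‖ + c) (hfm : ∀ j i, Measurable (f j i))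
    (hy : IsState μ net k y) {S : Set Ω} (hS : MeasurableSet[net.enriched k] S)
    {P : Ω → EuclideanSpace ℝ (Fin n)} (hPm : Measurable[net.enriched k] P)
    (hP : MemLp P 2 μ) (i : Fin N) :
    ∫ ω in S, inner ℝ (P ω) (net.noiseAt f a b k ω (y ω) i) ∂μ = 0 := by
  have h1 := hB.memLp_measurementNoise k i
  have h2 := hB.memLp_channel hf hfm hy i
  have i1 := integrable_inner_of_memLp hP h1
  have i2 := fun j => integrable_inner_of_memLp hP (h2 j)
  have e1 : ∀ ω, inner ℝ (P ω) (net.noiseAt f a b k ω (y ω) i)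
      = a * inner ℝ (P ω) (measurementNoise (fun i => net.H k i ω) (fun i => net.v k i ω) i)
        + b * ∑ j, inner ℝ (P ω)
          ((net.A k ω i j * f j i (y ω j - y ω i)) • net.ξ k j i ω) := by
    intro ω
    rw [Network.noiseAt, noisePart, inner_add_right, inner_smul_right, inner_smul_right,
      channelNoise, inner_sum]
  have z1 : ∫ ω in S, inner ℝ (P ω)
      (measurementNoise (fun i => net.H k i ω) (fun i => net.v k i ω) i) ∂μ = 0 := by
    have e2 : ∀ ω, inner ℝ (P ω)
        (measurementNoise (fun i => net.H k i ω) (fun i => net.v k i ω) i)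
        = inner ℝ (Matrix.toEuclideanLin (net.H k i ω) (P ω)) (net.v k i ω) := by
      intro ω
      rw [measurementNoise, real_inner_comm, inner_toEuclideanLin_transpose, real_inner_comm]
    simp only [e2] at i1 ⊢
    exact setIntegral_inner_eq_zero (net.enriched_le k)
      (measurable_toEuclideanLin (net.measurable_H_enriched k i) hPm).stronglyMeasurable i1
      (hB.integrable_v k i) (hB.condExp_v k i) hS
  have z2 : ∀ j, ∫ ω in S, inner ℝ (P ω)
      ((net.A k ω i j * f j i (y ω j - y ω i)) • net.ξ k j i ω) ∂μ = 0 := by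
    intro j
    have e2 : ∀ ω, inner ℝ (P ω) ((net.A k ω i j * f j i (y ω j - y ω i)) • net.ξ k j i ω)
        = inner ℝ ((net.A k ω i j * f j i (y ω j - y ω i)) • P ω) (net.ξ k j i ω) := by
      intro ω
      rw [inner_smul_right, real_inner_smul_left]
    have i3 := i2 j
    simp only [e2] at i3 ⊢
    have hg := (measurable_channel (net.measurable_A_enriched k) hfm
      (fun i => ((hy.meas i).mono (net.history_le_enriched k)).measurable) i j).stronglyMeasurable
    exact setIntegral_inner_eq_zero (net.enriched_le k) (hg.smul hPm.stronglyMeasurable) i3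
      (hB.integrable_ξ k j i) (hB.condExp_ξ k j i) hS
  simp only [e1]
  rw [integral_add (i1.const_mul a).integrableOn
    ((integrable_finsetSum _ fun j _ => i2 j).const_mul b).integrableOn, integral_const_mul,
    integral_const_mul, integral_finsetSum _ fun j _ => (i2 j).integrableOn, z1,
    Finset.sum_congr rfl fun j _ => z2 j]
  simp

/-- One step of the algorithm, integrated over an event of the past. -/
theorem setIntegral_sqSum_next_le (hB : DataBounds μ net ρ R β) (hbal : CondBalanced μ net)
    (hf : ∀ j i x, |f j i x| ≤ σ * ‖x‖ + c) (hfm : ∀ j i, Measurable (f j i))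
    (hlam : 0 ≤ lam) (hy : IsState μ net k y) {S : Set Ω} (hS : MeasurableSet[net.history k] S) :
    ∫ ω in S, sqSum (y ω + net.driftAt x0 a b lam k ω (y ω) + net.noiseAt f a b k ω (y ω)) ∂μ
      ≤ ∫ ω in S, sqSum (y ω) ∂μ
        - 2 * (b * ∫ ω in S, dirichlet (net.A k ω) (y ω) ∂μ
          + a * ∫ ω in S, net.obsEnergy k ω (y ω) ∂μ)
        + lam * (N * ‖x0‖ ^ 2) * μ.real S
        + ∫ ω in S, sqSum (net.driftAt x0 a b lam k ω (y ω)) ∂μ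
        + ∫ ω in S, sqSum (net.noiseAt f a b k ω (y ω)) ∂μ := by
  have hD := hB.memLp_driftAt (x0 := x0) (a := a) (b := b) (lam := lam) hy
  have hW := hB.memLp_noiseAt (a := a) (b := b) hf hfm hy
  have iD := integrable_sqSum_of_memLp hD
  have iW := integrable_sqSum_of_memLp hW
  have hPm : ∀ i, Measurable[net.enriched k] fun ω =>
      y ω i + net.driftAt x0 a b lam k ω (y ω) i := fun i =>
    (((hy.meas i).mono (net.history_le_enriched k)).add
      (measurable_driftAt_enriched hy i).stronglyMeasurable).measurable
  have hP : ∀ i, MemLp (fun ω => y ω i + net.driftAt x0 a b lam k ω (y ω) i) 2 μ :=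
    fun i => (hy.memLp i).add (hD i)
  have iPW := fun i => integrable_inner_of_memLp (hP i) (hW i)
  have hcross : ∫ ω in S, ∑ i, inner ℝ (y ω i + net.driftAt x0 a b lam k ω (y ω) i)
      (net.noiseAt f a b k ω (y ω) i) ∂μ = 0 := by
    rw [integral_finsetSum _ fun i _ => (iPW i).integrableOn]
    exact Finset.sum_eq_zero fun i _ => hB.setIntegral_inner_noiseAt hf hfm hy
      (net.history_le_enriched k S hS) (hPm i) (hP i) i
  have iA := integrable_finsetSum Finset.univ fun i _ => integrable_finsetSum Finset.univ
    fun j _ => hB.integrable_A_mul k i j (integrable_inner_sub hy i j)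
  have iO := hB.integrable_obsEnergy hy
  have hdir := hB.setIntegral_sum_inner_eq_dirichlet hbal hy hS
  have iX := integrable_finsetSum Finset.univ fun i _ => iPW i
  -- The square is expanded with state plus drift as one vector, so that all terms linear in the
  -- noise gather in the last sum, whose integral is zero.
  have hpt : ∀ ω, sqSum (y ω + net.driftAt x0 a b lam k ω (y ω) + net.noiseAt f a b k ω (y ω))
      ≤ sqSum (y ω) + -(2 * a) * net.obsEnergy k ω (y ω)
        + -(2 * b) * ∑ i, ∑ j, net.A k ω i j * inner ℝ (y ω i) (y ω i - y ω j)
        + lam * (N * ‖x0‖ ^ 2) + sqSum (net.driftAt x0 a b lam k ω (y ω))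
        + sqSum (net.noiseAt f a b k ω (y ω))
        + 2 * ∑ i, inner ℝ (y ω i + net.driftAt x0 a b lam k ω (y ω) i)
          (net.noiseAt f a b k ω (y ω) i) := by
    intro ω
    have h1 := inner_drift_le (H := fun i => net.H k i ω) (net.A k ω) x0 a b hlam (y ω)
    have h2 : sqSum (y ω + net.driftAt x0 a b lam k ω (y ω) + net.noiseAt f a b k ω (y ω))
        = sqSum (y ω) + 2 * ∑ i, inner ℝ (y ω i) (net.driftAt x0 a b lam k ω (y ω) i)
          + sqSum (net.driftAt x0 a b lam k ω (y ω)) + sqSum (net.noiseAt f a b k ω (y ω))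
          + 2 * ∑ i, inner ℝ (y ω i + net.driftAt x0 a b lam k ω (y ω) i)
            (net.noiseAt f a b k ω (y ω) i) := by
      simp only [sqSum, Finset.mul_sum, ← Finset.sum_add_distrib]
      refine Finset.sum_congr rfl fun i _ => ?_
      rw [Pi.add_apply, Pi.add_apply, norm_add_sq_real, norm_add_sq_real]
      ring
    rw [h2]
    simp only [Network.obsEnergy, Network.driftAt] at h1 ⊢
    linarith
  have hmono := setIntegral_mono (s := S)
    (hB.isState_next (x0 := x0) (a := a) (b := b) (lam := lam) hf hfm
      hy).integrable_sqSum.integrableOn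
    ((((((hy.integrable_sqSum.add (iO.const_mul (-(2 * a)))).add (iA.const_mul (-(2 * b)))).add
      (integrable_const (lam * (N * ‖x0‖ ^ 2)))).add iD).add iW).add
      (iX.const_mul 2)).integrableOn hpt
  refine hmono.trans (le_of_eq ?_)
  simp only [Pi.add_apply]
  rw [integral_add, integral_add, integral_add, integral_add, integral_add, integral_add,
    integral_const_mul (-(2 * a)), integral_const_mul (-(2 * b)), integral_const_mul (2 : ℝ),
    hcross, hdir, setIntegral_const, smul_eq_mul]
  · ring
  · exact hy.integrable_sqSum.integrableOn
  · exact (iO.const_mul _).integrableOn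
  · exact (hy.integrable_sqSum.add (iO.const_mul _)).integrableOn
  · exact (iA.const_mul _).integrableOn
  · exact ((hy.integrable_sqSum.add (iO.const_mul _)).add (iA.const_mul _)).integrableOn
  · exact integrable_const _
  · exact (((hy.integrable_sqSum.add (iO.const_mul _)).add (iA.const_mul _)).add
      (integrable_const _)).integrableOn
  · exact iD.integrableOn
  · exact ((((hy.integrable_sqSum.add (iO.const_mul _)).add (iA.const_mul _)).add
      (integrable_const _)).add iD).integrableOn
  · exact iW.integrableOn
  · exact (((((hy.integrable_sqSum.add (iO.const_mul _)).add (iA.const_mul _)).add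
      (integrable_const _)).add iD).add iW).integrableOn
  · exact (iX.const_mul _).integrableOn

/-- The one-step estimates with a single constant. -/
theorem exists_step_constant (hB : DataBounds μ net ρ R β) (hbal : CondBalanced μ net)
    (hf : ∀ j i x, |f j i x| ≤ σ * ‖x‖ + c) (hfm : ∀ j i, Measurable (f j i))
    (x0 : EuclideanSpace ℝ (Fin n)) {Λ : ℝ} (hΛ : 0 ≤ Λ) :
    ∃ C : ℝ, 0 ≤ C ∧ ∀ k (a b lam : ℝ) (y : Ω → Fin N → EuclideanSpace ℝ (Fin n)), 0 ≤ lam →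
      lam ≤ Λ → IsState μ net k y →
      (∀ S, MeasurableSet[net.history k] S →
        ∫ ω in S, sqSum (y ω + net.driftAt x0 a b lam k ω (y ω) + net.noiseAt f a b k ω (y ω)) ∂μ
          ≤ ∫ ω in S, sqSum (y ω) ∂μ
            - 2 * (b * ∫ ω in S, dirichlet (net.A k ω) (y ω) ∂μ
              + a * ∫ ω in S, net.obsEnergy k ω (y ω) ∂μ)
            + C * (a ^ 2 + b ^ 2 + lam) * (∫ ω in S, sqSum (y ω) ∂μ + μ.real S)) ∧
      ∫ ω, sqSum (net.driftAt x0 a b lam k ω (y ω) + net.noiseAt f a b k ω (y ω)) ∂μ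
        ≤ C * (a ^ 2 + b ^ 2 + lam) * (∫ ω, sqSum (y ω) ∂μ + 1) := by
  have hR := hB.R_nonneg
  have hβ := hB.β_nonneg
  set C1 := 3 * R + 12 * N ^ 2 * ρ ^ 2 + 6 + 6 * N * ‖x0‖ ^ 2 with hC1
  set C2 := 2 * β * R + 2 * (N * ρ ^ 2 * (8 * σ ^ 2 + 2 * c ^ 2)) * β with hC2
  have hC10 : 0 ≤ C1 := by positivity
  have hC20 : 0 ≤ C2 := by positivity
  set X := N * ‖x0‖ ^ 2 with hX
  have hX0 : 0 ≤ X := by positivity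
  -- The factor `2` comes from `‖D + W‖² ≤ 2 ‖D‖² + 2 ‖W‖²` in the displacement bound, and `X` from
  -- the regularization bias.
  refine ⟨2 * (C1 * (1 + Λ) + C2) + X, by positivity, fun k a b lam y hlam hlamΛ hy => ?_⟩
  -- The drift produces `λ²`, which `λ ≤ Λ` reduces to order `λ`.
  have hsq : a ^ 2 + b ^ 2 + lam ^ 2 ≤ (1 + Λ) * (a ^ 2 + b ^ 2 + lam) := by
    nlinarith [mul_nonneg hΛ (sq_nonneg a), mul_nonneg hΛ (sq_nonneg b),
      mul_le_mul_of_nonneg_left hlamΛ hlam]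
  have hsq2 : a ^ 2 + b ^ 2 ≤ a ^ 2 + b ^ 2 + lam := by linarith
  set ε := a ^ 2 + b ^ 2 + lam with hε
  have hε0 : 0 ≤ ε := by positivity
  have hboth : ∀ S, MeasurableSet[net.history k] S →
      ∫ ω in S, sqSum (net.driftAt x0 a b lam k ω (y ω)) ∂μ
        + ∫ ω in S, sqSum (net.noiseAt f a b k ω (y ω)) ∂μ
        ≤ (C1 * (1 + Λ) + C2) * ε * (∫ ω in S, sqSum (y ω) ∂μ + μ.real S) := by
    intro S hS
    have h1 := hB.setIntegral_sqSum_driftAt_le (x0 := x0) (a := a) (b := b) (lam := lam) hy hS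
    have h2 := hB.setIntegral_sqSum_noiseAt_le (a := a) (b := b) hf hfm hy hS
    have hV0 : 0 ≤ ∫ ω in S, sqSum (y ω) ∂μ + μ.real S :=
      add_nonneg (integral_nonneg fun ω => sqSum_nonneg _) measureReal_nonneg
    have h3 := mul_le_mul_of_nonneg_right (mul_le_mul_of_nonneg_left hsq hC10) hV0
    have h4 := mul_le_mul_of_nonneg_right (mul_le_mul_of_nonneg_left hsq2 hC20) hV0
    refine (add_le_add (h1.trans h3) (h2.trans h4)).trans (le_of_eq ?_)
    ring
  constructor
  · intro S hS
    have h1 := hB.setIntegral_sqSum_next_le (x0 := x0) (a := a) (b := b) hbal hf hfm hlam hy hS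
    have h2 := hboth S hS
    have hV0 : 0 ≤ ∫ ω in S, sqSum (y ω) ∂μ := integral_nonneg fun ω => sqSum_nonneg _
    have hs0 : 0 ≤ μ.real S := measureReal_nonneg
    have hle : lam ≤ ε := by rw [hε]; nlinarith [sq_nonneg a, sq_nonneg b]
    have h3 : lam * X * μ.real S ≤ X * ε * (∫ ω in S, sqSum (y ω) ∂μ + μ.real S) := by
      calc lam * X * μ.real S = X * lam * μ.real S := by ring
        _ ≤ X * ε * (∫ ω in S, sqSum (y ω) ∂μ + μ.real S) :=
          mul_le_mul (mul_le_mul_of_nonneg_left hle hX0) (by linarith) hs0 (by positivity)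
    have h4 : 0 ≤ (C1 * (1 + Λ) + C2) * ε * (∫ ω in S, sqSum (y ω) ∂μ + μ.real S) := by
      positivity
    linarith
  · have h1 := hboth Set.univ MeasurableSet.univ
    simp only [setIntegral_univ, probReal_univ] at h1
    have hD := hB.memLp_driftAt (x0 := x0) (a := a) (b := b) (lam := lam) hy
    have hW := hB.memLp_noiseAt (a := a) (b := b) hf hfm hy
    have iD := integrable_sqSum_of_memLp hD
    have iW := integrable_sqSum_of_memLp hW
    have h2 : ∫ ω, sqSum (net.driftAt x0 a b lam k ω (y ω) + net.noiseAt f a b k ω (y ω)) ∂μ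
        ≤ ∫ ω, (2 * sqSum (net.driftAt x0 a b lam k ω (y ω))
          + 2 * sqSum (net.noiseAt f a b k ω (y ω))) ∂μ :=
      integral_mono (integrable_sqSum_of_memLp fun i => (hD i).add (hW i))
        ((iD.const_mul 2).add (iW.const_mul 2)) fun ω => sqSum_add_le _ _
    rw [integral_add (iD.const_mul 2) (iW.const_mul 2), integral_const_mul, integral_const_mul]
      at h2
    have hV0 : 0 ≤ ∫ ω, sqSum (y ω) ∂μ := integral_nonneg fun ω => sqSum_nonneg _
    have h3 : 0 ≤ X * ε * (∫ ω, sqSum (y ω) ∂μ + 1) := by positivity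
    linarith

end DataBounds

end

/-! ### The error recursion and its descent inequalities. -/

section

variable {Ω : Type*} [mΩ : MeasurableSpace Ω] {N n : ℕ} {d : Fin N → ℕ}

/-- The estimation errors. -/
def Network.error (net : Network Ω N n d) (x0 : EuclideanSpace ℝ (Fin n))
    (f : Fin N → Fin N → EuclideanSpace ℝ (Fin n) → ℝ) (a b lam : ℕ → ℝ)
    (xinit : Fin N → EuclideanSpace ℝ (Fin n)) (k : ℕ) (ω : Ω) (i : Fin N) :
    EuclideanSpace ℝ (Fin n) :=
  net.estimate x0 f a b lam xinit k ω i - x0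

/-- Subtracting `x₀` turns the innovation into `v - H e` and leaves differences between nodes
unchanged; only the regularization still sees `x₀`. -/
theorem Network.error_succ (net : Network Ω N n d) (x0 : EuclideanSpace ℝ (Fin n))
    (f : Fin N → Fin N → EuclideanSpace ℝ (Fin n) → ℝ) (a b lam : ℕ → ℝ)
    (xinit : Fin N → EuclideanSpace ℝ (Fin n)) (k : ℕ) (ω : Ω) :
    net.error x0 f a b lam xinit (k + 1) ω = net.error x0 f a b lam xinit k ω
      + net.driftAt x0 (a k) (b k) (lam k) k ω (net.error x0 f a b lam xinit k ω)
      + net.noiseAt f (a k) (b k) k ω (net.error x0 f a b lam xinit k ω) := by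
  funext i
  set x := net.estimate x0 f a b lam xinit k ω with hx
  have he : ∀ i, net.error x0 f a b lam xinit k ω i = x i - x0 := fun i => rfl
  have hsucc : net.error x0 f a b lam xinit (k + 1) ω i = x i
      + a k • Matrix.toEuclideanLin (net.H k i ω).transpose
          (net.obs x0 k i ω - Matrix.toEuclideanLin (net.H k i ω) (x i))
      + b k • ∑ j ∈ neighbors (net.A k ω) i, net.A k ω i j • (net.message f x k j i ω - x i)
      - lam k • x i - x0 := rfl
  have hobs : net.obs x0 k i ω - Matrix.toEuclideanLin (net.H k i ω) (x i)
      = net.v k i ω - Matrix.toEuclideanLin (net.H k i ω) (x i - x0) := by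
    rw [Network.obs, map_sub]
    abel
  have hsum : ∑ j ∈ neighbors (net.A k ω) i, net.A k ω i j • (net.message f x k j i ω - x i)
      = ∑ j, net.A k ω i j • ((x j - x0) - (x i - x0))
        + ∑ j, (net.A k ω i j * f j i ((x j - x0) - (x i - x0))) • net.ξ k j i ω := by
    -- Non-neighbours carry weight zero, so the sum extends to all nodes.
    rw [neighbors, Finset.sum_filter, ← Finset.sum_add_distrib]
    refine Finset.sum_congr rfl fun j _ => ?_
    split_ifs with h
    · rw [Network.message, sub_sub_sub_cancel_right, mul_smul, ← smul_add]
      congr 1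
      abel
    · rw [not_not.1 h]
      simp
  rw [hsucc, hobs, hsum, map_sub]
  simp only [Pi.add_apply, Network.driftAt, Network.noiseAt, drift, noisePart, innovation,
    consensus, measurementNoise, channelNoise, he]
  rw [sub_add_cancel]
  module

variable {μ : Measure Ω} [IsProbabilityMeasure μ] {net : Network Ω N n d} {ρ R β σ c : ℝ}
  {x0 : EuclideanSpace ℝ (Fin n)} {f : Fin N → Fin N → EuclideanSpace ℝ (Fin n) → ℝ}
  {a b lam : ℕ → ℝ} {xinit : Fin N → EuclideanSpace ℝ (Fin n)}

theorem DataBounds.isState_error (hB : DataBounds μ net ρ R β)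
    (hf : ∀ j i x, |f j i x| ≤ σ * ‖x‖ + c) (hfm : ∀ j i, Measurable (f j i)) (k : ℕ) :
    IsState μ net k (net.error x0 f a b lam xinit k) := by
  induction k with
  | zero => exact ⟨fun i => stronglyMeasurable_const (b := xinit i - x0), fun i => memLp_const (xinit i - x0)⟩
  | succ k ih =>
    have e : net.error x0 f a b lam xinit (k + 1) = _ :=
      funext fun ω => net.error_succ x0 f a b lam xinit k ω
    rw [e]
    exact hB.isState_next hf hfm ih

/-- The recursive inequalities for the expected squared error, over one step and over a block. -/
theorem DataBounds.exists_descent (hB : DataBounds μ net ρ R β) (hbal : CondBalanced μ net)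
    (hN : N ≠ 0)
    (hconn : UniformlyCondJointlyConnected μ net.history fun k ω => symmetrized (net.A k ω))
    (hobs : UniformlyCondJointlyObservable μ net)
    (hf : ∀ j i x, |f j i x| ≤ σ * ‖x‖ + c) (hfm : ∀ j i, Measurable (f j i))
    (x0 : EuclideanSpace ℝ (Fin n)) (xinit : Fin N → EuclideanSpace ℝ (Fin n))
    (hnn : ∀ k, 0 ≤ a k ∧ 0 ≤ b k ∧ 0 ≤ lam k) (hanti : Antitone a ∧ Antitone b ∧ Antitone lam) :
    ∃ h : ℕ, 0 < h ∧ ∃ c' : ℝ, 0 < c' ∧ ∃ C : ℝ, 0 ≤ C ∧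
      (∀ k S, MeasurableSet[net.history k] S →
        ∫ ω in S, sqSum (net.error x0 f a b lam xinit (k + 1) ω) ∂μ
          ≤ ∫ ω in S, sqSum (net.error x0 f a b lam xinit k ω) ∂μ
            + C * (a k ^ 2 + b k ^ 2 + lam k) *
              (∫ ω in S, sqSum (net.error x0 f a b lam xinit k ω) ∂μ + μ.real S)) ∧
      ∀ m, ∫ ω, sqSum (net.error x0 f a b lam xinit ((m + 1) * h) ω) ∂μ
        ≤ ∫ ω, sqSum (net.error x0 f a b lam xinit (m * h) ω) ∂μ
          - c' * min (a ((m + 1) * h)) (b ((m + 1) * h)) *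
            ∫ ω, sqSum (net.error x0 f a b lam xinit (m * h) ω) ∂μ
          + C * (∑ j ∈ Finset.range h,
              (a (m * h + j) ^ 2 + b (m * h + j) ^ 2 + lam (m * h + j)))
            * (1 + ∫ ω, sqSum (net.error x0 f a b lam xinit (m * h) ω) ∂μ) := by
  obtain ⟨h, hh, c', hc', hex⟩ := hB.excitation hbal hN hconn hobs
  obtain ⟨C0, hC0, hstep⟩ := hB.exists_step_constant hbal hf hfm x0 (hnn 0).2.2
  have hR := hB.R_nonneg
  have hρ := hB.ρ_nonneg
  set e := net.error x0 f a b lam xinit with he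
  have hst : ∀ k, IsState μ net k (e k) := hB.isState_error hf hfm
  have hle : ∀ k, a k ≤ a 0 ∧ b k ≤ b 0 ∧ lam k ≤ lam 0 := fun k =>
    ⟨hanti.1 (Nat.zero_le k), hanti.2.1 (Nat.zero_le k), hanti.2.2 (Nat.zero_le k)⟩
  have ha0 := (hnn 0).1
  have hb0 := (hnn 0).2.1
  have hl0 := (hnn 0).2.2
  have hε0 : ∀ k, 0 ≤ a k ^ 2 + b k ^ 2 + lam k := fun k => by
    have := (hnn k).2.2
    positivity
  have hdir : ∀ k l, l ≤ k → 0 ≤ ∫ ω, dirichlet (net.A k ω) (e l ω) ∂μ := fun k l hl =>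
    hB.integral_dirichlet_nonneg hbal ((hst l).mono hl)
  have hob : ∀ k l, 0 ≤ ∫ ω, net.obsEnergy k ω (e l ω) ∂μ := fun k l =>
    integral_nonneg fun ω => net.obsEnergy_nonneg k ω _
  have hV : ∀ k, 0 ≤ ∫ ω, sqSum (e k ω) ∂μ := fun k => integral_nonneg fun ω => sqSum_nonneg _
  have hset : ∀ k S, MeasurableSet[net.history k] S →
      ∫ ω in S, sqSum (e (k + 1) ω) ∂μ ≤ ∫ ω in S, sqSum (e k ω) ∂μ
        - 2 * (b k * ∫ ω in S, dirichlet (net.A k ω) (e k ω) ∂μ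
          + a k * ∫ ω in S, net.obsEnergy k ω (e k ω) ∂μ)
        + C0 * (a k ^ 2 + b k ^ 2 + lam k) * (∫ ω in S, sqSum (e k ω) ∂μ + μ.real S) := by
    intro k S hS
    have := (hstep k (a k) (b k) (lam k) (e k) (hnn k).2.2 (hle k).2.2 (hst k)).1 S hS
    simpa only [he, net.error_succ] using this
  have hinc : ∀ k, ∫ ω, sqSum (e (k + 1) ω - e k ω) ∂μ
      ≤ C0 * (a k ^ 2 + b k ^ 2 + lam k) * (∫ ω, sqSum (e k ω) ∂μ + 1) := by
    intro k
    have h1 := (hstep k (a k) (b k) (lam k) (e k) (hnn k).2.2 (hle k).2.2 (hst k)).2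
    have h2 : ∀ ω, e (k + 1) ω - e k ω = net.driftAt x0 (a k) (b k) (lam k) k ω (e k ω)
        + net.noiseAt f (a k) (b k) k ω (e k ω) := fun ω => by
      rw [he, net.error_succ]
      abel
    simpa only [h2] using h1
  -- The single constant required by `block_descent`: `2 * C0` covers the one-step errors and the
  -- displacement, while the other terms bound the cost of freezing the state, using that the gains
  -- are nonincreasing.
  set C := 2 * C0 + b 0 * (2 * N * ρ) + a 0 * R with hC
  have hC' : 0 ≤ C := by positivity
  have hCC0 : C0 ≤ C := by
    have h1 : 0 ≤ b 0 * (2 * N * ρ) := by positivity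
    have h2 : 0 ≤ a 0 * R := by positivity
    linarith
  have h2CC0 : 2 * C0 ≤ C := by
    have h1 : 0 ≤ b 0 * (2 * N * ρ) := by positivity
    have h2 : 0 ≤ a 0 * R := by positivity
    linarith
  set E := a 0 ^ 2 + b 0 ^ 2 + lam 0 with hE
  have hεE : ∀ k, a k ^ 2 + b k ^ 2 + lam k ≤ E := fun k =>
    add_le_add (add_le_add (pow_le_pow_left₀ (hnn k).1 (hle k).1 2)
      (pow_le_pow_left₀ (hnn k).2.1 (hle k).2.1 2)) (hle k).2.2
  set C'' := (2 * h * 2 ^ h * C + 1) * C * (1 + C * E) ^ h with hC''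
  have hC''0 : 0 ≤ C'' := by
    have := hε0 0
    positivity
  refine ⟨h, hh, c', hc', C + C'', by positivity, fun k S hS => ?_, fun m => ?_⟩
  · refine (hset k S hS).trans ?_
    have h1 : 0 ≤ ∫ ω in S, dirichlet (net.A k ω) (e k ω) ∂μ :=
      hB.setIntegral_dirichlet_nonneg hbal (hst k) hS
    have h2 : 0 ≤ ∫ ω in S, net.obsEnergy k ω (e k ω) ∂μ :=
      integral_nonneg fun ω => net.obsEnergy_nonneg k ω _
    have h3 : 0 ≤ ∫ ω in S, sqSum (e k ω) ∂μ + μ.real S :=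
      add_nonneg (integral_nonneg fun ω => sqSum_nonneg _) measureReal_nonneg
    have h4 := mul_nonneg (hnn k).2.1 h1
    have h5 := mul_nonneg (hnn k).1 h2
    have h6 := mul_le_mul_of_nonneg_right (mul_le_mul_of_nonneg_right
      (by linarith : C0 ≤ C + C'') (hε0 k)) h3
    linarith
  · set T := m * h with hT
    have hTh : (m + 1) * h = T + h := Nat.succ_mul m h
    have hanti' : ∀ j < h, T + j ≤ T + h := fun j hj => by omega
    -- The rate `g` is taken at the end of the block, where nonincreasing gains are smallest, so it
    -- bounds both gains from below throughout.
    have key := block_descent (h := h) (C := C) (E := E) (c := c')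
      (g := min (a (T + h)) (b (T + h)))
      (u := fun j => ∫ ω, sqSum (e (T + j) ω) ∂μ)
      (q := fun j => b (T + j) * ∫ ω, dirichlet (net.A (T + j) ω) (e (T + j) ω) ∂μ
        + a (T + j) * ∫ ω, net.obsEnergy (T + j) ω (e (T + j) ω) ∂μ)
      (w := fun j => ∫ ω, sqSum (e (T + j) ω - e T ω) ∂μ)
      (p := fun j => ∫ ω, dirichlet (net.A (T + j) ω) (e T ω) ∂μ)
      (o := fun j => ∫ ω, net.obsEnergy (T + j) ω (e T ω) ∂μ)
      (a := fun j => a (T + j)) (b := fun j => b (T + j))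
      (ε := fun j => a (T + j) ^ 2 + b (T + j) ^ 2 + lam (T + j))
      hC' (hε0 0) (le_min (hnn _).1 (hnn _).2.1) (fun j => hV _)
      (fun j => add_nonneg (mul_nonneg (hnn _).2.1 (hdir _ _ le_rfl))
        (mul_nonneg (hnn _).1 (hob _ _)))
      (fun j => hdir _ _ (Nat.le_add_right _ _)) (fun j => hob _ _)
      (fun j => ⟨hε0 _, hεE _⟩) ?_ ?_ ?_ ?_
      (fun j hj => (min_le_left _ _).trans (hanti.1 (hanti' j hj)))
      (fun j hj => (min_le_right _ _).trans (hanti.2.1 (hanti' j hj)))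
      (hex m (e T) (hst T))
    · rw [hTh]
      simp only [Nat.add_zero] at key
      refine key.trans ?_
      have h1 : 0 ≤ C * (∑ j ∈ Finset.range h, (a (T + j) ^ 2 + b (T + j) ^ 2 + lam (T + j)))
          * (1 + ∫ ω, sqSum (e T ω) ∂μ) :=
        mul_nonneg (mul_nonneg hC' (Finset.sum_nonneg fun j _ => hε0 _)) (by linarith [hV T])
      linarith
    · intro j _
      have h1 := hset (T + j) Set.univ MeasurableSet.univ
      simp only [setIntegral_univ, probReal_univ] at h1
      refine h1.trans ?_
      have h2 := mul_le_mul_of_nonneg_right (mul_le_mul_of_nonneg_right hCC0 (hε0 (T + j)))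
        (by linarith [hV (T + j)] : 0 ≤ 1 + ∫ ω, sqSum (e (T + j) ω) ∂μ)
      linarith
    · intro j _
      have hTs := (hst T).mono (Nat.le_add_right T j)
      have h1 := mul_le_mul_of_nonneg_left
        (hB.integral_half_dirichlet_sub_le hbal (hst (T + j)) hTs) (hnn (T + j)).2.1
      have h2 := mul_le_mul_of_nonneg_left
        (hB.integral_half_obsEnergy_sub_le (hst (T + j)) hTs) (hnn (T + j)).1
      set W := ∫ ω, sqSum (e (T + j) ω - e T ω) ∂μ with hW
      have hW0 : 0 ≤ W := integral_nonneg fun ω => sqSum_nonneg _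
      have h3 := mul_le_mul_of_nonneg_right (hle (T + j)).2.1
        (by positivity : 0 ≤ 2 * N * ρ * W)
      have h4 := mul_le_mul_of_nonneg_right (hle (T + j)).1 (by positivity : 0 ≤ R * W)
      have h5 : 0 ≤ C0 * W := by positivity
      have h6 : C * W = 2 * (C0 * W) + b 0 * (2 * N * ρ * W) + a 0 * (R * W) := by
        rw [hC]; ring
      rw [h6]
      linarith
    · refine le_of_eq ?_
      simp [sqSum]
    · intro j _
      have hTs := (hst T).mono (Nat.le_add_right T j)
      have hTs' := (hst T).mono (Nat.le_add_right T (j + 1))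
      have i1 := ((hst (T + j)).sub hTs).integrable_sqSum
      have i2 := ((hst (T + j + 1)).sub ((hst (T + j)).mono (Nat.le_succ _))).integrable_sqSum
      have i3 := ((hst (T + (j + 1))).sub hTs').integrable_sqSum
      have h1 : ∫ ω, sqSum (e (T + (j + 1)) ω - e T ω) ∂μ
          ≤ ∫ ω, (2 * sqSum (e (T + j) ω - e T ω)
            + 2 * sqSum (e (T + j + 1) ω - e (T + j) ω)) ∂μ := by
        refine integral_mono i3 ((i1.const_mul 2).add (i2.const_mul 2)) fun ω => ?_
        have e1 : e (T + (j + 1)) ω - e T ω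
            = (e (T + j) ω - e T ω) + (e (T + j + 1) ω - e (T + j) ω) := by
          rw [← add_assoc]; abel
        simp only [e1]
        exact sqSum_add_le _ _
      rw [integral_add (i1.const_mul 2) (i2.const_mul 2), integral_const_mul,
        integral_const_mul] at h1
      have h2 := hinc (T + j)
      have h3 := mul_le_mul_of_nonneg_right (mul_le_mul_of_nonneg_right h2CC0 (hε0 (T + j)))
        (by linarith [hV (T + j)] : 0 ≤ 1 + ∫ ω, sqSum (e (T + j) ω) ∂μ)
      linarith

end

end DecReg

end

/-! ### Conclusion: almost sure and mean square convergence. -/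

theorem theorem2 {Ω : Type*} [MeasurableSpace Ω] (μ : MeasureTheory.Measure Ω)
    [MeasureTheory.IsProbabilityMeasure μ]
    {N n : ℕ} (hN : 2 ≤ N) {d : Fin N → ℕ}
    (net : DecReg.Network Ω N n d)
    (x0 : EuclideanSpace ℝ (Fin n))
    (f : Fin N → Fin N → EuclideanSpace ℝ (Fin n) → ℝ)
    (a b lam : ℕ → ℝ)
    (xinit : Fin N → EuclideanSpace ℝ (Fin n))
    (hbal : DecReg.CondBalanced μ net)
    (hA1 : DecReg.NoiseIntensityGrowth f)
    (hA2 : DecReg.NoiseAssumption μ net)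
    (hconn : DecReg.UniformlyCondJointlyConnected μ net.history
      (fun k ω => DecReg.symmetrized (net.A k ω)))
    (hobs : DecReg.UniformlyCondJointlyObservable μ net)
    (hmom : ∃ h : ℕ, 0 < h ∧ ∃ ρ : ℝ, 0 < ρ ∧ DecReg.MomentBound μ net h ρ) :
    (DecReg.GainC1 a b lam →
      ∀ᵐ ω ∂μ, ∀ i, Filter.Tendsto
        (fun k => net.estimate x0 f a b lam xinit k ω i) Filter.atTop (nhds x0)) ∧
    (DecReg.GainC2 a b lam →
      ∀ i,
        (∀ k, MeasureTheory.Integrable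
          (fun ω => ‖net.estimate x0 f a b lam xinit k ω i - x0‖ ^ 2) μ) ∧
        Filter.Tendsto
          (fun k => ∫ ω, ‖net.estimate x0 f a b lam xinit k ω i - x0‖ ^ 2 ∂μ)
          Filter.atTop (nhds 0)) := by
  obtain ⟨_, _, _, _, hmom⟩ := hmom
  obtain ⟨ρ, R, β, hB⟩ := DecReg.exists_dataBounds hA2 hmom
  obtain ⟨σ, c, hf⟩ := hA1.growth
  have hfm := hA1.measurable
  have hst : ∀ k, DecReg.IsState μ net k (net.error x0 f a b lam xinit k) :=
    hB.isState_error hf hfm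
  have hV0 : ∀ k ω, 0 ≤ DecReg.sqSum (net.error x0 f a b lam xinit k ω) :=
    fun k ω => DecReg.sqSum_nonneg _
  have hu : ∀ k, 0 ≤ ∫ ω, DecReg.sqSum (net.error x0 f a b lam xinit k ω) ∂μ :=
    fun k => integral_nonneg fun ω => hV0 k ω
  constructor
  · intro hg
    obtain ⟨h, hh, c', hc', C, hC, hstep, hblock⟩ :=
      hB.exists_descent hbal (by omega) hconn hobs hf hfm x0 xinit hg.nonneg hg.anti
    have hα : ∀ k, 0 ≤ C * (a k ^ 2 + b k ^ 2 + lam k) := fun k => by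
      have := (hg.nonneg k).2.2
      positivity
    -- The one-step inequality on past events gives an almost sure limit, which the block inequality
    -- then shows to be zero.
    have hconv := DecReg.ae_exists_tendsto_of_almost_supermartingale net.filtration hV0
      (fun k => (hst k).stronglyMeasurable_sqSum) (fun k => (hst k).integrable_sqSum) hα
      (hg.summable.mul_left C) hstep
    have hzero := DecReg.ae_tendsto_zero_of_frequently_integral_lt hV0
      (fun k => ((hst k).stronglyMeasurable_sqSum.mono (net.history_le k)).measurable)
      (fun k => (hst k).integrable_sqSum) hconv
      (fun δ hδ => DecReg.frequently_lt_of_gainC1 hg hh hc' hC hu hblock hδ)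
    filter_upwards [hzero] with ω hω i
    rw [tendsto_iff_norm_sub_tendsto_zero]
    have h1 : Tendsto (fun k => Real.sqrt (DecReg.sqSum (net.error x0 f a b lam xinit k ω)))
        atTop (𝓝 0) := by
      have := (Real.continuous_sqrt.tendsto 0).comp hω
      rwa [Real.sqrt_zero] at this
    refine squeeze_zero (fun k => norm_nonneg _) (fun k => ?_) h1
    exact Real.le_sqrt_of_sq_le (DecReg.norm_sq_le_sqSum (net.error x0 f a b lam xinit k ω) i)
  · intro hg i
    obtain ⟨h, hh, c', hc', C, hC, hstep, hblock⟩ :=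
      hB.exists_descent hbal (by omega) hconn hobs hf hfm x0 xinit hg.nonneg hg.anti
    have hi : ∀ k, Integrable (fun ω => ‖net.estimate x0 f a b lam xinit k ω i - x0‖ ^ 2) μ :=
      fun k => (hst k).integrable_norm_sq i
    refine ⟨hi, ?_⟩
    -- On the whole space the event inequality becomes the one-step bound that carries convergence
    -- from block starts to all times.
    have hlim := DecReg.tendsto_zero_of_gainC2 hg hh hc' hC hu (fun k => by
      have := hstep k Set.univ MeasurableSet.univ
      simp only [setIntegral_univ, probReal_univ] at this
      rwa [add_comm (1 : ℝ)]) hblock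
    refine squeeze_zero (fun k => integral_nonneg fun ω => sq_nonneg _) (fun k => ?_) hlim
    exact integral_mono (hi k) (hst k).integrable_sqSum fun ω =>
      DecReg.norm_sq_le_sqSum (net.error x0 f a b lam xinit k ω) i
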